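/- Let $(M,\omega)$ be a symplectic orbifold, represented by a proper Lie groupoid $X_1\rightrightarrows X_0$ with finite isotropy groups (the orbifold need not be effective), so that forms, functions and line bundles on $M$ are invariant forms, invariant functions and equivariant line bundles on $X_0$. Let $S^1$ act smoothly on $M$ (by automorphisms of the groupoid), and let $\mathcal X$ be the vector field generating the action of $e^{i\varphi}$ ($\mathcal X=\frac{d}{d\varphi}$). Fix $c>0$, and let $\Phi:M\to\mathbb R$ be a moment map with the normalization $\iota(c\,\mathcal X)\omega=d\Phi$ ($c=2\pi$ is the normalization in which the weights are integers, and for $c=2$ the formula for $\psi$ below reads $\psi=\Phi-|z|^2$). Suppose that $0$ is a regular value of $\Phi$. Let $L\to M$ be a pre-quantum line bundle, that is, an orbifold Hermitian line bundle with Hermitian connection $\nabla$ such that $\frac{i}{2\pi}\mathrm{curv}(\nabla)=\omega$, with a smooth lift of the $S^1$-action to $L$ by unitary bundle maps whose generating vector field satisfies Kostant's formula $\xi_L=\mathrm{Lift}(\xi_M)+2\pi\Phi\,\frac{\partial}{\partial\phi}$ for $\xi_M=c\,\mathcal X$, where $\frac{\partial}{\partial\phi}$ generates the scalar multiplication by $e^{i\phi}$.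 Let $L_{\mathbb C}=\mathbb C\times\mathbb C\to\mathbb C$ be the trivial line bundle with fibre metric $e^{-\pi|z|^2}\bar w_1w_2$, connection $d-\pi z\,d\bar z$ and trivial lift of the action. Let $S^1$ act on $M\times\mathbb C$ by $e^{i\varphi}\cdot(x,z)=(e^{i\varphi}\cdot x,e^{-i\varphi}z)$, with symplectic form $\omega-\frac i2dz\wedge d\bar z$ and moment map $\psi(x,z)=\Phi(x)-\frac c2|z|^2$. Put $M_{red}=\Phi^{-1}(0)/S^1$, $L_{red}=(L|\Phi^{-1}(0))/S^1$, $M_+=\psi^{-1}(0)/S^1$ and $L_+=(L\boxtimes L_{\mathbb C}|\psi^{-1}(0))/S^1$. Then: 1. The metric and the connection of $L|\Phi^{-1}(0)$ and of $L\boxtimes L_{\mathbb C}|\psi^{-1}(0)$ descend, so that $L_{red}\to M_{red}$ and $L_+\to M_+$ are orbifold Hermitian line bundles with Hermitian connection. 2. The maps $x\mapsto[x,\sqrt{2\Phi(x)/c}\,]$ and $[x]\mapsto[x,0]$ are isomorphisms from the orbifold $\{\Phi>0\}\subset M$ onto $\{\Phi>0\}\subset M_+$ and from $M_{red}$ onto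 $\{z=0\}\subset M_+$, and they preserve the symplectic forms. 3. Over these identifications there are canonical isomorphisms of orbifold Hermitian line bundles with connection $$L_+|\{\Phi>0\}\cong L|\{\Phi>0\},\qquad L_+|M_{red}\cong L_{red},$$ namely those induced by $\lambda\mapsto\lambda\otimes e^{\pi\Phi(x)/c}$ for $\lambda\in L_x$, $\Phi(x)>0$, and by $\lambda\mapsto\lambda\otimes1$ for $\lambda\in L_x$, $\Phi(x)=0$. -/

import Mathlib

open Bundle Set Filter Topology
open scoped Manifold ContDiff

noncomputable section

/-! ### Lie groupoids and orbifolds -/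

section LieGroupoids

variable {V₀ : Type*} [NormedAddCommGroup V₀] [NormedSpace ℝ V₀]
  {H₀ : Type*} [TopologicalSpace H₀] (I₀ : ModelWithCorners ℝ V₀ H₀)
  (X₀ : Type*) [TopologicalSpace X₀] [ChartedSpace H₀ X₀]
  {V₁ : Type*} [NormedAddCommGroup V₁] [NormedSpace ℝ V₁]
  {H₁ : Type*} [TopologicalSpace H₁] (I₁ : ModelWithCorners ℝ V₁ H₁)
  (X₁ : Type*) [TopologicalSpace X₁] [ChartedSpace H₁ X₁]

/-- A Lie groupoid with manifold of objects `X₀` and manifold of arrows `X₁`. The product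
`mul g h` ("first `h`, then `g`") is meaningful only if `src g = tgt h`; its other values are
irrelevant. -/
structure LieGroupoid where
  src : X₁ → X₀
  tgt : X₁ → X₀
  one : X₀ → X₁
  inv : X₁ → X₁
  mul : X₁ → X₁ → X₁
  src_one : ∀ x, src (one x) = x
  tgt_one : ∀ x, tgt (one x) = x
  src_inv : ∀ g, src (inv g) = tgt g
  tgt_inv : ∀ g, tgt (inv g) = src g
  src_mul : ∀ g h, src g = tgt h → src (mul g h) = src h
  tgt_mul : ∀ g h, src g = tgt h → tgt (mul g h) = tgt g
  mul_assoc : ∀ g h k, src g = tgt h → src h = tgt k → mul (mul g h) k = mul g (mul h k)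
  one_mul : ∀ g, mul (one (tgt g)) g = g
  mul_one : ∀ g, mul g (one (src g)) = g
  inv_mul : ∀ g, mul (inv g) g = one (src g)
  mul_inv : ∀ g, mul g (inv g) = one (tgt g)
  smooth_src : ContMDiff I₁ I₀ ∞ src
  smooth_tgt : ContMDiff I₁ I₀ ∞ tgt
  smooth_one : ContMDiff I₀ I₁ ∞ one
  smooth_inv : ContMDiff I₁ I₁ ∞ inv
  smooth_mul : ContMDiffOn (I₁.prod I₁) I₁ ∞ (fun p : X₁ × X₁ => mul p.1 p.2)
    {p | src p.1 = tgt p.2}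
  submersion_src : ∀ g, Function.Surjective (mfderiv I₁ I₀ src g)

variable {I₀ X₀ I₁ X₁}

/-- A Lie groupoid represents an orbifold if it is proper with finite isotropy groups
(a proper foliation groupoid). Effectivity is not required. -/
structure LieGroupoid.IsOrbifold (G : LieGroupoid I₀ X₀ I₁ X₁) : Prop where
  proper : IsProperMap (fun g => (G.src g, G.tgt g))
  finite_isotropy : ∀ x, {g | G.src g = x ∧ G.tgt g = x}.Finite

/-- A smooth action of the circle on the orbifold represented by a Lie groupoid,
by automorphisms of the groupoid. -/
structure CircleAction (G : LieGroupoid I₀ X₀ I₁ X₁) where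
  obj : Circle → X₀ → X₀
  arr : Circle → X₁ → X₁
  obj_one : ∀ x, obj 1 x = x
  obj_mul : ∀ a b x, obj (a * b) x = obj a (obj b x)
  arr_one : ∀ g, arr 1 g = g
  arr_mul : ∀ a b g, arr (a * b) g = arr a (arr b g)
  src_arr : ∀ a g, G.src (arr a g) = obj a (G.src g)
  tgt_arr : ∀ a g, G.tgt (arr a g) = obj a (G.tgt g)
  mul_arr : ∀ a g h, G.src g = G.tgt h → arr a (G.mul g h) = G.mul (arr a g) (arr a h)
  smooth_obj : ContMDiff ((𝓡 1).prod I₀) I₀ ∞ (fun p : Circle × X₀ => obj p.1 p.2)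
  smooth_arr : ContMDiff ((𝓡 1).prod I₁) I₁ ∞ (fun p : Circle × X₁ => arr p.1 p.2)

namespace CircleAction

variable {G : LieGroupoid I₀ X₀ I₁ X₁} (C : CircleAction G)

theorem arr_unit (a : Circle) (x : X₀) : C.arr a (G.one x) = G.one (C.obj a x) := by
  have h1 : G.mul (G.one x) (G.one x) = G.one x := by
    have := G.mul_one (G.one x)
    rwa [G.src_one] at this
  have h2 : G.mul (C.arr a (G.one x)) (C.arr a (G.one x)) = C.arr a (G.one x) := by
    rw [← C.mul_arr a _ _ (by rw [G.src_one, G.tgt_one]), h1]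
  set k := C.arr a (G.one x) with hk
  have hs : G.src k = C.obj a x := by rw [hk, C.src_arr, G.src_one]
  have ht : G.tgt k = C.obj a x := by rw [hk, C.tgt_arr, G.tgt_one]
  calc k = G.mul (G.one (G.tgt k)) k := (G.one_mul k).symm
    _ = G.mul (G.mul (G.inv k) k) k := by rw [G.inv_mul, ht, hs]
    _ = G.mul (G.inv k) (G.mul k k) := G.mul_assoc _ _ _ (G.src_inv k) (by rw [hs, ht])
    _ = G.one (C.obj a x) := by rw [h2, G.inv_mul, hs]

theorem obj_inv_obj (a : Circle) (x : X₀) : C.obj a⁻¹ (C.obj a x) = x := by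
  rw [← C.obj_mul, inv_mul_cancel, C.obj_one]

theorem arr_inv_arr (a : Circle) (g : X₁) : C.arr a⁻¹ (C.arr a g) = g := by
  rw [← C.arr_mul, inv_mul_cancel, C.arr_one]

/-- The quotient of an orbifold by a circle action, as the semidirect product groupoid: an arrow
`(g, a)` from `x` to `y` is an arrow `g` with source `x` and an `a` in the circle with
`a • tgt g = y`. -/
def quotient : LieGroupoid I₀ X₀ (I₁.prod (𝓡 1)) (X₁ × Circle) where
  src k := G.src k.1
  tgt k := C.obj k.2 (G.tgt k.1)
  one x := (G.one x, 1)
  inv k := (C.arr k.2 (G.inv k.1), k.2⁻¹)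
  mul k l := (G.mul (C.arr l.2⁻¹ k.1) l.1, k.2 * l.2)
  src_one x := G.src_one x
  tgt_one x := by rw [C.obj_one, G.tgt_one]
  src_inv k := by rw [C.src_arr, G.src_inv]
  tgt_inv k := by rw [C.tgt_arr, C.obj_inv_obj, G.tgt_inv]
  src_mul k l h := G.src_mul _ _ (by rw [C.src_arr, h, C.obj_inv_obj])
  tgt_mul k l h := by
    rw [G.tgt_mul _ _ (by rw [C.src_arr, h, C.obj_inv_obj]), C.tgt_arr, ← C.obj_mul]
    simp
  mul_assoc k l m h h' := by
    have e1 : G.src (C.arr l.2⁻¹ k.1) = G.tgt l.1 := by rw [C.src_arr, h, C.obj_inv_obj]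
    have e2 : G.src (C.arr m.2⁻¹ l.1) = G.tgt m.1 := by rw [C.src_arr, h', C.obj_inv_obj]
    refine Prod.ext ?_ (_root_.mul_assoc _ _ _)
    change G.mul (C.arr m.2⁻¹ (G.mul (C.arr l.2⁻¹ k.1) l.1)) m.1
      = G.mul (C.arr (l.2 * m.2)⁻¹ k.1) (G.mul (C.arr m.2⁻¹ l.1) m.1)
    rw [C.mul_arr _ _ _ e1, G.mul_assoc _ _ _ (by rw [C.src_arr, C.tgt_arr, e1]) e2,
      ← C.arr_mul, mul_inv_rev]
  one_mul k := by
    refine Prod.ext ?_ (_root_.one_mul _)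
    change G.mul (C.arr k.2⁻¹ (G.one (C.obj k.2 (G.tgt k.1)))) k.1 = k.1
    rw [C.arr_unit, C.obj_inv_obj, G.one_mul]
  mul_one k := by
    refine Prod.ext ?_ (_root_.mul_one _)
    change G.mul (C.arr 1⁻¹ k.1) (G.one (G.src k.1)) = k.1
    rw [inv_one, C.arr_one, G.mul_one]
  inv_mul k := by
    refine Prod.ext ?_ (_root_.inv_mul_cancel _)
    change G.mul (C.arr k.2⁻¹ (C.arr k.2 (G.inv k.1))) k.1 = G.one (G.src k.1)
    rw [C.arr_inv_arr, G.inv_mul]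
  mul_inv k := by
    refine Prod.ext ?_ (_root_.mul_inv_cancel _)
    change G.mul (C.arr (k.2⁻¹)⁻¹ k.1) (C.arr k.2 (G.inv k.1)) = G.one (C.obj k.2 (G.tgt k.1))
    rw [inv_inv, ← C.mul_arr _ _ _ (G.tgt_inv k.1).symm, G.mul_inv, C.arr_unit]
  smooth_src := G.smooth_src.comp contMDiff_fst
  smooth_tgt := C.smooth_obj.comp (contMDiff_snd.prodMk (G.smooth_tgt.comp contMDiff_fst))
  smooth_one := G.smooth_one.prodMk contMDiff_const
  smooth_inv := (C.smooth_arr.comp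
    (contMDiff_snd.prodMk (G.smooth_inv.comp contMDiff_fst))).prodMk
      ((contMDiff_inv (𝓡 1) ∞).comp contMDiff_snd)
  smooth_mul := by
    refine ContMDiffOn.prodMk ?_ ?_
    · refine G.smooth_mul.comp (t := {p : X₁ × X₁ | G.src p.1 = G.tgt p.2})
        (f := fun p : (X₁ × Circle) × (X₁ × Circle) => (C.arr p.2.2⁻¹ p.1.1, p.2.1))
        (ContMDiff.contMDiffOn ?_) ?_
      · exact (C.smooth_arr.comp ((((contMDiff_inv (𝓡 1) ∞).comp contMDiff_snd).comp
          contMDiff_snd).prodMk (contMDiff_fst.comp contMDiff_fst))).prodMk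
            (contMDiff_fst.comp contMDiff_snd)
      · intro p hp
        change G.src (C.arr p.2.2⁻¹ p.1.1) = G.tgt p.2.1
        have hp' : G.src p.1.1 = C.obj p.2.2 (G.tgt p.2.1) := hp
        rw [C.src_arr, hp', C.obj_inv_obj]
    · exact ((contMDiff_snd.comp contMDiff_fst).mul
        (contMDiff_snd.comp contMDiff_snd)).contMDiffOn
  submersion_src k := by
    have h : mfderiv (I₁.prod (𝓡 1)) I₀ (G.src ∘ (Prod.fst : X₁ × Circle → X₁)) k
        = (mfderiv I₁ I₀ G.src k.1).comp (mfderiv (I₁.prod (𝓡 1)) I₁ Prod.fst k) :=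
      mfderiv_comp k (G.smooth_src.mdifferentiable (by simp) _)
        ((contMDiff_fst (n := ∞)).mdifferentiable (by simp) _)
    change Function.Surjective (mfderiv (I₁.prod (𝓡 1)) I₀ (G.src ∘ Prod.fst) k)
    rw [h, mfderiv_fst]
    exact (G.submersion_src k.1).comp Prod.fst_surjective

end CircleAction

/-- The product of an orbifold with the complex plane. -/
def LieGroupoid.prodC (G : LieGroupoid I₀ X₀ I₁ X₁) :
    LieGroupoid (I₀.prod 𝓘(ℝ, ℂ)) (X₀ × ℂ) (I₁.prod 𝓘(ℝ, ℂ)) (X₁ × ℂ) where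
  src k := (G.src k.1, k.2)
  tgt k := (G.tgt k.1, k.2)
  one p := (G.one p.1, p.2)
  inv k := (G.inv k.1, k.2)
  mul k l := (G.mul k.1 l.1, l.2)
  src_one p := Prod.ext (G.src_one _) rfl
  tgt_one p := Prod.ext (G.tgt_one _) rfl
  src_inv k := Prod.ext (G.src_inv _) rfl
  tgt_inv k := Prod.ext (G.tgt_inv _) rfl
  src_mul k l h := Prod.ext (G.src_mul _ _ (congrArg Prod.fst h)) rfl
  tgt_mul k l h := Prod.ext (G.tgt_mul _ _ (congrArg Prod.fst h)) (congrArg Prod.snd h).symm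
  mul_assoc k l m h h' :=
    Prod.ext (G.mul_assoc _ _ _ (congrArg Prod.fst h) (congrArg Prod.fst h')) rfl
  one_mul k := Prod.ext (G.one_mul _) rfl
  mul_one k := Prod.ext (G.mul_one _) rfl
  inv_mul k := Prod.ext (G.inv_mul _) rfl
  mul_inv k := Prod.ext (G.mul_inv _) rfl
  smooth_src := (G.smooth_src.comp contMDiff_fst).prodMk contMDiff_snd
  smooth_tgt := (G.smooth_tgt.comp contMDiff_fst).prodMk contMDiff_snd
  smooth_one := (G.smooth_one.comp contMDiff_fst).prodMk contMDiff_snd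
  smooth_inv := (G.smooth_inv.comp contMDiff_fst).prodMk contMDiff_snd
  smooth_mul := by
    refine ContMDiffOn.prodMk ?_ (contMDiff_snd.comp contMDiff_snd).contMDiffOn
    exact G.smooth_mul.comp (t := {p : X₁ × X₁ | G.src p.1 = G.tgt p.2})
      (f := fun p : (X₁ × ℂ) × (X₁ × ℂ) => (p.1.1, p.2.1))
      (((contMDiff_fst.comp contMDiff_fst).prodMk
        (contMDiff_fst.comp contMDiff_snd)).contMDiffOn)
      (fun p hp => congrArg Prod.fst hp)
  submersion_src k := by
    change Function.Surjective (mfderiv (I₁.prod 𝓘(ℝ, ℂ)) (I₀.prod 𝓘(ℝ, ℂ))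
      (Prod.map G.src (id : ℂ → ℂ)) k)
    rw [mfderiv_prodMap (G.smooth_src.mdifferentiable (by simp) _) mdifferentiableAt_id,
      mfderiv_id]
    exact (G.submersion_src k.1).prodMap Function.surjective_id

theorem contMDiff_circle_val :
    ContMDiff (𝓡 1) 𝓘(ℝ, ℂ) ∞ (fun a : Circle => (a : ℂ)) :=
  haveI : Fact (Module.finrank ℝ ℂ = 1 + 1) := ⟨Complex.finrank_real_complex⟩
  contMDiff_coe_sphere (E := ℂ) (n := 1)

theorem contMDiff_mul_complex {f k : Circle × (X₀ × ℂ) → ℂ}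
    (hf : ContMDiff ((𝓡 1).prod (I₀.prod 𝓘(ℝ, ℂ))) 𝓘(ℝ, ℂ) ∞ f)
    (hk : ContMDiff ((𝓡 1).prod (I₀.prod 𝓘(ℝ, ℂ))) 𝓘(ℝ, ℂ) ∞ k) :
    ContMDiff ((𝓡 1).prod (I₀.prod 𝓘(ℝ, ℂ))) 𝓘(ℝ, ℂ) ∞ (fun p => f p * k p) :=
  (((ContinuousLinearMap.mul ℝ ℂ).contDiff.contMDiff).comp hf).clm_apply hk

/-- The action `a • (x, z) = (a • x, a⁻¹ z)` of the circle on the product with the plane. -/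
def CircleAction.prodC {G : LieGroupoid I₀ X₀ I₁ X₁} (C : CircleAction G) :
    CircleAction G.prodC where
  obj a p := (C.obj a p.1, ((a⁻¹ : Circle) : ℂ) * p.2)
  arr a k := (C.arr a k.1, ((a⁻¹ : Circle) : ℂ) * k.2)
  obj_one p := by simp [C.obj_one]
  obj_mul a b p := Prod.ext (C.obj_mul _ _ _) (by simp only [_root_.mul_inv, Circle.coe_mul]; ring)
  arr_one k := by simp [C.arr_one]
  arr_mul a b k := Prod.ext (C.arr_mul _ _ _) (by simp only [_root_.mul_inv, Circle.coe_mul]; ring)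
  src_arr a k := Prod.ext (C.src_arr _ _) rfl
  tgt_arr a k := Prod.ext (C.tgt_arr _ _) rfl
  mul_arr a k l h := Prod.ext (C.mul_arr _ _ _ (congrArg Prod.fst h)) rfl
  smooth_obj := (C.smooth_obj.comp
      (contMDiff_fst.prodMk (contMDiff_fst.comp contMDiff_snd))).prodMk
    (contMDiff_mul_complex
      ((contMDiff_circle_val.comp (contMDiff_inv (𝓡 1) ∞)).comp contMDiff_fst)
      (contMDiff_snd.comp contMDiff_snd))
  smooth_arr := (C.smooth_arr.comp
      (contMDiff_fst.prodMk (contMDiff_fst.comp contMDiff_snd))).prodMk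
    (contMDiff_mul_complex
      ((contMDiff_circle_val.comp (contMDiff_inv (𝓡 1) ∞)).comp contMDiff_fst)
      (contMDiff_snd.comp contMDiff_snd))

end LieGroupoids

/-! ### Maps of orbifolds

An orbifold may be given as the restriction of a Lie groupoid to an invariant set `S` of objects
(an open set or a regular level set), so that the following notions carry such a set along. -/

section Maps

variable {V₀ : Type*} [NormedAddCommGroup V₀] [NormedSpace ℝ V₀]
  {H₀ : Type*} [TopologicalSpace H₀] {I₀ : ModelWithCorners ℝ V₀ H₀}
  {X₀ : Type*} [TopologicalSpace X₀] [ChartedSpace H₀ X₀]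
  {V₁ : Type*} [NormedAddCommGroup V₁] [NormedSpace ℝ V₁]
  {H₁ : Type*} [TopologicalSpace H₁] {I₁ : ModelWithCorners ℝ V₁ H₁}
  {X₁ : Type*} [TopologicalSpace X₁] [ChartedSpace H₁ X₁]
  {W₀ : Type*} [NormedAddCommGroup W₀] [NormedSpace ℝ W₀]
  {K₀ : Type*} [TopologicalSpace K₀] {J₀ : ModelWithCorners ℝ W₀ K₀}
  {Y₀ : Type*} [TopologicalSpace Y₀] [ChartedSpace K₀ Y₀]
  {W₁ : Type*} [NormedAddCommGroup W₁] [NormedSpace ℝ W₁]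
  {K₁ : Type*} [TopologicalSpace K₁] {J₁ : ModelWithCorners ℝ W₁ K₁}
  {Y₁ : Type*} [TopologicalSpace Y₁] [ChartedSpace K₁ Y₁]

/-- `(f₀, f₁)` is a smooth functor from `G` restricted to `S` to `G'` restricted to `S'`. -/
structure IsSmoothFunctor (G : LieGroupoid I₀ X₀ I₁ X₁) (S : Set X₀)
    (G' : LieGroupoid J₀ Y₀ J₁ Y₁) (S' : Set Y₀) (f₀ : X₀ → Y₀) (f₁ : X₁ → Y₁) : Prop where
  mapsTo : ∀ x ∈ S, f₀ x ∈ S'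
  smooth_obj : ContMDiffOn I₀ J₀ ∞ f₀ S
  smooth_arr : ContMDiffOn I₁ J₁ ∞ f₁ {g | G.src g ∈ S ∧ G.tgt g ∈ S}
  map_src : ∀ g, G.src g ∈ S → G.tgt g ∈ S → G'.src (f₁ g) = f₀ (G.src g)
  map_tgt : ∀ g, G.src g ∈ S → G.tgt g ∈ S → G'.tgt (f₁ g) = f₀ (G.tgt g)
  map_mul : ∀ g h, G.src h ∈ S → G.tgt h ∈ S → G.tgt g ∈ S → G.src g = G.tgt h →
    f₁ (G.mul g h) = G'.mul (f₁ g) (f₁ h)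

/-- `η` is a smooth natural transformation from `(f₀, f₁)` to `(h₀, h₁)`, where both are functors
on `G` restricted to `S` with values in `G'`. -/
structure IsSmoothNatTrans (G : LieGroupoid I₀ X₀ I₁ X₁) (S : Set X₀)
    (G' : LieGroupoid J₀ Y₀ J₁ Y₁) (f₀ : X₀ → Y₀) (f₁ : X₁ → Y₁) (h₀ : X₀ → Y₀) (h₁ : X₁ → Y₁)
    (η : X₀ → Y₁) : Prop where
  smooth : ContMDiffOn I₀ J₁ ∞ η S
  src_eq : ∀ x ∈ S, G'.src (η x) = f₀ x
  tgt_eq : ∀ x ∈ S, G'.tgt (η x) = h₀ x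
  natural : ∀ g, G.src g ∈ S → G.tgt g ∈ S →
    G'.mul (η (G.tgt g)) (f₁ g) = G'.mul (h₁ g) (η (G.src g))

/-- `(f₀, f₁)` is an equivalence between `G` restricted to `S` and `G'` restricted to `S'`: it has
a smooth inverse up to smooth natural transformations. Such an `(f₀, f₁)` is an isomorphism
between the orbifolds that the two groupoids represent. -/
def IsSmoothEquivalence (G : LieGroupoid I₀ X₀ I₁ X₁) (S : Set X₀)
    (G' : LieGroupoid J₀ Y₀ J₁ Y₁) (S' : Set Y₀) (f₀ : X₀ → Y₀) (f₁ : X₁ → Y₁) : Prop :=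
  IsSmoothFunctor G S G' S' f₀ f₁ ∧
    ∃ (r₀ : Y₀ → X₀) (r₁ : Y₁ → X₁) (η : X₀ → X₁) (ε : Y₀ → Y₁),
      IsSmoothFunctor G' S' G S r₀ r₁ ∧
      IsSmoothNatTrans G S G (r₀ ∘ f₀) (r₁ ∘ f₁) id id η ∧
      IsSmoothNatTrans G' S' G' (f₀ ∘ r₀) (f₁ ∘ r₁) id id ε

end Maps

/-! ### Hermitian line bundles with connection over orbifolds -/

section LineBundles

variable {V₀ : Type*} [NormedAddCommGroup V₀] [NormedSpace ℝ V₀]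
  {H₀ : Type*} [TopologicalSpace H₀] {I₀ : ModelWithCorners ℝ V₀ H₀}
  {X₀ : Type*} [TopologicalSpace X₀] [ChartedSpace H₀ X₀]
  {V₁ : Type*} [NormedAddCommGroup V₁] [NormedSpace ℝ V₁]
  {H₁ : Type*} [TopologicalSpace H₁] {I₁ : ModelWithCorners ℝ V₁ H₁}
  {X₁ : Type*} [TopologicalSpace X₁] [ChartedSpace H₁ X₁]
  {G : LieGroupoid I₀ X₀ I₁ X₁}
  {E : X₀ → Type*} [∀ x, AddCommMonoid (E x)] [∀ x, Module ℂ (E x)]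

/-- The data of an orbifold Hermitian line bundle with connection: a line bundle `E` over the
manifold of objects, with a fibre metric `herm` (linear in the second variable), an action `move`
of the arrows on the fibres, and a connection, given by the covariant derivative `covDeriv γ u` of
sections `u` along curves `γ`. The laws are stated in `IsHermitianLineBundle`. -/
structure LineBundleData (G : LieGroupoid I₀ X₀ I₁ X₁) (E : X₀ → Type*)
    [∀ x, AddCommMonoid (E x)] [∀ x, Module ℂ (E x)] where
  herm : ∀ x, E x → E x → ℂ
  move : ∀ g : X₁, E (G.src g) →ₗ[ℂ] E (G.tgt g)
  covDeriv : ∀ γ : ℝ → X₀, (∀ t, E (γ t)) → ∀ t, E (γ t)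

/-- The arrow `g` carries the point `u` of the total space, over its source, to the point `v`,
over its target. -/
def LineBundleData.Moves (B : LineBundleData G E) (g : X₁) (u v : TotalSpace ℂ E) : Prop :=
  ∃ w : E (G.src g), u = ⟨G.src g, w⟩ ∧ v = ⟨G.tgt g, B.move g w⟩

variable [TopologicalSpace (TotalSpace ℂ E)] [∀ x, TopologicalSpace (E x)] [FiberBundle ℂ E]

variable (I₀) in
/-- `u` is a smooth section of `E` along the (smooth) curve `γ`. -/
def IsSmoothAlong (γ : ℝ → X₀) (u : ∀ t, E (γ t)) : Prop :=
  ContMDiff 𝓘(ℝ, ℝ) (I₀.prod 𝓘(ℝ, ℂ)) ∞ (fun t => (⟨γ t, u t⟩ : TotalSpace ℂ E))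

variable [IsManifold I₀ ∞ X₀]

/-- On the open set `U`, the smooth section `σ` of `E` is a local frame and `A` is the
corresponding connection one-form: `∇ (f σ) = (df + f A) σ` along curves in `S`. A one-form is
smooth if it is smooth as a function on the tangent bundle. -/
structure LineBundleData.IsConnectionForm (B : LineBundleData G E) (S U : Set X₀)
    (σ : ∀ x, E x) (A : ∀ x : X₀, TangentSpace I₀ x →L[ℝ] ℂ) : Prop where
  isOpen : IsOpen U
  smooth_frame : ContMDiffOn I₀ (I₀.prod 𝓘(ℝ, ℂ)) ∞ (fun x => (⟨x, σ x⟩ : TotalSpace ℂ E)) U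
  frame_ne_zero : ∀ x ∈ U, σ x ≠ 0
  smooth_form : ContMDiffOn I₀.tangent 𝓘(ℝ, ℂ) ∞ (fun v : TangentBundle I₀ X₀ => A v.proj v.2)
    {v | v.proj ∈ U}
  covDeriv_eq : ∀ (γ : ℝ → X₀) (u : ∀ t, E (γ t)), IsSmoothAlong I₀ γ u → (∀ t, γ t ∈ S) →
    ∀ t, γ t ∈ U → ∀ f : ℝ → ℂ, (∀ᶠ s in 𝓝 t, u s = f s • σ (γ s)) →
      B.covDeriv γ u t =
        (deriv f t + f t * A (γ t) (mfderiv 𝓘(ℝ, ℝ) I₀ γ t (1 : ℝ))) • σ (γ t)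

/-- `B` is an orbifold Hermitian line bundle with Hermitian connection over the orbifold given by
the restriction of `G` to the invariant set `S` (an open set or a regular level set). -/
structure LineBundleData.IsHermitianLineBundle (B : LineBundleData G E) (S : Set X₀) : Prop where
  invariant : ∀ g, G.src g ∈ S ↔ G.tgt g ∈ S
  /-- the Hermitian metric -/
  herm_conj : ∀ x ∈ S, ∀ u v, B.herm x u v = starRingEnd ℂ (B.herm x v u)
  herm_add : ∀ x ∈ S, ∀ u v w, B.herm x u (v + w) = B.herm x u v + B.herm x u w
  herm_smul : ∀ x ∈ S, ∀ (c : ℂ) u v, B.herm x u (c • v) = c * B.herm x u v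
  herm_pos : ∀ x ∈ S, ∀ u, u ≠ 0 → 0 < (B.herm x u u).re
  smooth_herm : ContMDiffOn (I₀.prod 𝓘(ℝ, ℂ)) 𝓘(ℝ, ℂ) ∞
    (fun u : TotalSpace ℂ E => B.herm u.proj u.2 u.2) {u | u.proj ∈ S}
  /-- the action of the arrows -/
  move_one : ∀ x ∈ S, ∀ u : E x, B.Moves (G.one x) ⟨x, u⟩ ⟨x, u⟩
  move_mul : ∀ g h u v w, G.src h ∈ S → B.Moves h u v → B.Moves g v w → B.Moves (G.mul g h) u w
  smooth_move : ∀ σ : ∀ x, E x,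
    ContMDiff I₀ (I₀.prod 𝓘(ℝ, ℂ)) ∞ (fun x => (⟨x, σ x⟩ : TotalSpace ℂ E)) →
    ContMDiffOn I₁ (I₀.prod 𝓘(ℝ, ℂ)) ∞
      (fun g => (⟨G.tgt g, B.move g (σ (G.src g))⟩ : TotalSpace ℂ E)) {g | G.src g ∈ S}
  herm_move : ∀ g, G.src g ∈ S → ∀ u v,
    B.herm (G.tgt g) (B.move g u) (B.move g v) = B.herm (G.src g) u v
  /-- the connection -/
  exists_connectionForm : ∀ x ∈ S, ∃ U σ A, x ∈ U ∧ B.IsConnectionForm S U σ A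
  covDeriv_herm : ∀ (γ : ℝ → X₀) (u v : ∀ t, E (γ t)), IsSmoothAlong I₀ γ u →
    IsSmoothAlong I₀ γ v → (∀ t, γ t ∈ S) → ∀ t,
      HasDerivAt (fun s => B.herm (γ s) (u s) (v s))
        (B.herm (γ t) (B.covDeriv γ u t) (v t) + B.herm (γ t) (u t) (B.covDeriv γ v t)) t
  covDeriv_move : ∀ (g : ℝ → X₁) (u : ∀ t, E (G.src (g t))), ContMDiff 𝓘(ℝ, ℝ) I₁ ∞ g →
    IsSmoothAlong I₀ (fun t => G.src (g t)) u → (∀ t, G.src (g t) ∈ S) → ∀ t,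
      B.covDeriv (fun s => G.tgt (g s)) (fun s => B.move (g s) (u s)) t
        = B.move (g t) (B.covDeriv (fun s => G.src (g s)) u t)

end LineBundles

section LineBundleIsomorphisms

variable {V₀ : Type*} [NormedAddCommGroup V₀] [NormedSpace ℝ V₀]
  {H₀ : Type*} [TopologicalSpace H₀] {I₀ : ModelWithCorners ℝ V₀ H₀}
  {X₀ : Type*} [TopologicalSpace X₀] [ChartedSpace H₀ X₀]
  {V₁ : Type*} [NormedAddCommGroup V₁] [NormedSpace ℝ V₁]
  {H₁ : Type*} [TopologicalSpace H₁] {I₁ : ModelWithCorners ℝ V₁ H₁}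
  {X₁ : Type*} [TopologicalSpace X₁] [ChartedSpace H₁ X₁]
  {W₀ : Type*} [NormedAddCommGroup W₀] [NormedSpace ℝ W₀]
  {K₀ : Type*} [TopologicalSpace K₀] {J₀ : ModelWithCorners ℝ W₀ K₀}
  {Y₀ : Type*} [TopologicalSpace Y₀] [ChartedSpace K₀ Y₀]
  {W₁ : Type*} [NormedAddCommGroup W₁] [NormedSpace ℝ W₁]
  {K₁ : Type*} [TopologicalSpace K₁] {J₁ : ModelWithCorners ℝ W₁ K₁}
  {Y₁ : Type*} [TopologicalSpace Y₁] [ChartedSpace K₁ Y₁]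
  {G : LieGroupoid I₀ X₀ I₁ X₁} {G' : LieGroupoid J₀ Y₀ J₁ Y₁}
  {E : X₀ → Type*} [∀ x, AddCommMonoid (E x)] [∀ x, Module ℂ (E x)]
  [TopologicalSpace (TotalSpace ℂ E)] [∀ x, TopologicalSpace (E x)] [FiberBundle ℂ E]
  {E' : Y₀ → Type*} [∀ x, AddCommMonoid (E' x)] [∀ x, Module ℂ (E' x)]
  [TopologicalSpace (TotalSpace ℂ E')] [∀ x, TopologicalSpace (E' x)] [FiberBundle ℂ E']

/-- `F` is an isomorphism of orbifold Hermitian line bundles with connection, between the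
restriction of `B` to `S` and the restriction of `B'` to `S'`, which covers the isomorphism
`(f₀, f₁)` of orbifolds. -/
structure IsLineBundleIso (B : LineBundleData G E) (S : Set X₀) (B' : LineBundleData G' E')
    (S' : Set Y₀) (f₀ : X₀ → Y₀) (f₁ : X₁ → Y₁) (F : ∀ x, E x →ₗ[ℂ] E' (f₀ x)) : Prop where
  base : IsSmoothEquivalence G S G' S' f₀ f₁
  bijective : ∀ x ∈ S, Function.Bijective (F x)
  smooth : ContMDiffOn (I₀.prod 𝓘(ℝ, ℂ)) (J₀.prod 𝓘(ℝ, ℂ)) ∞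
    (fun u : TotalSpace ℂ E => (⟨f₀ u.proj, F u.proj u.2⟩ : TotalSpace ℂ E')) {u | u.proj ∈ S}
  equivariant : ∀ g u v, G.src g ∈ S → B.Moves g u v →
    B'.Moves (f₁ g) ⟨f₀ u.proj, F u.proj u.2⟩ ⟨f₀ v.proj, F v.proj v.2⟩
  herm_eq : ∀ x ∈ S, ∀ u v, B'.herm (f₀ x) (F x u) (F x v) = B.herm x u v
  covDeriv_eq : ∀ (γ : ℝ → X₀) (u : ∀ t, E (γ t)), IsSmoothAlong I₀ γ u → (∀ t, γ t ∈ S) →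
    ∀ t, B'.covDeriv (fun s => f₀ (γ s)) (fun s => F (γ s) (u s)) t
      = F (γ t) (B.covDeriv γ u t)

end LineBundleIsomorphisms

/-! ### Symplectic forms, moment maps, and pre-quantum line bundles -/

section Prequantum

variable {V₀ : Type*} [NormedAddCommGroup V₀] [NormedSpace ℝ V₀]
  {H₀ : Type*} [TopologicalSpace H₀] {I₀ : ModelWithCorners ℝ V₀ H₀}
  {X₀ : Type*} [TopologicalSpace X₀] [ChartedSpace H₀ X₀] [IsManifold I₀ ∞ X₀]
  {V₁ : Type*} [NormedAddCommGroup V₁] [NormedSpace ℝ V₁]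
  {H₁ : Type*} [TopologicalSpace H₁] {I₁ : ModelWithCorners ℝ V₁ H₁}
  {X₁ : Type*} [TopologicalSpace X₁] [ChartedSpace H₁ X₁]
  {G : LieGroupoid I₀ X₀ I₁ X₁}
  {E : X₀ → Type*} [∀ x, AddCommMonoid (E x)] [∀ x, Module ℂ (E x)]

variable (I₀) in
/-- `Z` is a smooth vector field. -/
def IsSmoothField (Z : ∀ x : X₀, TangentSpace I₀ x) : Prop :=
  ContMDiff I₀ I₀.tangent ∞ (fun x => (⟨x, Z x⟩ : TangentBundle I₀ X₀))

variable (I₀) in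
/-- The derivative of the function `f` in the direction of the vector field `Z`. -/
def fieldDeriv {F : Type*} [NormedAddCommGroup F] [NormedSpace ℝ F]
    (Z : ∀ x : X₀, TangentSpace I₀ x) (f : X₀ → F) (x : X₀) : F :=
  mfderiv I₀ 𝓘(ℝ, F) f x (Z x)

/-- `Ω` is a symplectic form on the orbifold represented by `G`: a smooth closed two-form on the
objects with `src^* Ω = tgt^* Ω`, whose kernel consists of the vectors tangent to the orbits. -/
structure IsSymplecticForm (G : LieGroupoid I₀ X₀ I₁ X₁)
    (Ω : ∀ x : X₀, TangentSpace I₀ x →L[ℝ] TangentSpace I₀ x →L[ℝ] ℝ) : Prop where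
  alternating : ∀ x v, Ω x v v = 0
  smooth : ∀ Y Z : ∀ x : X₀, TangentSpace I₀ x, IsSmoothField I₀ Y → IsSmoothField I₀ Z →
    ContMDiff I₀ 𝓘(ℝ, ℝ) ∞ (fun x => Ω x (Y x) (Z x))
  closed : ∀ X Y Z : ∀ x : X₀, TangentSpace I₀ x,
    IsSmoothField I₀ X → IsSmoothField I₀ Y → IsSmoothField I₀ Z → ∀ x,
      fieldDeriv I₀ X (fun y => Ω y (Y y) (Z y)) x - fieldDeriv I₀ Y (fun y => Ω y (X y) (Z y)) x
        + fieldDeriv I₀ Z (fun y => Ω y (X y) (Y y)) x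
        - Ω x (VectorField.mlieBracket I₀ X Y x) (Z x)
        + Ω x (VectorField.mlieBracket I₀ X Z x) (Y x)
        - Ω x (VectorField.mlieBracket I₀ Y Z x) (X x) = 0
  basic : ∀ (g : X₁) (v w : TangentSpace I₁ g),
    Ω (G.src g) (mfderiv I₁ I₀ G.src g v) (mfderiv I₁ I₀ G.src g w)
      = Ω (G.tgt g) (mfderiv I₁ I₀ G.tgt g v) (mfderiv I₁ I₀ G.tgt g w)
  nondegenerate : ∀ (g : X₁) (v : TangentSpace I₀ (G.tgt g)),
    (∀ w, Ω (G.tgt g) v w = 0) ↔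
      ∃ ξ : TangentSpace I₁ g, mfderiv I₁ I₀ G.src g ξ = 0 ∧ mfderiv I₁ I₀ G.tgt g ξ = v

/-- `Φ` is a moment map for the circle action, `ι(c X) Ω = dΦ`, where `X` is the generator
`d/dφ` of the action of `e^{iφ}`. -/
structure IsMomentMap {G : LieGroupoid I₀ X₀ I₁ X₁} (C : CircleAction G)
    (Ω : ∀ x : X₀, TangentSpace I₀ x →L[ℝ] TangentSpace I₀ x →L[ℝ] ℝ) (c : ℝ) (Φ : X₀ → ℝ) :
    Prop where
  smooth : ContMDiff I₀ 𝓘(ℝ, ℝ) ∞ Φ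
  invariant : ∀ g, Φ (G.src g) = Φ (G.tgt g)
  moment : ∀ (x : X₀) (φ : ℝ) (v : TangentSpace I₀ (C.obj (Circle.exp φ) x)),
    Ω (C.obj (Circle.exp φ) x)
        (c • mfderiv 𝓘(ℝ, ℝ) I₀ (fun s : ℝ => C.obj (Circle.exp s) x) φ (1 : ℝ)) v
      = mfderiv I₀ 𝓘(ℝ, ℝ) Φ (C.obj (Circle.exp φ) x) v

variable [TopologicalSpace (TotalSpace ℂ E)] [∀ x, TopologicalSpace (E x)] [FiberBundle ℂ E]

/-- `B` is a pre-quantum line bundle for `Ω`: a Hermitian line bundle with Hermitian connection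
such that `(i / 2π) curv(∇) = Ω`, where `curv(∇) = dA` for every local connection form `A`. -/
structure LineBundleData.IsPrequantum (B : LineBundleData G E)
    (Ω : ∀ x : X₀, TangentSpace I₀ x →L[ℝ] TangentSpace I₀ x →L[ℝ] ℝ) : Prop where
  isHermitianLineBundle : B.IsHermitianLineBundle univ
  curvature : ∀ U σ A, B.IsConnectionForm univ U σ A →
    ∀ Y Z : ∀ x : X₀, TangentSpace I₀ x, IsSmoothField I₀ Y → IsSmoothField I₀ Z → ∀ x ∈ U,
      Complex.I / (2 * Real.pi) *
        (fieldDeriv I₀ Y (fun y => A y (Z y)) x - fieldDeriv I₀ Z (fun y => A y (Y y)) x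
          - A x (VectorField.mlieBracket I₀ Y Z x)) = (Ω x (Y x) (Z x) : ℂ)

/-- `lift` is a lift of the circle action to `E`, by unitary maps between the fibres that commute
with the action of the arrows. -/
structure IsCircleLift (C : CircleAction G) (B : LineBundleData G E)
    (lift : ∀ (a : Circle) (x : X₀), E x →ₗ[ℂ] E (C.obj a x)) : Prop where
  lift_one : ∀ x u, (⟨C.obj 1 x, lift 1 x u⟩ : TotalSpace ℂ E) = ⟨x, u⟩
  lift_mul : ∀ a b x u, (⟨C.obj (a * b) x, lift (a * b) x u⟩ : TotalSpace ℂ E)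
    = ⟨C.obj a (C.obj b x), lift a (C.obj b x) (lift b x u)⟩
  smooth : ContMDiff ((𝓡 1).prod (I₀.prod 𝓘(ℝ, ℂ))) (I₀.prod 𝓘(ℝ, ℂ)) ∞
    (fun p : Circle × TotalSpace ℂ E =>
      (⟨C.obj p.1 p.2.proj, lift p.1 p.2.proj p.2.2⟩ : TotalSpace ℂ E))
  unitary : ∀ a x u v, B.herm (C.obj a x) (lift a x u) (lift a x v) = B.herm x u v
  commutes : ∀ a g u v, B.Moves g u v →
    B.Moves (C.arr a g) ⟨C.obj a u.proj, lift a u.proj u.2⟩ ⟨C.obj a v.proj, lift a v.proj v.2⟩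

/-- Kostant's formula `ξ_E = Lift(ξ) + 2π Φ ∂/∂φ` for the vector field generating the lifted
action, where `ξ` is `c` times the generator of the action of `e^{iφ}`. The vertical part of
the velocity of the curve `φ ↦ e^{iφ} • u` is its covariant derivative, and `∂/∂φ` generates
the scalar multiplication by `e^{iφ}`. -/
def SatisfiesKostant (C : CircleAction G) (B : LineBundleData G E)
    (lift : ∀ (a : Circle) (x : X₀), E x →ₗ[ℂ] E (C.obj a x)) (c : ℝ) (Φ : X₀ → ℝ) : Prop :=
  ∀ (x : X₀) (u : E x) (φ : ℝ),
    (c : ℂ) • B.covDeriv (fun s : ℝ => C.obj (Circle.exp s) x) (fun s => lift (Circle.exp s) x u) φ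
      = (2 * Real.pi * Φ (C.obj (Circle.exp φ) x) * Complex.I) • lift (Circle.exp φ) x u

end Prequantum

/-! ### Reduction and cutting -/

section Cutting

variable {V₀ : Type*} [NormedAddCommGroup V₀] [NormedSpace ℝ V₀]
  {H₀ : Type*} [TopologicalSpace H₀] {I₀ : ModelWithCorners ℝ V₀ H₀}
  {X₀ : Type*} [TopologicalSpace X₀] [ChartedSpace H₀ X₀]
  {V₁ : Type*} [NormedAddCommGroup V₁] [NormedSpace ℝ V₁]
  {H₁ : Type*} [TopologicalSpace H₁] {I₁ : ModelWithCorners ℝ V₁ H₁}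
  {X₁ : Type*} [TopologicalSpace X₁] [ChartedSpace H₁ X₁]
  {G : LieGroupoid I₀ X₀ I₁ X₁}
  {E : X₀ → Type*} [∀ x, AddCommMonoid (E x)] [∀ x, Module ℂ (E x)]

/-- The quotient of a line bundle by a lifted circle action: the same bundle over the objects,
on which an arrow `(g, a)` of the quotient orbifold acts by `g`, followed by `a`. -/
def LineBundleData.quotient (B : LineBundleData G E) (C : CircleAction G)
    (lift : ∀ (a : Circle) (x : X₀), E x →ₗ[ℂ] E (C.obj a x)) :
    LineBundleData C.quotient E where
  herm := B.herm
  move k := (lift k.2 (G.tgt k.1)).comp (B.move k.1)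
  covDeriv := B.covDeriv

variable (I₀ E) in
/-- The line bundle `L ⊠ L_ℂ` over `M × ℂ`. The line bundle `L_ℂ = ℂ × ℂ` is trivial, so that this
is the pullback of `L`, by the identification `λ ⊗ w = w λ`. -/
abbrev BoxFiber : X₀ × ℂ → Type _ :=
  (ContMDiffMap.fst : C^∞⟮I₀.prod 𝓘(ℝ, ℂ), X₀ × ℂ; I₀, X₀⟯) *ᵖ E

/-- The Hermitian line bundle with connection `L ⊠ L_ℂ`, where `L_ℂ` has the fibre metric
`exp(-π |z|²) \bar w₁ w₂` and the connection form `-π z d\bar z`. -/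
def LineBundleData.boxC (B : LineBundleData G E) :
    LineBundleData G.prodC (BoxFiber I₀ E) where
  herm p u v := Real.exp (-Real.pi * ‖p.2‖ ^ 2) * B.herm p.1 u v
  move k := B.move k.1
  covDeriv γ u t := B.covDeriv (fun s => (γ s).1) u t
    + (-Real.pi * (γ t).2 * starRingEnd ℂ (deriv (fun s => (γ s).2) t)) • (show E (γ t).1 from u t)

variable (I₀) in
/-- The lift of the circle action to `L ⊠ L_ℂ`, with the trivial lift to `L_ℂ`. -/
def boxLift (C : CircleAction G) (lift : ∀ (a : Circle) (x : X₀), E x →ₗ[ℂ] E (C.obj a x)) :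
    ∀ (a : Circle) (p : X₀ × ℂ), BoxFiber I₀ E p →ₗ[ℂ] BoxFiber I₀ E (C.prodC.obj a p) :=
  fun a p => lift a p.1

/-- The moment map `ψ(x, z) = Φ(x) - (c/2) |z|²` on `M × ℂ`, for the symplectic form
`-(i/2) dz ∧ d\bar z` on `ℂ` and the action `e^{iφ} • (x, z) = (e^{iφ} • x, e^{-iφ} z)`. -/
def cutMoment (c : ℝ) (Φ : X₀ → ℝ) (p : X₀ × ℂ) : ℝ := Φ p.1 - c / 2 * ‖p.2‖ ^ 2

/-- The symplectic form `Ω - (i/2) dz ∧ d\bar z` on `M × ℂ`; it induces the symplectic form of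
`M_+`. -/
def boxForm (Ω : ∀ x : X₀, TangentSpace I₀ x →L[ℝ] TangentSpace I₀ x →L[ℝ] ℝ) (p : X₀ × ℂ)
    (v w : TangentSpace (I₀.prod 𝓘(ℝ, ℂ)) p) : ℝ :=
  let v₂ : ℂ := mfderiv (I₀.prod 𝓘(ℝ, ℂ)) 𝓘(ℝ, ℂ) Prod.snd p v
  let w₂ : ℂ := mfderiv (I₀.prod 𝓘(ℝ, ℂ)) 𝓘(ℝ, ℂ) Prod.snd p w
  Ω p.1 (mfderiv (I₀.prod 𝓘(ℝ, ℂ)) I₀ Prod.fst p v) (mfderiv (I₀.prod 𝓘(ℝ, ℂ)) I₀ Prod.fst p w)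
    - (v₂.re * w₂.im - v₂.im * w₂.re)

/-- The reduced bundle `L_red = (L | Φ⁻¹(0)) / S¹`; it is a bundle over the orbifold
`M_red = Φ⁻¹(0) / S¹`, the restriction of `C.quotient` to `Φ⁻¹(0)`. -/
def LineBundleData.red (B : LineBundleData G E) (C : CircleAction G)
    (lift : ∀ (a : Circle) (x : X₀), E x →ₗ[ℂ] E (C.obj a x)) :
    LineBundleData C.quotient E :=
  B.quotient C lift

/-- The cut bundle `L_+ = (L ⊠ L_ℂ | ψ⁻¹(0)) / S¹`; it is a bundle over the orbifold
`M_+ = ψ⁻¹(0) / S¹`, the restriction of `C.prodC.quotient` to `ψ⁻¹(0)`. -/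
def LineBundleData.cut (B : LineBundleData G E) (C : CircleAction G)
    (lift : ∀ (a : Circle) (x : X₀), E x →ₗ[ℂ] E (C.obj a x)) :
    LineBundleData C.prodC.quotient (BoxFiber I₀ E) :=
  B.boxC.quotient C.prodC (boxLift I₀ C lift)

/-- The embedding `x ↦ [x, (2Φ(x)/c)^{1/2}]` of `{Φ > 0}` into `M_+`, on objects. -/
def cutEmb (c : ℝ) (Φ : X₀ → ℝ) (x : X₀) : X₀ × ℂ := (x, (Real.sqrt (2 * Φ x / c) : ℂ))

/-- The embedding of `{Φ > 0}` into `M_+`, on arrows. -/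
def cutEmbArr (G : LieGroupoid I₀ X₀ I₁ X₁) (c : ℝ) (Φ : X₀ → ℝ) (g : X₁) : (X₁ × ℂ) × Circle :=
  ((g, (Real.sqrt (2 * Φ (G.src g) / c) : ℂ)), 1)

/-- The embedding `[x] ↦ [x, 0]` of `M_red` into `M_+`, on objects. -/
def redEmb (x : X₀) : X₀ × ℂ := (x, 0)

/-- The embedding of `M_red` into `M_+`, on arrows. -/
def redEmbArr (k : X₁ × Circle) : (X₁ × ℂ) × Circle := ((k.1, 0), k.2)

variable (I₀ E) in
/-- The map `λ ↦ exp(π Φ(x) / c) λ` from `L` to `L ⊠ L_ℂ`, over `x ↦ (x, (2Φ(x)/c)^{1/2})`. -/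
def cutIso (c : ℝ) (Φ : X₀ → ℝ) (x : X₀) : E x →ₗ[ℂ] BoxFiber I₀ E (cutEmb c Φ x) :=
  ((Real.exp (Real.pi * Φ x / c) : ℂ) • (LinearMap.id : E x →ₗ[ℂ] E x) : E x →ₗ[ℂ] E x)

variable (I₀ E) in
/-- The map `λ ↦ λ` from `L` to `L ⊠ L_ℂ`, over `x ↦ (x, 0)`. -/
def redIso (x : X₀) : E x →ₗ[ℂ] BoxFiber I₀ E (redEmb x) :=
  (LinearMap.id : E x →ₗ[ℂ] E x)

end Cutting

end

/-! Everything rests on one formula. If a section `u` along a curve `γ` is moved by a curve `a` in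
the circle with angular velocity `ν`, then `∇(a • u) = a • (∇u + (2πi Φ ν / c) u)`
(`covDeriv_lift`). Its core is the case of constant `a`: the lifted action preserves the connection
(`covDeriv_rotate`). To see this, rotate a section along `γ(t)` by `e^{is}` and write it in a local
frame as `f σ`, with `P` and `Q` the values of the connection form on `∂ₛ` and `∂ₜ`. Kostant's
formula reads `∂ₛf + f P = R f` with `R = 2πi Φ / c`. Prequantization and the moment map equation
together give `∂ₛQ - ∂ₜP = -∂ₜR`. Hence the coefficient `∂ₜf / f + Q` of the covariant derivative
does not depend on `s` (`hasDerivAt_logDeriv_add`). The curvature is tested on global vector fields,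
so its value on `∂ₛ, ∂ₜ` is extracted with fields that are constant in a chart
(`exists_fields_extDeriv_eq`).

Descent to a level set means that the correction term vanishes there. On `Φ = 0` it is zero. On `ψ =
0` the factor `L_ℂ` contributes `-πiν|z|²`, because `z` is rotated by `a⁻¹`, and `2πi Φ ν / c =
πiν|z|²` cancels it. These are `IsPrequantum.red` and `IsPrequantum.cut`, both fed into the general
descent statement `IsHermitianLineBundle.quotient`.

On the part `Φ > 0` of `ψ⁻¹(0)` one has `z ≠ 0`, and acting by `z / |z|` brings each point to the
slice where `z` is the positive number `(2Φ/c)^{1/2}`; this inverts the embedding of `{Φ > 0}` up to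
a natural transformation (`isSmoothEquivalence_cutEmb`). On the slice `z` is real, so `dz ∧ d\bar z`
restricts to zero. The factor `e^{πΦ/c}` compensates both the weight `e^{-π|z|²} = e^{-2πΦ/c}` and
the connection term `-π z d\bar z = -π dΦ/c` (`isLineBundleIso_cutIso`). On `z = 0` all
contributions of `L_ℂ` are trivial (`isLineBundleIso_redIso`). -/

set_option linter.unusedSectionVars false

noncomputable section

/-! ### Sections of vector bundles and of line bundles -/

section GlobalSections

variable {V₀ : Type*} [NormedAddCommGroup V₀] [NormedSpace ℝ V₀] [FiniteDimensional ℝ V₀]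
  {H₀ : Type*} [TopologicalSpace H₀] {I₀ : ModelWithCorners ℝ V₀ H₀}
  {X₀ : Type*} [TopologicalSpace X₀] [ChartedSpace H₀ X₀] [IsManifold I₀ ∞ X₀] [T2Space X₀]
  {F : Type*} [NormedAddCommGroup F] [NormedSpace ℝ F]
  {V : X₀ → Type*} [TopologicalSpace (TotalSpace F V)] [∀ x, AddCommGroup (V x)]
  [∀ x, Module ℝ (V x)] [∀ x, TopologicalSpace (V x)] [FiberBundle F V] [VectorBundle ℝ F V]

/-- A local smooth section of a vector bundle agrees near any given point with a global one. -/
theorem exists_contMDiff_section_eventuallyEq {s : ∀ x, V x} {U : Set X₀} {x : X₀}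
    (hU : IsOpen U) (hx : x ∈ U)
    (hs : ContMDiffOn I₀ (I₀.prod 𝓘(ℝ, F)) ∞ (fun y => (⟨y, s y⟩ : TotalSpace F V)) U) :
    ∃ s' : ∀ x, V x,
      ContMDiff I₀ (I₀.prod 𝓘(ℝ, F)) ∞ (fun y => (⟨y, s' y⟩ : TotalSpace F V)) ∧
        ∀ᶠ y in 𝓝 x, s' y = s y := by
  -- The bump function has closed support in `U` and equals `1` near `x`, so the product with `s`
  -- extends by zero.
  obtain ⟨f, hf, -⟩ := (SmoothBumpFunction.nhds_basis_support (I := I₀) (hU.mem_nhds hx)).mem_iff.1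
    (hU.mem_nhds hx)
  refine ⟨fun y => f y • s y,
    ContMDiffOn.smul_section_of_tsupport f.contMDiff.contMDiffOn hU hf hs, ?_⟩
  filter_upwards [f.eventuallyEq_one] with y hy
  rw [hy, Pi.one_apply, one_smul]

end GlobalSections

/-! ### Coefficients with respect to a frame of a line bundle. -/

section Frames

variable {V₀ : Type*} [NormedAddCommGroup V₀] [NormedSpace ℝ V₀]
  {H₀ : Type*} [TopologicalSpace H₀] {I₀ : ModelWithCorners ℝ V₀ H₀}
  {X₀ : Type*} [TopologicalSpace X₀] [ChartedSpace H₀ X₀]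
  {W : Type*} [NormedAddCommGroup W] [NormedSpace ℝ W]
  {K : Type*} [TopologicalSpace K] {J : ModelWithCorners ℝ W K}
  {M : Type*} [TopologicalSpace M] [ChartedSpace K M]
  {L : X₀ → Type*} [∀ x, AddCommGroup (L x)] [∀ x, Module ℂ (L x)]
  [TopologicalSpace (TotalSpace ℂ L)] [∀ x, TopologicalSpace (L x)] [FiberBundle ℂ L]
  [VectorBundle ℂ ℂ L]

/-- The coefficient of a point of a line bundle with respect to a frame. -/
def frameCoeff (σ : ∀ x, L x) (u : TotalSpace ℂ L) : ℂ :=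
  (trivializationAt ℂ L u.proj u).2 / (trivializationAt ℂ L u.proj ⟨u.proj, σ u.proj⟩).2

theorem trivializationAt_smul {x y : X₀} (hx : x ∈ (trivializationAt ℂ L y).baseSet) (a : ℂ)
    (u : L x) :
    (trivializationAt ℂ L y ⟨x, a • u⟩).2 = a * (trivializationAt ℂ L y ⟨x, u⟩).2 :=
  ((trivializationAt ℂ L y).linear ℂ hx).map_smul a u

theorem trivializationAt_injective {x y : X₀} (hx : x ∈ (trivializationAt ℂ L y).baseSet)
    {u v : L x} (h : (trivializationAt ℂ L y ⟨x, u⟩).2 = (trivializationAt ℂ L y ⟨x, v⟩).2) :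
    u = v := by
  have h1 := (trivializationAt ℂ L y).linearEquivAt_apply (R := ℂ) x hx u
  have h2 := (trivializationAt ℂ L y).linearEquivAt_apply (R := ℂ) x hx v
  exact ((trivializationAt ℂ L y).linearEquivAt ℂ x hx).injective (by rw [h1, h2, h])

theorem trivializationAt_ne_zero {x y : X₀} (hx : x ∈ (trivializationAt ℂ L y).baseSet)
    {u : L x} (hu : u ≠ 0) : (trivializationAt ℂ L y ⟨x, u⟩).2 ≠ 0 := by
  intro h
  refine hu (trivializationAt_injective hx (h.trans ?_))
  simpa using (trivializationAt_smul hx 0 (0 : L x)).symm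

theorem frameCoeff_smul_eq {σ : ∀ x, L x} {x : X₀} (hσ : σ x ≠ 0) (u : L x) :
    frameCoeff σ ⟨x, u⟩ • σ x = u := by
  have hx := FiberBundle.mem_baseSet_trivializationAt' (F := ℂ) (E := L) x
  refine trivializationAt_injective hx ?_
  rw [trivializationAt_smul hx]
  exact div_mul_cancel₀ _ (trivializationAt_ne_zero hx hσ)

theorem frameCoeff_ne_zero {σ : ∀ x, L x} {x : X₀} (hσ : σ x ≠ 0) {u : L x} (hu : u ≠ 0) :
    frameCoeff σ ⟨x, u⟩ ≠ 0 := by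
  intro h
  have := frameCoeff_smul_eq hσ u
  rw [h, zero_smul] at this
  exact hu this.symm

theorem smul_ne_smul_of_ne {x : X₀} {u : L x} (hu : u ≠ 0) {a b : ℂ} (h : a • u = b • u) :
    a = b := by
  have hx := FiberBundle.mem_baseSet_trivializationAt' (F := ℂ) (E := L) x
  have h' := congrArg (fun w : L x => (trivializationAt ℂ L x ⟨x, w⟩).2) h
  simp only [trivializationAt_smul hx] at h'
  exact mul_right_cancel₀ (trivializationAt_ne_zero hx hu) h'

/-- Scalar multiplication is smooth on the total space. -/
theorem ContMDiffWithinAt.totalSpace_smul {f : M → ℂ} {p : M → X₀} {u : ∀ m, L (p m)} {s : Set M}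
    {m : M} (hf : ContMDiffWithinAt J 𝓘(ℝ, ℂ) ∞ f s m)
    (hu : ContMDiffWithinAt J (I₀.prod 𝓘(ℝ, ℂ)) ∞ (fun m => (⟨p m, u m⟩ : TotalSpace ℂ L)) s m) :
    ContMDiffWithinAt J (I₀.prod 𝓘(ℝ, ℂ)) ∞
      (fun m => (⟨p m, f m • u m⟩ : TotalSpace ℂ L)) s m := by
  rw [contMDiffWithinAt_totalSpace] at hu ⊢
  refine ⟨hu.1, ((((ContinuousLinearMap.mul ℝ ℂ).contDiff.contMDiff).contMDiffAt.comp_contMDiffWithinAt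
    m hf).clm_apply hu.2).congr_of_eventuallyEq ?_ ?_⟩
  · have h : ∀ᶠ y in 𝓝[s] m, p y ∈ (trivializationAt ℂ L (p m)).baseSet :=
      hu.1.continuousWithinAt.preimage_mem_nhdsWithin
        ((trivializationAt ℂ L (p m)).open_baseSet.mem_nhds
          (FiberBundle.mem_baseSet_trivializationAt' (p m)))
    filter_upwards [h] with y hy
    exact trivializationAt_smul hy _ _
  · exact trivializationAt_smul (FiberBundle.mem_baseSet_trivializationAt' (p m)) _ _


/-- The trivialization in the definition of `frameCoeff` moves with the point. The quotient of
coordinates is the same in every trivialization, by `frameCoeff_smul_eq` and linearity, so near `u`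
it may be computed in the fixed one at `u.proj`. -/
theorem contMDiffAt_frameCoeff {σ : ∀ x, L x} {U : Set X₀} (hU : IsOpen U)
    (hσ : ContMDiffOn I₀ (I₀.prod 𝓘(ℝ, ℂ)) ∞ (fun y => (⟨y, σ y⟩ : TotalSpace ℂ L)) U)
    (hσ0 : ∀ x ∈ U, σ x ≠ 0) {u : TotalSpace ℂ L} (hu : u.proj ∈ U) :
    ContMDiffAt (I₀.prod 𝓘(ℝ, ℂ)) 𝓘(ℝ, ℂ) ∞ (frameCoeff σ) u := by
  have hx := FiberBundle.mem_baseSet_trivializationAt' (F := ℂ) (E := L) u.proj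
  have h1 : ContMDiffAt (I₀.prod 𝓘(ℝ, ℂ)) 𝓘(ℝ, ℂ) ∞
      (fun v : TotalSpace ℂ L => (trivializationAt ℂ L u.proj v).2) u :=
    (contMDiffAt_totalSpace.1 (contMDiffAt_id (x := u))).2
  have h2 : ContMDiffAt (I₀.prod 𝓘(ℝ, ℂ)) 𝓘(ℝ, ℂ) ∞
      (fun v : TotalSpace ℂ L => (trivializationAt ℂ L u.proj ⟨v.proj, σ v.proj⟩).2) u :=
    ((contMDiffAt_section u.proj).1 (hσ.contMDiffAt (hU.mem_nhds hu))).comp u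
      (contMDiffAt_proj L)
  have h3 : (trivializationAt ℂ L u.proj ⟨u.proj, σ u.proj⟩).2 ≠ 0 :=
    trivializationAt_ne_zero hx (hσ0 _ hu)
  have h4 := ((contDiffAt_inv ℝ h3).contMDiffAt).comp u h2
  have h5 := (((ContinuousLinearMap.mul ℝ ℂ).contDiff.contMDiff).contMDiffAt.comp u h1).clm_apply h4
  refine h5.congr_of_eventuallyEq ?_
  have hc : Continuous (fun v : TotalSpace ℂ L => v.proj) := FiberBundle.continuous_proj ℂ L
  filter_upwards [hc.continuousAt.preimage_mem_nhds
    ((trivializationAt ℂ L u.proj).open_baseSet.mem_nhds hx),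
    hc.continuousAt.preimage_mem_nhds (hU.mem_nhds hu)] with v hv hvU
  change frameCoeff σ v = (trivializationAt ℂ L u.proj v).2 *
    ((trivializationAt ℂ L u.proj ⟨v.proj, σ v.proj⟩).2)⁻¹
  have hv0 := hσ0 _ hvU
  rw [← div_eq_mul_inv, eq_div_iff (trivializationAt_ne_zero hv hv0),
    ← trivializationAt_smul hv]
  obtain ⟨x, w⟩ := v
  exact congrArg (fun w : L x => (trivializationAt ℂ L u.proj ⟨x, w⟩).2)
    (frameCoeff_smul_eq hv0 w)

end Frames

section NonvanishingSections

variable {V₀ : Type*} [NormedAddCommGroup V₀] [NormedSpace ℝ V₀] [FiniteDimensional ℝ V₀]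
  {H₀ : Type*} [TopologicalSpace H₀] {I₀ : ModelWithCorners ℝ V₀ H₀}
  {X₀ : Type*} [TopologicalSpace X₀] [ChartedSpace H₀ X₀] [IsManifold I₀ ∞ X₀] [T2Space X₀]
  {L : X₀ → Type*} [∀ x, AddCommGroup (L x)] [∀ x, Module ℂ (L x)]
  [TopologicalSpace (TotalSpace ℂ L)] [∀ x, TopologicalSpace (L x)] [FiberBundle ℂ L]
  [VectorBundle ℂ ℂ L] [VectorBundle ℝ ℂ L] [ContMDiffVectorBundle ∞ ℂ L I₀]

variable (I₀ L) in
/-- Near any point a line bundle has a frame which extends to a global smooth section. -/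
theorem exists_contMDiff_section_ne_zero (x : X₀) :
    ∃ (σ : ∀ x, L x) (U : Set X₀), IsOpen U ∧ x ∈ U ∧
      ContMDiff I₀ (I₀.prod 𝓘(ℝ, ℂ)) ∞ (fun y => (⟨y, σ y⟩ : TotalSpace ℂ L)) ∧
        ∀ y ∈ U, σ y ≠ 0 := by
  set e := trivializationAt ℂ L x
  have hx : x ∈ e.baseSet := FiberBundle.mem_baseSet_trivializationAt' x
  have hs : ContMDiffOn I₀ (I₀.prod 𝓘(ℝ, ℂ)) ∞
      (fun y => (⟨y, e.symm y 1⟩ : TotalSpace ℂ L)) e.baseSet := by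
    rw [e.contMDiffOn_section_baseSet_iff]
    refine contMDiffOn_const (c := (1 : ℂ)) |>.congr fun y hy => ?_
    rw [e.apply_mk_symm hy]
  obtain ⟨σ, hσ, heq⟩ := exists_contMDiff_section_eventuallyEq e.open_baseSet hx hs
  obtain ⟨U, hU, hUo, hxU⟩ := eventually_nhds_iff.1 (heq.and (e.open_baseSet.mem_nhds hx))
  refine ⟨σ, U, hUo, hxU, hσ, fun y hy h0 => ?_⟩
  have h1 : e.symm y 1 = 0 := by rw [← (hU y hy).1, h0]
  have h2 := e.apply_mk_symm (hU y hy).2 (1 : ℂ)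
  rw [h1] at h2
  have h3 := trivializationAt_smul (hU y hy).2 0 (0 : L y)
  rw [zero_smul, zero_mul] at h3
  exact one_ne_zero ((congrArg Prod.snd h2).symm.trans h3)

end NonvanishingSections

/-! ### The exterior derivative of a one-form along a map with several parameters -/

section CoordinateFields

variable {V₀ : Type*} [NormedAddCommGroup V₀] [NormedSpace ℝ V₀]
  {H₀ : Type*} [TopologicalSpace H₀] {I₀ : ModelWithCorners ℝ V₀ H₀}
  {X₀ : Type*} [TopologicalSpace X₀] [ChartedSpace H₀ X₀] [IsManifold I₀ ∞ X₀]

variable (I₀) in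
/-- The vector field which is constant, equal to `v`, in the preferred chart at `y`. -/
def coordField (y : X₀) (v : V₀) (x : X₀) : TangentSpace I₀ x :=
  (trivializationAt V₀ (TangentSpace I₀ : X₀ → Type _) y).symmL ℝ x v

theorem contMDiffOn_coordField (y : X₀) (v : V₀) :
    ContMDiffOn I₀ I₀.tangent ∞ (fun x => (⟨x, coordField I₀ y v x⟩ : TangentBundle I₀ X₀))
      (trivializationAt V₀ (TangentSpace I₀ : X₀ → Type _) y).baseSet := by
  rw [(trivializationAt V₀ (TangentSpace I₀ : X₀ → Type _) y).contMDiffOn_section_baseSet_iff]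
  refine contMDiffOn_const (c := v) |>.congr fun x hx => ?_
  unfold coordField
  rw [Trivialization.symmL_apply _ hx, Trivialization.apply_mk_symm _ hx]

/-- Each tangent vector in the chart domain is the value of a coordinate field, whose constant is
the coordinate vector. This lets velocities of a map be extended to vector fields. -/
theorem coordField_mfderiv {y x : X₀} (hx : x ∈ (chartAt H₀ y).source) (w : TangentSpace I₀ x) :
    coordField I₀ y (mfderiv I₀ 𝓘(ℝ, V₀) (extChartAt I₀ y) x w) x = w := by
  unfold coordField
  rw [← TangentBundle.continuousLinearMapAt_trivializationAt hx]
  exact Trivialization.symmL_continuousLinearMapAt _ (by simpa using hx) w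

/-- In the chart at `y` both fields are constant, so their derivatives within the range of the model
vanish. The centre `y` suffices, since the bracket is only needed there. -/
theorem mlieBracket_coordField [CompleteSpace V₀] (y : X₀) (v w : V₀) :
    VectorField.mlieBracket I₀ (coordField I₀ y v) (coordField I₀ y w) y = 0 := by
  have key : ∀ v : V₀, ∀ z ∈ (extChartAt I₀ y).target,
      VectorField.mpullbackWithin 𝓘(ℝ, V₀) I₀ (extChartAt I₀ y).symm (coordField I₀ y v)
        (range I₀) z = v := by
    intro v z hz
    have hz' : (extChartAt I₀ y).symm z ∈ (chartAt H₀ y).source := by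
      simpa using (extChartAt I₀ y).map_target hz
    rw [VectorField.mpullbackWithin_apply]
    unfold coordField
    rw [TangentBundle.symmL_trivializationAt hz',
      (extChartAt I₀ y).right_inv hz]
    exact (isInvertible_mfderivWithin_extChartAt_symm hz).inverse_apply_eq.2 rfl
  have hy : extChartAt I₀ y y ∈ range I₀ := extChartAt_target_subset_range y (mem_extChartAt_target y)
  have key' : ∀ v : V₀, VectorField.mpullbackWithin 𝓘(ℝ, V₀) I₀ (extChartAt I₀ y).symm
      (coordField I₀ y v) (range I₀) =ᶠ[𝓝[range I₀] (extChartAt I₀ y y)] fun _ => v :=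
    fun v => eventually_of_mem (extChartAt_target_mem_nhdsWithin y) (key v)
  rw [← VectorField.mlieBracketWithin_univ, VectorField.mlieBracketWithin_apply, preimage_univ,
    univ_inter]
  have h0 : VectorField.lieBracketWithin ℝ
      (VectorField.mpullbackWithin 𝓘(ℝ, V₀) I₀ (extChartAt I₀ y).symm (coordField I₀ y v) (range I₀))
      (VectorField.mpullbackWithin 𝓘(ℝ, V₀) I₀ (extChartAt I₀ y).symm (coordField I₀ y w) (range I₀))
      (range I₀) (extChartAt I₀ y y) = 0 := by
    have e1 : fderivWithin ℝ (VectorField.mpullbackWithin 𝓘(ℝ, V₀) I₀ (extChartAt I₀ y).symm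
      (coordField I₀ y v) (range I₀)) (range I₀) (extChartAt I₀ y y) = 0 :=
      ((key' v).fderivWithin_eq (key v _ (mem_extChartAt_target y))).trans (fderivWithin_const_apply _)
    have e2 : fderivWithin ℝ (VectorField.mpullbackWithin 𝓘(ℝ, V₀) I₀ (extChartAt I₀ y).symm
      (coordField I₀ y w) (range I₀)) (range I₀) (extChartAt I₀ y y) = 0 :=
      ((key' w).fderivWithin_eq (key w _ (mem_extChartAt_target y))).trans (fderivWithin_const_apply _)
    unfold VectorField.lieBracketWithin
    rw [e1, e2]
    exact sub_self 0
  rw [h0]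
  exact map_zero _

end CoordinateFields

/-! ### The pullback of a one-form by a map from a vector space, and its derivatives. -/

section OneForms

variable {V₀ : Type*} [NormedAddCommGroup V₀] [NormedSpace ℝ V₀] 
  {H₀ : Type*} [TopologicalSpace H₀] {I₀ : ModelWithCorners ℝ V₀ H₀}
  {X₀ : Type*} [TopologicalSpace X₀] [ChartedSpace H₀ X₀] [IsManifold I₀ ∞ X₀]
  {E : Type*} [NormedAddCommGroup E] [NormedSpace ℝ E]

/-- A one-form, evaluated on the derivative of a map `f` in the direction `w`. -/
def formAlong (A : ∀ x : X₀, TangentSpace I₀ x →L[ℝ] ℂ) (f : E → X₀) (w p : E) : ℂ :=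
  A (f p) (mfderiv 𝓘(ℝ, E) I₀ f p w)

theorem formAlong_smul_add (A : ∀ x : X₀, TangentSpace I₀ x →L[ℝ] ℂ) (f : E → X₀) (r : ℝ)
    (v w p : E) : formAlong A f (r • v + w) p = r * formAlong A f v p + formAlong A f w p := by
  let T : E →L[ℝ] TangentSpace I₀ (f p) := mfderiv 𝓘(ℝ, E) I₀ f p
  change A (f p) (T (r • v + w)) = r * A (f p) (T v) + A (f p) (T w)
  rw [map_add, map_smul, map_add, map_smul, Complex.real_smul]

theorem contMDiffAt_form_field {U : Set X₀} (hU : IsOpen U)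
    {A : ∀ x : X₀, TangentSpace I₀ x →L[ℝ] ℂ}
    (hA : ContMDiffOn I₀.tangent 𝓘(ℝ, ℂ) ∞ (fun v : TangentBundle I₀ X₀ => A v.proj v.2)
      {v | v.proj ∈ U}) {Z : ∀ x : X₀, TangentSpace I₀ x} {y : X₀} (hy : y ∈ U)
    (hZ : ContMDiffAt I₀ I₀.tangent ∞ (fun x => (⟨x, Z x⟩ : TangentBundle I₀ X₀)) y) :
    ContMDiffAt I₀ 𝓘(ℝ, ℂ) ∞ (fun x => A x (Z x)) y := by
  have hc : Continuous (fun v : TangentBundle I₀ X₀ => v.proj) :=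
    FiberBundle.continuous_proj V₀ (TangentSpace I₀)
  exact ContMDiffAt.comp y
    (hA.contMDiffAt ((hU.preimage hc).mem_nhds (show (⟨y, Z y⟩ : TangentBundle I₀ X₀) ∈ _ from hy)))
    hZ

/-- The derivative sees `Z` only through its value at `f p`, so this is the chain rule along `f`. -/
theorem fieldDeriv_along {F : Type*} [NormedAddCommGroup F] [NormedSpace ℝ F]
    {Z : ∀ x : X₀, TangentSpace I₀ x} {h : X₀ → F} {f : E → X₀} {p e : E}
    (hh : MDifferentiableAt I₀ 𝓘(ℝ, F) h (f p)) (hf : MDifferentiableAt 𝓘(ℝ, E) I₀ f p)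
    (hZ : Z (f p) = mfderiv 𝓘(ℝ, E) I₀ f p e) :
    fieldDeriv I₀ Z h (f p) = fderiv ℝ (fun p => h (f p)) p e := by
  let T : E →L[ℝ] F := (mfderiv I₀ 𝓘(ℝ, F) h (f p)).comp (mfderiv 𝓘(ℝ, E) I₀ f p)
  have h1 : HasFDerivAt (fun p => h (f p)) T p :=
    hasMFDerivAt_iff_hasFDerivAt.1 (hh.hasMFDerivAt.comp p hf.hasMFDerivAt)
  rw [fieldDeriv, hZ, h1.fderiv]
  rfl

variable [FiniteDimensional ℝ V₀]

/-- The velocity of `f` is expanded in coordinate fields. The coefficients carry the derivative of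
`f`, and the remaining factors are smooth functions on the manifold composed with `f`, so the
product rule becomes available. -/
theorem formAlong_eventuallyEq {A : ∀ x : X₀, TangentSpace I₀ x →L[ℝ] ℂ} {f : E → X₀}
    (hf : ContMDiff 𝓘(ℝ, E) I₀ ∞ f) (p₀ : E) (w : E) :
    ∀ᶠ p in 𝓝 p₀, formAlong A f w p = ∑ i, (Module.finBasis ℝ V₀).repr
      (fderiv ℝ (extChartAt I₀ (f p₀) ∘ f) p w) i •
        A (f p) (coordField I₀ (f p₀) (Module.finBasis ℝ V₀ i) (f p)) := by
  have h : ∀ᶠ p in 𝓝 p₀, f p ∈ (chartAt H₀ (f p₀)).source :=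
    hf.continuous.continuousAt.preimage_mem_nhds (chart_source_mem_nhds H₀ (f p₀))
  filter_upwards [h] with p hp
  have e1 : mfderiv I₀ 𝓘(ℝ, V₀) (extChartAt I₀ (f p₀)) (f p) (mfderiv 𝓘(ℝ, E) I₀ f p w)
      = fderiv ℝ (extChartAt I₀ (f p₀) ∘ f) p w := by
    rw [← mfderiv_eq_fderiv, mfderiv_comp p (mdifferentiableAt_extChartAt hp)
      (hf.mdifferentiable (by simp) p)]
    rfl
  have e2 := coordField_mfderiv hp (mfderiv 𝓘(ℝ, E) I₀ f p w)
  rw [e1] at e2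
  rw [formAlong, ← e2]
  conv_lhs => rw [← (Module.finBasis ℝ V₀).sum_repr (fderiv ℝ (extChartAt I₀ (f p₀) ∘ f) p w)]
  simp only [coordField, map_sum, map_smul]

/-- The product rule for the expansion in `formAlong_eventuallyEq`. It separates a term with the
second derivative of `f`, symmetric in `e` and `w`, from one that is the derivative of `A` on a
coordinate field. -/
theorem differentiableAt_formAlong {U : Set X₀} (hU : IsOpen U)
    {A : ∀ x : X₀, TangentSpace I₀ x →L[ℝ] ℂ}
    (hA : ContMDiffOn I₀.tangent 𝓘(ℝ, ℂ) ∞ (fun v : TangentBundle I₀ X₀ => A v.proj v.2)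
      {v | v.proj ∈ U}) {f : E → X₀} (hf : ContMDiff 𝓘(ℝ, E) I₀ ∞ f) {p₀ : E} (hp : f p₀ ∈ U)
    (w e : E) :
    DifferentiableAt ℝ (formAlong A f w) p₀ ∧
    fderiv ℝ (formAlong A f w) p₀ e = ∑ i, ((Module.finBasis ℝ V₀).repr
      (fderiv ℝ (fderiv ℝ (extChartAt I₀ (f p₀) ∘ f)) p₀ e w) i •
        A (f p₀) (coordField I₀ (f p₀) (Module.finBasis ℝ V₀ i) (f p₀)) +
      (Module.finBasis ℝ V₀).repr (fderiv ℝ (extChartAt I₀ (f p₀) ∘ f) p₀ w) i •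
        fderiv ℝ (fun p => A (f p) (coordField I₀ (f p₀) (Module.finBasis ℝ V₀ i) (f p))) p₀ e) := by
  set b := Module.finBasis ℝ V₀
  set g := extChartAt I₀ (f p₀) ∘ f with hg
  have hgs : ContDiffAt ℝ ∞ g p₀ :=
    (((contMDiffAt_extChartAt (n := ∞) (I := I₀) (x := f p₀)).comp p₀ hf.contMDiffAt)).contDiffAt
  have hdg : HasFDerivAt (fderiv ℝ g) (fderiv ℝ (fderiv ℝ g) p₀) p₀ :=
    ((hgs.fderiv_right (m := ∞) (by simp)).differentiableAt (by simp)).hasFDerivAt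
  have ha : ∀ i, HasFDerivAt (fun p => A (f p) (coordField I₀ (f p₀) (b i) (f p)))
      (fderiv ℝ (fun p => A (f p) (coordField I₀ (f p₀) (b i) (f p))) p₀) p₀ := by
    intro i
    have h1 : ContMDiffAt I₀ 𝓘(ℝ, ℂ) ∞ (fun x => A x (coordField I₀ (f p₀) (b i) x)) (f p₀) :=
      contMDiffAt_form_field hU hA hp ((contMDiffOn_coordField (f p₀) (b i)).contMDiffAt
        ((trivializationAt V₀ (TangentSpace I₀ : X₀ → Type _) (f p₀)).open_baseSet.mem_nhds
          (FiberBundle.mem_baseSet_trivializationAt' (f p₀))))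
    exact (((h1.comp p₀ hf.contMDiffAt).contDiffAt).differentiableAt (by simp)).hasFDerivAt
  have hr : ∀ i, HasFDerivAt (fun p => b.repr (fderiv ℝ g p w) i)
      ((LinearMap.toContinuousLinearMap (b.coord i)).comp
        ((ContinuousLinearMap.apply ℝ V₀ w).comp (fderiv ℝ (fderiv ℝ g) p₀))) p₀ := fun i =>
    (LinearMap.toContinuousLinearMap (b.coord i)).hasFDerivAt.comp p₀
      ((ContinuousLinearMap.apply ℝ V₀ w).hasFDerivAt.comp p₀ hdg)
  have hs := (HasFDerivAt.fun_sum (u := Finset.univ) fun i _ => (hr i).smul (ha i)).congr_of_eventuallyEq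
    (formAlong_eventuallyEq hf p₀ w)
  refine ⟨hs.differentiableAt, ?_⟩
  rw [hs.fderiv, sum_apply]
  refine Finset.sum_congr rfl fun i _ => ?_
  rw [add_comm]
  rfl

/-- This is the naturality `d(f^*A) = f^*(dA)` at one point, in the form that the curvature
condition can use. The fields `Y` and `Z` are constant in the chart at `f p₀`, cut off outside a
neighbourhood, and chosen to match the two velocities. Their bracket vanishes at `f p₀`, and the
second derivatives of `f` cancel by symmetry. -/
theorem exists_fields_extDeriv_eq [T2Space X₀] {U : Set X₀} (hU : IsOpen U)
    {A : ∀ x : X₀, TangentSpace I₀ x →L[ℝ] ℂ}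
    (hA : ContMDiffOn I₀.tangent 𝓘(ℝ, ℂ) ∞ (fun v : TangentBundle I₀ X₀ => A v.proj v.2)
      {v | v.proj ∈ U}) {f : E → X₀} (hf : ContMDiff 𝓘(ℝ, E) I₀ ∞ f) {p₀ : E} (hp : f p₀ ∈ U)
    (e₁ e₂ : E) :
    ∃ Y Z : ∀ x : X₀, TangentSpace I₀ x, IsSmoothField I₀ Y ∧ IsSmoothField I₀ Z ∧
      Y (f p₀) = mfderiv 𝓘(ℝ, E) I₀ f p₀ e₁ ∧ Z (f p₀) = mfderiv 𝓘(ℝ, E) I₀ f p₀ e₂ ∧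
      fieldDeriv I₀ Y (fun y => A y (Z y)) (f p₀) - fieldDeriv I₀ Z (fun y => A y (Y y)) (f p₀)
        - A (f p₀) (VectorField.mlieBracket I₀ Y Z (f p₀))
      = fderiv ℝ (formAlong A f e₂) p₀ e₁ - fderiv ℝ (formAlong A f e₁) p₀ e₂ := by
  set b := Module.finBasis ℝ V₀
  set g := extChartAt I₀ (f p₀) ∘ f with hg
  set K : V₀ → ∀ x : X₀, TangentSpace I₀ x := coordField I₀ (f p₀) with hK
  have hmem := FiberBundle.mem_baseSet_trivializationAt' (F := V₀)
    (E := (TangentSpace I₀ : X₀ → Type _)) (f p₀)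
  have hopen := (trivializationAt V₀ (TangentSpace I₀ : X₀ → Type _) (f p₀)).open_baseSet
  have hext : ∀ e : E, ∃ Y : ∀ x : X₀, TangentSpace I₀ x, IsSmoothField I₀ Y ∧
      ∀ᶠ x in 𝓝 (f p₀), Y x = K (fderiv ℝ g p₀ e) x := fun e =>
    exists_contMDiff_section_eventuallyEq hopen hmem (contMDiffOn_coordField (f p₀) _)
  have hKe : ∀ e : E, K (fderiv ℝ g p₀ e) (f p₀) = mfderiv 𝓘(ℝ, E) I₀ f p₀ e := by
    intro e
    have e1 : mfderiv I₀ 𝓘(ℝ, V₀) (extChartAt I₀ (f p₀)) (f p₀) (mfderiv 𝓘(ℝ, E) I₀ f p₀ e)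
        = fderiv ℝ g p₀ e := by
      rw [← mfderiv_eq_fderiv, hg, mfderiv_comp p₀ (mdifferentiableAt_extChartAt
        (mem_chart_source H₀ (f p₀))) (hf.mdifferentiable (by simp) p₀)]
      rfl
    rw [← e1]
    exact coordField_mfderiv (mem_chart_source H₀ (f p₀)) _
  -- The derivative of `A` on a field that is constant in the chart is precisely the part of the
  -- derivative of `formAlong` without second derivatives of `f`.
  have hfd : ∀ (Y Z : ∀ x : X₀, TangentSpace I₀ x) (e e' : E),
      (∀ᶠ x in 𝓝 (f p₀), Y x = K (fderiv ℝ g p₀ e) x) →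
      (∀ᶠ x in 𝓝 (f p₀), Z x = K (fderiv ℝ g p₀ e') x) →
      fieldDeriv I₀ Y (fun y => A y (Z y)) (f p₀) = ∑ i, b.repr (fderiv ℝ g p₀ e') i •
        fderiv ℝ (fun p => A (f p) (K (b i) (f p))) p₀ e := by
    intro Y Z e e' hY hZ
    have hb : ∀ i, ContMDiffAt I₀ 𝓘(ℝ, ℂ) ∞ (fun x => A x (K (b i) x)) (f p₀) := fun i =>
      contMDiffAt_form_field hU hA hp ((contMDiffOn_coordField (f p₀) (b i)).contMDiffAt
        (hopen.mem_nhds hmem))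
    have ha : ∀ i, HasFDerivAt (fun p => A (f p) (K (b i) (f p)))
        (fderiv ℝ (fun p => A (f p) (K (b i) (f p))) p₀) p₀ := fun i =>
      ((((hb i).comp p₀ hf.contMDiffAt).contDiffAt).differentiableAt (by simp)).hasFDerivAt
    have heq : (fun p => A (f p) (Z (f p))) =ᶠ[𝓝 p₀]
        fun p => ∑ i, b.repr (fderiv ℝ g p₀ e') i • A (f p) (K (b i) (f p)) := by
      filter_upwards [hf.continuous.continuousAt.eventually hZ] with p hx
      rw [hx]
      conv_lhs => rw [← b.sum_repr (fderiv ℝ g p₀ e')]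
      simp only [hK, coordField, map_sum, map_smul]
    have hd : MDifferentiableAt I₀ 𝓘(ℝ, ℂ) (fun y => A y (Z y)) (f p₀) := by
      refine (contMDiffAt_form_field hU hA hp
        (((contMDiffOn_coordField (f p₀) (fderiv ℝ g p₀ e')).contMDiffAt
          (hopen.mem_nhds hmem)).congr_of_eventuallyEq ?_)).mdifferentiableAt (by simp)
      filter_upwards [hZ] with x hx
      rw [hx]
    rw [fieldDeriv_along hd (hf.mdifferentiable (by simp) p₀) (hY.self_of_nhds.trans (hKe e)),
      ((HasFDerivAt.fun_sum (u := Finset.univ) fun i _ =>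
        (ha i).const_smul (b.repr (fderiv ℝ g p₀ e') i)).congr_of_eventuallyEq heq).fderiv]
    simp
  obtain ⟨Y, hYs, hY⟩ := hext e₁
  obtain ⟨Z, hZs, hZ⟩ := hext e₂
  refine ⟨Y, Z, hYs, hZs, hY.self_of_nhds.trans (hKe _), hZ.self_of_nhds.trans (hKe _), ?_⟩
  have hbr : VectorField.mlieBracket I₀ Y Z (f p₀) = 0 := by
    rw [Filter.EventuallyEq.mlieBracket_vectorField_eq hY hZ]
    exact mlieBracket_coordField _ _ _
  have hgs : ContDiffAt ℝ ∞ g p₀ :=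
    (((contMDiffAt_extChartAt (n := ∞) (I := I₀) (x := f p₀)).comp p₀ hf.contMDiffAt)).contDiffAt
  have hsymm : fderiv ℝ (fderiv ℝ g) p₀ e₁ e₂ = fderiv ℝ (fderiv ℝ g) p₀ e₂ e₁ :=
    (hgs.isSymmSndFDerivAt (by simpa using WithTop.coe_le_coe.2 (le_top (a := (2 : ℕ∞))))).eq e₁ e₂
  rw [hbr, map_zero, sub_zero, hfd Y Z e₁ e₂ hY hZ, hfd Z Y e₂ e₁ hZ hY,
    (differentiableAt_formAlong hU hA hf hp e₂ e₁).2,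
    (differentiableAt_formAlong hU hA hf hp e₁ e₂).2, ← hg, hsymm]
  simp only [Finset.sum_add_distrib]
  rw [add_sub_add_left_eq_sub]

end OneForms

/-! ### Covariant derivatives in local frames -/

/-- If `∂ₛf + f P = R f` and `∂ₛQ - ∂ₜP = -∂ₜR`, then `∂ₜf / f + Q` does not depend on `s`. -/
theorem hasDerivAt_logDeriv_add {f P Q R : ℝ × ℝ → ℂ} {s₀ t₀ : ℝ}
    (hf : ContDiffAt ℝ ∞ f (s₀, t₀)) (hf0 : f (s₀, t₀) ≠ 0)
    (hP : DifferentiableAt ℝ P (s₀, t₀)) (hQ : DifferentiableAt ℝ Q (s₀, t₀))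
    (hR : DifferentiableAt ℝ R (s₀, t₀))
    (heq : ∀ᶠ p in 𝓝 (s₀, t₀), fderiv ℝ f p (1, 0) + f p * P p = R p * f p)
    (hcurv : fderiv ℝ Q (s₀, t₀) (1, 0) - fderiv ℝ P (s₀, t₀) (0, 1)
      = -fderiv ℝ R (s₀, t₀) (0, 1)) :
    HasDerivAt (fun s => fderiv ℝ f (s, t₀) (0, 1) / f (s, t₀) + Q (s, t₀)) 0 s₀ := by
  have hD : HasFDerivAt (fderiv ℝ f) (fderiv ℝ (fderiv ℝ f) (s₀, t₀)) (s₀, t₀) :=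
    ((hf.fderiv_right (m := ∞) (by simp)).differentiableAt (by simp)).hasFDerivAt
  have hsymm : fderiv ℝ (fderiv ℝ f) (s₀, t₀) (1, 0) (0, 1)
      = fderiv ℝ (fderiv ℝ f) (s₀, t₀) (0, 1) (1, 0) :=
    (hf.isSymmSndFDerivAt (by simpa using WithTop.coe_le_coe.2 (le_top (a := (2 : ℕ∞))))).eq _ _
  have hfd : HasFDerivAt f (fderiv ℝ f (s₀, t₀)) (s₀, t₀) :=
    (hf.differentiableAt (by simp)).hasFDerivAt
  -- The equation `∂ₛf = (R - P) f` holds near the point, so it may be differentiated in `t`.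
  have hmix : fderiv ℝ (fderiv ℝ f) (s₀, t₀) (0, 1) (1, 0)
      = (fderiv ℝ R (s₀, t₀) (0, 1) - fderiv ℝ P (s₀, t₀) (0, 1)) * f (s₀, t₀)
        + (R (s₀, t₀) - P (s₀, t₀)) * fderiv ℝ f (s₀, t₀) (0, 1) := by
    have h1 : HasFDerivAt (fun p => fderiv ℝ f p (1, 0))
        ((ContinuousLinearMap.apply ℝ ℂ ((1 : ℝ), (0 : ℝ))).comp
          (fderiv ℝ (fderiv ℝ f) (s₀, t₀))) (s₀, t₀) :=
      (ContinuousLinearMap.apply ℝ ℂ ((1 : ℝ), (0 : ℝ))).hasFDerivAt.comp _ hD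
    have h2 := (hR.hasFDerivAt.sub hP.hasFDerivAt).mul hfd
    have h3 : (fun p => fderiv ℝ f p (1, 0)) =ᶠ[𝓝 (s₀, t₀)] (R - P) * f := by
      filter_upwards [heq] with p hp
      simp only [Pi.mul_apply, Pi.sub_apply]
      linear_combination hp
    have h4 := congrArg (fun T : ℝ × ℝ →L[ℝ] ℂ => T (0, 1)) (h1.unique (h2.congr_of_eventuallyEq h3))
    simp only [ContinuousLinearMap.comp_apply, ContinuousLinearMap.apply_apply, add_apply,
      smul_apply, sub_apply, Pi.sub_apply, smul_eq_mul] at h4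
    rw [h4]
    ring
  have hpath : HasDerivAt (fun s : ℝ => (s, t₀)) ((1 : ℝ), (0 : ℝ)) s₀ :=
    (hasDerivAt_id s₀).prodMk (hasDerivAt_const s₀ t₀)
  have k1 : HasDerivAt (fun s => fderiv ℝ f (s, t₀) (0, 1))
      (fderiv ℝ (fderiv ℝ f) (s₀, t₀) (1, 0) (0, 1)) s₀ := by
    have h1 : HasFDerivAt (fun p => fderiv ℝ f p (0, 1))
        ((ContinuousLinearMap.apply ℝ ℂ ((0 : ℝ), (1 : ℝ))).comp
          (fderiv ℝ (fderiv ℝ f) (s₀, t₀))) (s₀, t₀) :=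
      (ContinuousLinearMap.apply ℝ ℂ ((0 : ℝ), (1 : ℝ))).hasFDerivAt.comp _ hD
    exact h1.comp_hasDerivAt s₀ hpath
  have k2 : HasDerivAt (fun s => f (s, t₀)) (fderiv ℝ f (s₀, t₀) (1, 0)) s₀ :=
    hfd.comp_hasDerivAt s₀ hpath
  have k3 : HasDerivAt (fun s => Q (s, t₀)) (fderiv ℝ Q (s₀, t₀) (1, 0)) s₀ :=
    hQ.hasFDerivAt.comp_hasDerivAt s₀ hpath
  refine ((k1.div k2 hf0).add k3).congr_deriv ?_
  -- With `∂ₛf = (R - P) f`, the derivative of `∂ₜf / f` reduces to `∂ₜR - ∂ₜP`, which cancels `∂ₛQ`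
  -- by `hcurv`.
  have e0 := heq.self_of_nhds
  rw [hsymm, hmix]
  field_simp
  linear_combination (-fderiv ℝ f (s₀, t₀) (0, 1)) * e0 + f (s₀, t₀) ^ 2 * hcurv

section LineBundles

variable {V₀ : Type*} [NormedAddCommGroup V₀] [NormedSpace ℝ V₀]
  {H₀ : Type*} [TopologicalSpace H₀] {I₀ : ModelWithCorners ℝ V₀ H₀}
  {X₀ : Type*} [TopologicalSpace X₀] [ChartedSpace H₀ X₀]
  {V₁ : Type*} [NormedAddCommGroup V₁] [NormedSpace ℝ V₁]
  {H₁ : Type*} [TopologicalSpace H₁] {I₁ : ModelWithCorners ℝ V₁ H₁}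
  {X₁ : Type*} [TopologicalSpace X₁] [ChartedSpace H₁ X₁]
  {G : LieGroupoid I₀ X₀ I₁ X₁}

theorem TotalSpace.mk_smul {L : X₀ → Type*} [∀ x, AddCommMonoid (L x)] [∀ x, Module ℂ (L x)]
    {x y : X₀} {u : L x} {v : L y} (h : (⟨x, u⟩ : TotalSpace ℂ L) = ⟨y, v⟩) (a : ℂ) :
    (⟨x, a • u⟩ : TotalSpace ℂ L) = ⟨y, a • v⟩ := by
  obtain ⟨rfl, h⟩ := TotalSpace.mk.inj h
  rw [eq_of_heq h]

/-- The covariant derivative depends only on the section, as a map to the total space. -/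
theorem LineBundleData.covDeriv_congr {L : X₀ → Type*} [∀ x, AddCommMonoid (L x)]
    [∀ x, Module ℂ (L x)] (B : LineBundleData G L)
    {γ γ' : ℝ → X₀} {u : ∀ t, L (γ t)} {u' : ∀ t, L (γ' t)}
    (h : ∀ t, (⟨γ t, u t⟩ : TotalSpace ℂ L) = ⟨γ' t, u' t⟩) (t : ℝ) :
    (⟨γ t, B.covDeriv γ u t⟩ : TotalSpace ℂ L) = ⟨γ' t, B.covDeriv γ' u' t⟩ := by
  obtain rfl : γ = γ' := funext fun t => congrArg TotalSpace.proj (h t)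
  obtain rfl : u = u' := funext fun t => TotalSpace.mk_injective (γ t) (h t)
  rfl

variable [IsManifold I₀ ∞ X₀]
  {L : X₀ → Type*} [∀ x, AddCommGroup (L x)] [∀ x, Module ℂ (L x)]
  [TopologicalSpace (TotalSpace ℂ L)] [∀ x, TopologicalSpace (L x)] [FiberBundle ℂ L]
  [VectorBundle ℂ ℂ L] {B : LineBundleData G L}

theorem LineBundleData.IsConnectionForm.contDiffAt_frameCoeff {S U : Set X₀} {σ : ∀ x, L x}
    {A : ∀ x : X₀, TangentSpace I₀ x →L[ℝ] ℂ} (hA : B.IsConnectionForm S U σ A)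
    {E : Type*} [NormedAddCommGroup E] [NormedSpace ℝ E] {u : E → TotalSpace ℂ L}
    (hu : ContMDiff 𝓘(ℝ, E) (I₀.prod 𝓘(ℝ, ℂ)) ∞ u) {p : E} (hp : (u p).proj ∈ U) :
    ContDiffAt ℝ ∞ (fun p => frameCoeff σ (u p)) p :=
  ((contMDiffAt_frameCoeff hA.isOpen hA.smooth_frame hA.frame_ne_zero hp).comp p
    hu.contMDiffAt).contDiffAt

/-- The covariant derivative of a section along a curve which is the restriction of a section
along a map with several parameters. -/
theorem LineBundleData.IsConnectionForm.covDeriv_along {S U : Set X₀} {σ : ∀ x, L x}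
    {A : ∀ x : X₀, TangentSpace I₀ x →L[ℝ] ℂ} (hA : B.IsConnectionForm S U σ A)
    {E : Type*} [NormedAddCommGroup E] [NormedSpace ℝ E] {u : E → TotalSpace ℂ L}
    (hu : ContMDiff 𝓘(ℝ, E) (I₀.prod 𝓘(ℝ, ℂ)) ∞ u)
    {γ : ℝ → X₀} {v : ∀ t, L (γ t)} (hv : IsSmoothAlong I₀ γ v) (hγ : ∀ t, γ t ∈ S) {t : ℝ}
    (ht : γ t ∈ U) {q : ℝ → E} {q' : E} (hq : HasDerivAt q q' t)
    (heq : ∀ᶠ s in 𝓝 t, (⟨γ s, v s⟩ : TotalSpace ℂ L) = u (q s)) :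
    B.covDeriv γ v t = (fderiv ℝ (fun p => frameCoeff σ (u p)) (q t) q'
      + frameCoeff σ (u (q t)) * formAlong A (fun p => (u p).proj) q' (q t)) • σ (γ t) := by
  have hγs : ContMDiff 𝓘(ℝ, ℝ) I₀ ∞ γ := (contMDiff_proj L).comp hv
  have hFs : ContMDiff 𝓘(ℝ, E) I₀ ∞ (fun p => (u p).proj) := (contMDiff_proj L).comp hu
  have hev : ∀ᶠ s in 𝓝 t, v s = frameCoeff σ ⟨γ s, v s⟩ • σ (γ s) := by
    filter_upwards [hγs.continuous.continuousAt.preimage_mem_nhds (hA.isOpen.mem_nhds ht)] with s hs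
    exact (frameCoeff_smul_eq (hA.frame_ne_zero _ hs) _).symm
  rw [hA.covDeriv_eq γ v hv hγ t ht _ hev]
  have h0 : (⟨γ t, v t⟩ : TotalSpace ℂ L) = u (q t) := heq.self_of_nhds
  have hproj : γ t = (u (q t)).proj := congrArg TotalSpace.proj h0
  have h1 : deriv (fun s => frameCoeff σ ⟨γ s, v s⟩) t
      = fderiv ℝ (fun p => frameCoeff σ (u p)) (q t) q' := by
    have hd := ((hA.contDiffAt_frameCoeff hu (p := q t) (hproj ▸ ht)).differentiableAt
      (by simp)).hasFDerivAt.comp_hasDerivAt t hq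
    refine (hd.congr_of_eventuallyEq ?_).deriv
    filter_upwards [heq] with s hs
    rw [hs, Function.comp]
  have h2 : A (γ t) (mfderiv 𝓘(ℝ, ℝ) I₀ γ t (1 : ℝ))
      = formAlong A (fun p => (u p).proj) q' (q t) := by
    have hγF : γ =ᶠ[𝓝 t] (fun p => (u p).proj) ∘ q := by
      filter_upwards [heq] with s hs
      exact congrArg TotalSpace.proj hs
    have hqm : HasMFDerivAt 𝓘(ℝ, ℝ) 𝓘(ℝ, E) q t (ContinuousLinearMap.toSpanSingleton ℝ q') :=
      hasMFDerivAt_iff_hasFDerivAt.2 hq.hasFDerivAt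
    have hm := ((hFs.mdifferentiable (by simp) (q t)).hasMFDerivAt.comp t hqm).congr_of_eventuallyEq
      hγF
    have hval : (mfderiv 𝓘(ℝ, ℝ) I₀ γ t (1 : ℝ) : V₀)
        = mfderiv 𝓘(ℝ, E) I₀ (fun p => (u p).proj) (q t) q' := by
      rw [hm.mfderiv]
      change mfderiv 𝓘(ℝ, E) I₀ (fun p => (u p).proj) (q t) ((1 : ℝ) • q') = _
      rw [one_smul]
    -- The base points `γ t` and `(u (q t)).proj` agree only by a proved equation, so the two
    -- velocities are compared as points of the tangent bundle.
    have htot : (⟨γ t, mfderiv 𝓘(ℝ, ℝ) I₀ γ t (1 : ℝ)⟩ : TangentBundle I₀ X₀)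
        = ⟨(u (q t)).proj, mfderiv 𝓘(ℝ, E) I₀ (fun p => (u p).proj) (q t) q'⟩ :=
      TotalSpace.ext hproj (heq_of_eq hval)
    exact congrArg (fun w : TangentBundle I₀ X₀ => A w.proj w.2) htot
  rw [h1, h2, h0]

/-- The Leibniz rule. -/
theorem LineBundleData.IsHermitianLineBundle.covDeriv_smul {S : Set X₀}
    (hB : B.IsHermitianLineBundle S) {γ : ℝ → X₀} {u v : ∀ t, L (γ t)}
    (hu : IsSmoothAlong I₀ γ u) (hv : IsSmoothAlong I₀ γ v) (hγ : ∀ t, γ t ∈ S)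
    {h : ℝ → ℂ} {t : ℝ} (hh : DifferentiableAt ℝ h t) (heq : ∀ᶠ s in 𝓝 t, u s = h s • v s) :
    B.covDeriv γ u t = deriv h t • v t + h t • B.covDeriv γ v t := by
  obtain ⟨U, σ, A, ht, hA⟩ := hB.exists_connectionForm _ (hγ t)
  have hγs : ContMDiff 𝓘(ℝ, ℝ) I₀ ∞ γ := (contMDiff_proj L).comp hv
  have hev : ∀ᶠ s in 𝓝 t, v s = frameCoeff σ ⟨γ s, v s⟩ • σ (γ s) := by
    filter_upwards [hγs.continuous.continuousAt.preimage_mem_nhds (hA.isOpen.mem_nhds ht)] with s hs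
    exact (frameCoeff_smul_eq (hA.frame_ne_zero _ hs) _).symm
  have hev' : ∀ᶠ s in 𝓝 t, u s = (h s * frameCoeff σ ⟨γ s, v s⟩) • σ (γ s) := by
    filter_upwards [hev, heq] with s h1 h2
    rw [mul_smul, ← h1, h2]
  have hd : DifferentiableAt ℝ (fun s => frameCoeff σ ⟨γ s, v s⟩) t :=
    (hA.contDiffAt_frameCoeff hv ht).differentiableAt (by simp)
  rw [hA.covDeriv_eq γ u hu hγ t ht _ hev', hA.covDeriv_eq γ v hv hγ t ht _ hev]
  have e : deriv h t • v t = (deriv h t * frameCoeff σ ⟨γ t, v t⟩) • σ (γ t) := by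
    rw [mul_smul, ← hev.self_of_nhds]
  rw [deriv_fun_mul hh hd, smul_smul, e, ← add_smul]
  congr 1
  ring

theorem LineBundleData.IsHermitianLineBundle.herm_zero_right {S : Set X₀}
    (hB : B.IsHermitianLineBundle S) {x : X₀} (hx : x ∈ S) (u : L x) : B.herm x u 0 = 0 := by
  have := hB.herm_smul x hx 0 u 0
  rwa [zero_smul, zero_mul] at this

theorem LineBundleData.IsHermitianLineBundle.eq_zero_of_herm_self {S : Set X₀}
    (hB : B.IsHermitianLineBundle S) {x : X₀} (hx : x ∈ S) {u : L x} (h : B.herm x u u = 0) :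
    u = 0 := by
  by_contra hu
  have := hB.herm_pos x hx u hu
  rw [h] at this
  exact lt_irrefl _ this

end LineBundles

/-! ### Smoothness of the action of arrows on sections along maps. -/

section Moves

variable {V₀ : Type*} [NormedAddCommGroup V₀] [NormedSpace ℝ V₀] [FiniteDimensional ℝ V₀]
  {H₀ : Type*} [TopologicalSpace H₀] {I₀ : ModelWithCorners ℝ V₀ H₀}
  {X₀ : Type*} [TopologicalSpace X₀] [ChartedSpace H₀ X₀] [IsManifold I₀ ∞ X₀] [T2Space X₀]
  {V₁ : Type*} [NormedAddCommGroup V₁] [NormedSpace ℝ V₁]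
  {H₁ : Type*} [TopologicalSpace H₁] {I₁ : ModelWithCorners ℝ V₁ H₁}
  {X₁ : Type*} [TopologicalSpace X₁] [ChartedSpace H₁ X₁]
  {G : LieGroupoid I₀ X₀ I₁ X₁}
  {W : Type*} [NormedAddCommGroup W] [NormedSpace ℝ W]
  {K : Type*} [TopologicalSpace K] {J : ModelWithCorners ℝ W K}
  {M : Type*} [TopologicalSpace M] [ChartedSpace K M]
  {L : X₀ → Type*} [∀ x, AddCommGroup (L x)] [∀ x, Module ℂ (L x)]
  [TopologicalSpace (TotalSpace ℂ L)] [∀ x, TopologicalSpace (L x)] [FiberBundle ℂ L]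
  [VectorBundle ℂ ℂ L] [VectorBundle ℝ ℂ L] [ContMDiffVectorBundle ∞ ℂ L I₀]
  {B : LineBundleData G L}

/-- The action of the arrows is smooth along any smooth map to the manifold of arrows. -/
theorem LineBundleData.IsHermitianLineBundle.contMDiff_move (hB : B.IsHermitianLineBundle univ)
    {k : M → X₁} (hk : ContMDiff J I₁ ∞ k) {u : ∀ m, L (G.src (k m))}
    (hu : ContMDiff J (I₀.prod 𝓘(ℝ, ℂ)) ∞ (fun m => (⟨G.src (k m), u m⟩ : TotalSpace ℂ L))) :
    ContMDiff J (I₀.prod 𝓘(ℝ, ℂ)) ∞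
      (fun m => (⟨G.tgt (k m), B.move (k m) (u m)⟩ : TotalSpace ℂ L)) := by
  intro m
  -- Smoothness of the action is assumed only for global sections. Hence `u` is written locally as a
  -- smooth coefficient times a global section that does not vanish nearby, and the coefficient
  -- passes through the linear map.
  obtain ⟨σ, U, hU, hm, hσ, hσ0⟩ := exists_contMDiff_section_ne_zero I₀ L (G.src (k m))
  have h1 : ContMDiff I₁ (I₀.prod 𝓘(ℝ, ℂ)) ∞
      (fun g => (⟨G.tgt g, B.move g (σ (G.src g))⟩ : TotalSpace ℂ L)) := by
    rw [← contMDiffOn_univ]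
    exact (hB.smooth_move σ hσ).mono fun g _ => mem_univ _
  have h2 : ContMDiffAt J 𝓘(ℝ, ℂ) ∞ (fun m => frameCoeff σ ⟨G.src (k m), u m⟩) m :=
    ContMDiffAt.comp m (contMDiffAt_frameCoeff hU hσ.contMDiffOn hσ0 hm) hu.contMDiffAt
  have h3 := ContMDiffWithinAt.totalSpace_smul (s := univ) h2.contMDiffWithinAt
    (p := fun m => G.tgt (k m)) (u := fun m => B.move (k m) (σ (G.src (k m))))
    (h1.comp hk).contMDiffAt.contMDiffWithinAt
  refine (contMDiffWithinAt_univ.1 h3).congr_of_eventuallyEq ?_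
  filter_upwards [(G.smooth_src.comp hk).continuous.continuousAt.preimage_mem_nhds
    (hU.mem_nhds hm)] with m' hm'
  rw [← map_smul, frameCoeff_smul_eq (hσ0 (G.src (k m')) hm') (u m')]

end Moves

/-! ### The lifted circle action preserves the connection, up to the moment map -/

section Lift

variable {V₀ : Type*} [NormedAddCommGroup V₀] [NormedSpace ℝ V₀]
  {H₀ : Type*} [TopologicalSpace H₀] {I₀ : ModelWithCorners ℝ V₀ H₀}
  {X₀ : Type*} [TopologicalSpace X₀] [ChartedSpace H₀ X₀] [IsManifold I₀ ∞ X₀]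
  {V₁ : Type*} [NormedAddCommGroup V₁] [NormedSpace ℝ V₁]
  {H₁ : Type*} [TopologicalSpace H₁] {I₁ : ModelWithCorners ℝ V₁ H₁}
  {X₁ : Type*} [TopologicalSpace X₁] [ChartedSpace H₁ X₁]
  {G : LieGroupoid I₀ X₀ I₁ X₁}
  {Ω : ∀ x : X₀, TangentSpace I₀ x →L[ℝ] TangentSpace I₀ x →L[ℝ] ℝ}
  {C : CircleAction G} {c : ℝ} {Φ : X₀ → ℝ}

theorem CircleAction.smooth_orbit (C : CircleAction G) (x : X₀) :
    ContMDiff 𝓘(ℝ, ℝ) I₀ ∞ (fun s : ℝ => C.obj (Circle.exp s) x) :=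
  C.smooth_obj.comp (contMDiff_circleExp.prodMk contMDiff_const)

/-- Along an orbit the derivative of `Φ` is `c Ω(X, X)`, with `X` the generator, and this is zero
because `Ω` is alternating. -/
theorem IsMomentMap.apply_exp (hΩ : IsSymplecticForm G Ω) (hΦ : IsMomentMap C Ω c Φ)
    (x : X₀) (φ : ℝ) : Φ (C.obj (Circle.exp φ) x) = Φ x := by
  have hd : ∀ s : ℝ, HasDerivAt (fun s : ℝ => Φ (C.obj (Circle.exp s) x)) 0 s := by
    intro s
    have h1 := ((hΦ.smooth.mdifferentiable (by simp) _).hasMFDerivAt.comp s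
      ((C.smooth_orbit x).mdifferentiable (by simp) s).hasMFDerivAt)
    let T : ℝ →L[ℝ] ℝ := (mfderiv I₀ 𝓘(ℝ, ℝ) Φ (C.obj (Circle.exp s) x)).comp
      (mfderiv 𝓘(ℝ, ℝ) I₀ (fun s : ℝ => C.obj (Circle.exp s) x) s)
    have h2 : HasFDerivAt (fun s : ℝ => Φ (C.obj (Circle.exp s) x)) T s :=
      hasMFDerivAt_iff_hasFDerivAt.1 h1
    refine h2.hasDerivAt.congr_deriv ?_
    have h3 := hΦ.moment x s (mfderiv 𝓘(ℝ, ℝ) I₀ (fun s : ℝ => C.obj (Circle.exp s) x) s (1 : ℝ))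
    rw [map_smul, smul_apply, hΩ.alternating, smul_zero] at h3
    exact h3.symm
  have h := is_const_of_deriv_eq_zero (fun s => (hd s).differentiableAt) (fun s => (hd s).deriv) φ 0
  simpa [C.obj_one] using h

theorem IsMomentMap.apply_obj (hΩ : IsSymplecticForm G Ω) (hΦ : IsMomentMap C Ω c Φ)
    (a : Circle) (x : X₀) : Φ (C.obj a x) = Φ x := by
  rw [← Circle.exp_arg a]
  exact hΦ.apply_exp hΩ x _

variable {L : X₀ → Type*} [∀ x, AddCommGroup (L x)] [∀ x, Module ℂ (L x)]
  [TopologicalSpace (TotalSpace ℂ L)] [∀ x, TopologicalSpace (L x)] [FiberBundle ℂ L]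
  [VectorBundle ℂ ℂ L] {B : LineBundleData G L}
  {lift : ∀ (a : Circle) (x : X₀), L x →ₗ[ℂ] L (C.obj a x)}

theorem IsCircleLift.smoothAlong (hlift : IsCircleLift C B lift) {a : ℝ → Circle}
    (ha : ContMDiff 𝓘(ℝ, ℝ) (𝓡 1) ∞ a) {γ : ℝ → X₀} {u : ∀ t, L (γ t)}
    (hu : IsSmoothAlong I₀ γ u) :
    IsSmoothAlong I₀ (fun t => C.obj (a t) (γ t)) (fun t => lift (a t) (γ t) (u t)) :=
  hlift.smooth.comp (ha.prodMk hu)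

theorem IsCircleLift.ne_zero (hlift : IsCircleLift C B lift)
    (hB : B.IsHermitianLineBundle univ) (a : Circle) {x : X₀} {u : L x} (hu : u ≠ 0) :
    lift a x u ≠ 0 := by
  intro h
  have h1 := hlift.unitary a x u u
  rw [h, hB.herm_zero_right (mem_univ _)] at h1
  exact hu (hB.eq_zero_of_herm_self (mem_univ _) h1.symm)

/-- The section along a two-parameter map obtained by rotating a section along a curve. -/
def rotatedSection (lift : ∀ (a : Circle) (x : X₀), L x →ₗ[ℂ] L (C.obj a x)) (γ : ℝ → X₀)
    (v : ∀ t, L (γ t)) (p : ℝ × ℝ) : TotalSpace ℂ L :=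
  ⟨C.obj (Circle.exp p.1) (γ p.2), lift (Circle.exp p.1) (γ p.2) (v p.2)⟩

theorem IsCircleLift.contMDiff_rotatedSection (hlift : IsCircleLift C B lift) {γ : ℝ → X₀}
    {v : ∀ t, L (γ t)} (hv : IsSmoothAlong I₀ γ v) :
    ContMDiff 𝓘(ℝ, ℝ × ℝ) (I₀.prod 𝓘(ℝ, ℂ)) ∞ (rotatedSection lift γ v) := by
  have h1 : ContMDiff 𝓘(ℝ, ℝ × ℝ) (𝓡 1) ∞ (fun p : ℝ × ℝ => Circle.exp p.1) :=
    contMDiff_circleExp.comp contDiff_fst.contMDiff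
  have h2 : ContMDiff 𝓘(ℝ, ℝ × ℝ) (I₀.prod 𝓘(ℝ, ℂ)) ∞
      (fun p : ℝ × ℝ => (⟨γ p.2, v p.2⟩ : TotalSpace ℂ L)) :=
    ContMDiff.comp (g := fun t => (⟨γ t, v t⟩ : TotalSpace ℂ L)) hv contDiff_snd.contMDiff
  exact hlift.smooth.comp (h1.prodMk h2)

/-- Kostant's formula in a local frame. -/
theorem SatisfiesKostant.frame (hK : SatisfiesKostant C B lift c Φ) (hc : c ≠ 0)
    (hlift : IsCircleLift C B lift) {γ : ℝ → X₀} {v : ∀ t, L (γ t)} (hv : IsSmoothAlong I₀ γ v)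
    {U : Set X₀} {σ : ∀ x, L x} {A : ∀ x : X₀, TangentSpace I₀ x →L[ℝ] ℂ}
    (hA : B.IsConnectionForm univ U σ A) {p : ℝ × ℝ} (hp : (rotatedSection lift γ v p).proj ∈ U) :
    fderiv ℝ (fun p => frameCoeff σ (rotatedSection lift γ v p)) p (1, 0)
      + frameCoeff σ (rotatedSection lift γ v p)
        * formAlong A (fun p => (rotatedSection lift γ v p).proj) (1, 0) p
      = (2 * Real.pi * Φ (rotatedSection lift γ v p).proj * Complex.I / c)
        * frameCoeff σ (rotatedSection lift γ v p) := by
  obtain ⟨s, t⟩ := p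
  have hs := hlift.contMDiff_rotatedSection hv
  have hpath : HasDerivAt (fun s : ℝ => (s, t)) ((1 : ℝ), (0 : ℝ)) s :=
    (hasDerivAt_id s).prodMk (hasDerivAt_const s t)
  have hsm : IsSmoothAlong I₀ (fun s : ℝ => C.obj (Circle.exp s) (γ t))
      (fun s => lift (Circle.exp s) (γ t) (v t)) :=
    ContMDiff.comp hlift.smooth (contMDiff_circleExp.prodMk
      (contMDiff_const (c := (⟨γ t, v t⟩ : TotalSpace ℂ L))))
  have h1 := hA.covDeriv_along hs hsm (fun _ => mem_univ _) hp hpath (Eventually.of_forall fun _ => rfl)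
  have h2 := hK (γ t) (v t) s
  have hσ := hA.frame_ne_zero _ hp
  have h3 : lift (Circle.exp s) (γ t) (v t)
      = frameCoeff σ (rotatedSection lift γ v (s, t)) • σ (C.obj (Circle.exp s) (γ t)) :=
    (frameCoeff_smul_eq hσ _).symm
  rw [h1, h3, smul_smul, smul_smul] at h2
  have h4 := smul_ne_smul_of_ne hσ h2
  have hc' : (c : ℂ) ≠ 0 := by exact_mod_cast hc
  rw [div_mul_eq_mul_div, eq_div_iff hc', mul_comm]
  exact h4

variable [FiniteDimensional ℝ V₀] [T2Space X₀]

/-- The curvature of the connection in the direction of the orbits is given by the moment map. -/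
theorem LineBundleData.IsPrequantum.curvature_orbit (hB : B.IsPrequantum Ω)
    (hΦ : IsMomentMap C Ω c Φ) (hc : c ≠ 0) {γ : ℝ → X₀}
    {U : Set X₀} {σ : ∀ x, L x} {A : ∀ x : X₀, TangentSpace I₀ x →L[ℝ] ℂ}
    (hA : B.IsConnectionForm univ U σ A) {F : ℝ × ℝ → X₀}
    (hFs : ContMDiff 𝓘(ℝ, ℝ × ℝ) I₀ ∞ F)
    (hF : ∀ p, F p = C.obj (Circle.exp p.1) (γ p.2)) {p : ℝ × ℝ} (hp : F p ∈ U) :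
    fderiv ℝ (formAlong A F (0, 1)) p (1, 0) - fderiv ℝ (formAlong A F (1, 0)) p (0, 1)
      = -fderiv ℝ (fun p => 2 * Real.pi * (Φ (F p) : ℂ) * Complex.I / c) p (0, 1) := by
  obtain rfl : F = fun p => C.obj (Circle.exp p.1) (γ p.2) := funext hF
  set F : ℝ × ℝ → X₀ := fun p => C.obj (Circle.exp p.1) (γ p.2) with hFdef
  obtain ⟨s, t⟩ := p
  obtain ⟨Y, Z, hY, hZ, hYe, hZe, hd⟩ := exists_fields_extDeriv_eq hA.isOpen hA.smooth_form hFs hp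
    (1, 0) (0, 1)
  have h1 := hB.curvature U σ A hA Y Z hY hZ _ hp
  rw [hd, hYe, hZe] at h1
  have hpath : HasDerivAt (fun s : ℝ => (s, t)) ((1 : ℝ), (0 : ℝ)) s :=
    (hasDerivAt_id s).prodMk (hasDerivAt_const s t)
  -- The `s`-velocity of `F` is the generator of the action, so the moment map equation evaluates
  -- `Ω` on the two velocities of `F`.
  have hvel : mfderiv 𝓘(ℝ, ℝ × ℝ) I₀ F (s, t) (1, 0)
      = mfderiv 𝓘(ℝ, ℝ) I₀ (fun s : ℝ => C.obj (Circle.exp s) (γ t)) s (1 : ℝ) := by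
    have hqm : HasMFDerivAt 𝓘(ℝ, ℝ) 𝓘(ℝ, ℝ × ℝ) (fun s : ℝ => (s, t)) s
        (ContinuousLinearMap.toSpanSingleton ℝ ((1 : ℝ), (0 : ℝ))) :=
      hasMFDerivAt_iff_hasFDerivAt.2 hpath.hasFDerivAt
    have hm := (hFs.mdifferentiable (by simp) (s, t)).hasMFDerivAt.comp s hqm
    have hm' : HasMFDerivAt 𝓘(ℝ, ℝ) I₀ (fun s : ℝ => C.obj (Circle.exp s) (γ t)) s _ := hm
    rw [hm'.mfderiv]
    change _ = mfderiv 𝓘(ℝ, ℝ × ℝ) I₀ F (s, t) ((1 : ℝ) • ((1 : ℝ), (0 : ℝ)))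
    rw [one_smul]
  have h2 := hΦ.moment (γ t) s (mfderiv 𝓘(ℝ, ℝ × ℝ) I₀ F (s, t) (0, 1))
  rw [← hvel, map_smul, smul_apply] at h2
  have hΦF : HasFDerivAt (fun p => Φ (F p)) (fderiv ℝ (fun p => Φ (F p)) (s, t)) (s, t) :=
    (((hΦ.smooth.comp hFs).contDiff).differentiable (by simp) (s, t)).hasFDerivAt
  have h3 : fderiv ℝ (fun p => Φ (F p)) (s, t) (0, 1)
      = c * Ω (F (s, t)) (mfderiv 𝓘(ℝ, ℝ × ℝ) I₀ F (s, t) (1, 0))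
        (mfderiv 𝓘(ℝ, ℝ × ℝ) I₀ F (s, t) (0, 1)) := by
    have hm := (hΦ.smooth.mdifferentiable (by simp) _).hasMFDerivAt.comp (s, t)
      (hFs.mdifferentiable (by simp) (s, t)).hasMFDerivAt
    let T : ℝ × ℝ →L[ℝ] ℝ := (mfderiv I₀ 𝓘(ℝ, ℝ) Φ (F (s, t))).comp
      (mfderiv 𝓘(ℝ, ℝ × ℝ) I₀ F (s, t))
    have hm' : HasFDerivAt (fun p => Φ (F p)) T (s, t) := hasMFDerivAt_iff_hasFDerivAt.1 hm
    rw [hm'.fderiv]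
    exact h2.symm
  have h4 : HasFDerivAt (fun p => 2 * Real.pi * (Φ (F p) : ℂ) * Complex.I / c)
      ((2 * Real.pi * Complex.I / c : ℂ) •
        (Complex.ofRealCLM.comp (fderiv ℝ (fun p => Φ (F p)) (s, t)))) (s, t) := by
    refine ((Complex.ofRealCLM.hasFDerivAt.comp (s, t) hΦF).const_smul
      (2 * Real.pi * Complex.I / c : ℂ)).congr_of_eventuallyEq (Eventually.of_forall fun p => ?_)
    simp only [Pi.smul_apply, Function.comp, Complex.ofRealCLM_apply, smul_eq_mul]
    ring
  have hc' : (c : ℂ) ≠ 0 := by exact_mod_cast hc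
  have hpi : (Real.pi : ℂ) ≠ 0 := by exact_mod_cast Real.pi_ne_zero
  rw [h4.fderiv]
  simp only [smul_apply, ContinuousLinearMap.comp_apply, Complex.ofRealCLM_apply, smul_eq_mul]
  rw [h3]
  push_cast
  -- The moment map gives `∂ₜΦ = c Ω(∂ₛF, ∂ₜF)` and prequantization gives `Ω = (i/2π) dA`.
  -- Multiplying by `-2πi/c` returns `dA`, since `-i² = 1`.
  rw [← h1]
  field_simp
  rw [Complex.I_sq]
  ring

/-- The lifted action preserves the connection. The ratio `α s` of the covariant derivative of the
rotated section to that section has derivative zero in `s`, by Kostant's formula and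
`curvature_orbit`, and at `s = 0` it is the ratio for `v`. The condition `v t ≠ 0` makes the ratio
meaningful. -/
theorem LineBundleData.IsPrequantum.covDeriv_rotate (hB : B.IsPrequantum Ω)
    (hΦ : IsMomentMap C Ω c Φ) (hc : c ≠ 0) (hlift : IsCircleLift C B lift)
    (hK : SatisfiesKostant C B lift c Φ) {γ : ℝ → X₀} {v : ∀ t, L (γ t)}
    (hv : IsSmoothAlong I₀ γ v) {t : ℝ} (hvt : v t ≠ 0) (s : ℝ) :
    B.covDeriv (fun τ => C.obj (Circle.exp s) (γ τ)) (fun τ => lift (Circle.exp s) (γ τ) (v τ)) t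
      = lift (Circle.exp s) (γ t) (B.covDeriv γ v t) := by
  have hH := hB.isHermitianLineBundle
  have hU := hlift.contMDiff_rotatedSection hv
  have hw : ∀ s, lift (Circle.exp s) (γ t) (v t) ≠ 0 := fun s => hlift.ne_zero hH _ hvt
  -- The fibres are one-dimensional, so the covariant derivative is a multiple of the nonzero vector
  -- `lift (Circle.exp s) (γ t) (v t)`.
  have hex : ∀ s, ∃ a : ℂ, B.covDeriv (fun τ => C.obj (Circle.exp s) (γ τ))
      (fun τ => lift (Circle.exp s) (γ τ) (v τ)) t = a • lift (Circle.exp s) (γ t) (v t) := by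
    intro s
    refine ⟨(trivializationAt ℂ L (C.obj (Circle.exp s) (γ t)) ⟨_, B.covDeriv
      (fun τ => C.obj (Circle.exp s) (γ τ)) (fun τ => lift (Circle.exp s) (γ τ) (v τ)) t⟩).2 /
      (trivializationAt ℂ L (C.obj (Circle.exp s) (γ t)) ⟨_, lift (Circle.exp s) (γ t) (v t)⟩).2, ?_⟩
    have hx := FiberBundle.mem_baseSet_trivializationAt' (F := ℂ) (E := L)
      (C.obj (Circle.exp s) (γ t))
    refine trivializationAt_injective hx ?_
    rw [trivializationAt_smul hx]
    exact (div_mul_cancel₀ _ (trivializationAt_ne_zero hx (hw s))).symm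
  choose α hα using hex
  have hder : ∀ s, HasDerivAt α 0 s := by
    intro s₀
    obtain ⟨U, σ, A, hp, hA⟩ := hH.exists_connectionForm (C.obj (Circle.exp s₀) (γ t)) (mem_univ _)
    have hFs : ContMDiff 𝓘(ℝ, ℝ × ℝ) I₀ ∞ (fun p => (rotatedSection lift γ v p).proj) :=
      (contMDiff_proj L).comp hU
    have hpU : ∀ᶠ p in 𝓝 ((s₀, t) : ℝ × ℝ), (rotatedSection lift γ v p).proj ∈ U :=
      hFs.continuous.continuousAt.preimage_mem_nhds (hA.isOpen.mem_nhds hp)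
    have hf := hA.contDiffAt_frameCoeff hU (p := ((s₀, t) : ℝ × ℝ)) hp
    have hR : DifferentiableAt ℝ (fun p => 2 * Real.pi *
        (Φ (rotatedSection lift γ v p).proj : ℂ) * Complex.I / c) (s₀, t) := by
      have h1 : DifferentiableAt ℝ (fun p => (Φ (rotatedSection lift γ v p).proj : ℂ)) (s₀, t) :=
        Complex.ofRealCLM.differentiableAt.comp _
          ((hΦ.smooth.comp hFs).contDiff.differentiable (by simp) _)
      fun_prop
    have hd := hasDerivAt_logDeriv_add hf (frameCoeff_ne_zero (hA.frame_ne_zero _ hp) (hw s₀))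
      (differentiableAt_formAlong hA.isOpen hA.smooth_form hFs (p₀ := (s₀, t)) hp (1, 0) 0).1
      (differentiableAt_formAlong hA.isOpen hA.smooth_form hFs (p₀ := (s₀, t)) hp (0, 1) 0).1 hR
      (hpU.mono fun p hp => hK.frame hc hlift hv hA hp)
      (hB.curvature_orbit hΦ hc hA hFs (fun _ => rfl) hp)
    -- While the rotated point stays in the domain of the frame, `α` is the expression `∂ₜf / f + Q`
    -- whose derivative was just computed.
    refine hd.congr_of_eventuallyEq ?_
    have hcont : ContinuousAt (fun s : ℝ => (s, t)) s₀ := by fun_prop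
    filter_upwards [hcont.eventually hpU] with s hs
    have hpath : HasDerivAt (fun τ : ℝ => (s, τ)) ((0 : ℝ), (1 : ℝ)) t :=
      (hasDerivAt_const t s).prodMk (hasDerivAt_id t)
    have hsm : IsSmoothAlong I₀ (fun τ => C.obj (Circle.exp s) (γ τ))
        (fun τ => lift (Circle.exp s) (γ τ) (v τ)) :=
      hlift.smoothAlong (a := fun _ => Circle.exp s) contMDiff_const hv
    have h1 := hA.covDeriv_along hU hsm (fun _ => mem_univ _) hs hpath
      (Eventually.of_forall fun _ => rfl)
    have hσ := hA.frame_ne_zero _ hs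
    have h3 : lift (Circle.exp s) (γ t) (v t)
        = frameCoeff σ (rotatedSection lift γ v (s, t)) • σ (C.obj (Circle.exp s) (γ t)) :=
      (frameCoeff_smul_eq hσ _).symm
    have h4 := hα s
    rw [h1, h3, smul_smul] at h4
    have h5 := smul_ne_smul_of_ne hσ h4
    have h6 : frameCoeff σ (rotatedSection lift γ v (s, t)) ≠ 0 := frameCoeff_ne_zero hσ (hw s)
    rw [eq_comm, ← sub_eq_zero]
    field_simp
    linear_combination h5
  have hconst : α s = α 0 :=
    is_const_of_deriv_eq_zero (fun s => (hder s).differentiableAt) (fun s => (hder s).deriv) s 0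
  -- At `s = 0` the rotated section coincides with `v` only as a map to the total space, which is
  -- enough for `covDeriv_congr`.
  have h0 : ∀ τ, (⟨C.obj (Circle.exp 0) (γ τ), lift (Circle.exp 0) (γ τ) (v τ)⟩ : TotalSpace ℂ L)
      = ⟨γ τ, v τ⟩ := by
    intro τ
    rw [Circle.exp_zero]
    exact hlift.lift_one _ _
  have h1 := B.covDeriv_congr h0 t
  rw [hα 0] at h1
  have h2 : B.covDeriv γ v t = α 0 • v t :=
    TotalSpace.mk_injective _ (h1.symm.trans (TotalSpace.mk_smul (h0 t) _))
  rw [hα s, h2, map_smul, hconst]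

/-- The covariant derivative of a section which is moved by a curve `a` in the circle with angular
velocity `ν`. -/
theorem LineBundleData.IsPrequantum.covDeriv_lift_of_ne_zero (hB : B.IsPrequantum Ω)
    (hΩ : IsSymplecticForm G Ω)
    (hΦ : IsMomentMap C Ω c Φ) (hc : c ≠ 0) (hlift : IsCircleLift C B lift)
    (hK : SatisfiesKostant C B lift c Φ) {γ : ℝ → X₀} {v : ∀ t, L (γ t)}
    (hv : IsSmoothAlong I₀ γ v) {t : ℝ} (hvt : v t ≠ 0) {a : ℝ → Circle}
    (ha : ContMDiff 𝓘(ℝ, ℝ) (𝓡 1) ∞ a) {ν : ℝ}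
    (hν : HasDerivAt (fun s => (a s : ℂ)) (Complex.I * ν * a t) t) :
    B.covDeriv (fun τ => C.obj (a τ) (γ τ)) (fun τ => lift (a τ) (γ τ) (v τ)) t
      = lift (a t) (γ t)
        (B.covDeriv γ v t + (2 * Real.pi * Φ (γ t) * Complex.I / c * ν) • v t) := by
  have hH := hB.isHermitianLineBundle
  have hU := hlift.contMDiff_rotatedSection hv
  obtain ⟨s₀, hs₀⟩ : ∃ s₀, Circle.exp s₀ = a t := ⟨_, Circle.exp_arg _⟩
  -- This angle function satisfies `Circle.exp (θ τ) = a τ` for every `τ`. Differentiability is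
  -- needed only at `t`, where `a τ / a t` equals `1` and lies off the branch cut of the logarithm.
  set θ : ℝ → ℝ := fun τ => s₀ + (Complex.log (a τ / a t)).im with hθ
  have hat : (a t : ℂ) ≠ 0 := Circle.coe_ne_zero _
  have hθt : θ t = s₀ := by simp [hθ]
  have hθe : ∀ τ, Circle.exp (θ τ) = a τ := by
    intro τ
    rw [hθ]
    simp only [Complex.log_im]
    have h1 : (a τ / a t : ℂ) = ((a τ / a t : Circle) : ℂ) := by simp
    rw [Circle.exp_add, h1, Circle.exp_arg, hs₀, mul_div_cancel]
  have hθd : HasDerivAt θ ν t := by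
    have h1 := (hν.div_const (a t : ℂ)).clog_real (by simp [hat])
    have h2 := (Complex.imCLM.hasFDerivAt.comp_hasDerivAt t h1).const_add s₀
    refine h2.congr_deriv ?_
    simp [hat]
  have hq : HasDerivAt (fun τ => (θ τ, τ)) (ν, (1 : ℝ)) t := hθd.prodMk (hasDerivAt_id t)
  obtain ⟨U, σ, A, hp, hA⟩ := hH.exists_connectionForm (C.obj (a t) (γ t)) (mem_univ _)
  have hpF : (rotatedSection lift γ v (s₀, t)).proj ∈ U := by
    change C.obj (Circle.exp s₀) (γ t) ∈ U
    rwa [hs₀]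
  have hσ := hA.frame_ne_zero _ hp
  have hsm : IsSmoothAlong I₀ (fun τ => C.obj (Circle.exp s₀) (γ τ))
      (fun τ => lift (Circle.exp s₀) (γ τ) (v τ)) :=
    hlift.smoothAlong (a := fun _ => Circle.exp s₀) contMDiff_const hv
  have hpath : HasDerivAt (fun τ : ℝ => (s₀, τ)) ((0 : ℝ), (1 : ℝ)) t :=
    (hasDerivAt_const t s₀).prodMk (hasDerivAt_id t)
  have h1 := hA.covDeriv_along hU hsm (fun _ => mem_univ _) hpF hpath
    (Eventually.of_forall fun _ => rfl)
  rw [hB.covDeriv_rotate hΦ hc hlift hK hv hvt s₀, hs₀] at h1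
  have h2 := hA.covDeriv_along hU (hlift.smoothAlong ha hv) (fun _ => mem_univ _) hp hq
    (Eventually.of_forall fun τ => by
      change _ = (⟨C.obj (Circle.exp (θ τ)) (γ τ), lift (Circle.exp (θ τ)) (γ τ) (v τ)⟩ :
        TotalSpace ℂ L)
      rw [hθe])
  have h3 := hK.frame hc hlift hv hA hpF
  have h4 : rotatedSection lift γ v (s₀, t) = ⟨C.obj (a t) (γ t), lift (a t) (γ t) (v t)⟩ := by
    rw [rotatedSection, hs₀]
  have h5 : lift (a t) (γ t) (v t)
      = frameCoeff σ ⟨C.obj (a t) (γ t), lift (a t) (γ t) (v t)⟩ • σ (C.obj (a t) (γ t)) :=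
    (frameCoeff_smul_eq hσ _).symm
  have hΦ' : Φ (rotatedSection lift γ v (s₀, t)).proj = Φ (γ t) := hΦ.apply_obj hΩ _ _
  -- The moved section is the rotated section along `τ ↦ (θ τ, τ)`, with velocity `(ν, 1)`. The
  -- component `(0, 1)` is handled by `covDeriv_rotate`, and `ν` times the component `(1, 0)` is
  -- Kostant's term.
  have hdir : ((ν, 1) : ℝ × ℝ) = ν • ((1 : ℝ), (0 : ℝ)) + ((0 : ℝ), (1 : ℝ)) := by simp
  have hform : formAlong A (fun p => (rotatedSection lift γ v p).proj) (ν, 1) (s₀, t)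
      = ν * formAlong A (fun p => (rotatedSection lift γ v p).proj) (1, 0) (s₀, t)
        + formAlong A (fun p => (rotatedSection lift γ v p).proj) (0, 1) (s₀, t) := by
    rw [hdir, formAlong_smul_add]
  rw [h2, map_add, map_smul, h1, hθt, h5, smul_smul, ← add_smul, hform, hdir, map_add, map_smul,
    Complex.real_smul]
  rw [hΦ'] at h3
  rw [h4] at h3 ⊢
  congr 1
  linear_combination (ν : ℂ) * h3

/-- The covariant derivative of a section which is moved by a curve `a` in the circle with angular
velocity `ν`. -/
theorem LineBundleData.IsPrequantum.covDeriv_lift [VectorBundle ℝ ℂ L]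
    [ContMDiffVectorBundle ∞ ℂ L I₀] (hB : B.IsPrequantum Ω)
    (hΩ : IsSymplecticForm G Ω)
    (hΦ : IsMomentMap C Ω c Φ) (hc : c ≠ 0) (hlift : IsCircleLift C B lift)
    (hK : SatisfiesKostant C B lift c Φ) {γ : ℝ → X₀} {u : ∀ t, L (γ t)}
    (hu : IsSmoothAlong I₀ γ u) {t : ℝ} {a : ℝ → Circle}
    (ha : ContMDiff 𝓘(ℝ, ℝ) (𝓡 1) ∞ a) {ν : ℝ}
    (hν : HasDerivAt (fun s => (a s : ℂ)) (Complex.I * ν * a t) t) :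
    B.covDeriv (fun τ => C.obj (a τ) (γ τ)) (fun τ => lift (a τ) (γ τ) (u τ)) t
      = lift (a t) (γ t)
        (B.covDeriv γ u t + (2 * Real.pi * Φ (γ t) * Complex.I / c * ν) • u t) := by
  have hH := hB.isHermitianLineBundle
  -- A section that may vanish at `t` is a function times a nonvanishing one. Both sides of the
  -- formula obey the same Leibniz rule, so the nonvanishing case suffices.
  obtain ⟨σ, U, hU, hm, hσ, hσ0⟩ := exists_contMDiff_section_ne_zero I₀ L (γ t)
  have hγ : ContMDiff 𝓘(ℝ, ℝ) I₀ ∞ γ := (contMDiff_proj L).comp hu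
  have hv : IsSmoothAlong I₀ γ (fun t => σ (γ t)) := hσ.comp hγ
  set h : ℝ → ℂ := fun s => frameCoeff σ ⟨γ s, u s⟩ with hh
  have hhd : DifferentiableAt ℝ h t :=
    (((contMDiffAt_frameCoeff hU hσ.contMDiffOn hσ0 hm).comp t hu.contMDiffAt).contDiffAt
      (n := ∞)).differentiableAt (by simp)
  have hev : ∀ᶠ s in 𝓝 t, u s = h s • σ (γ s) := by
    filter_upwards [hγ.continuous.continuousAt.preimage_mem_nhds (hU.mem_nhds hm)] with s hs
    exact (frameCoeff_smul_eq (hσ0 (γ s) hs) (u s)).symm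
  have hev' : ∀ᶠ s in 𝓝 t, lift (a s) (γ s) (u s) = h s • lift (a s) (γ s) (σ (γ s)) := by
    filter_upwards [hev] with s hs
    rw [hs, map_smul]
  rw [hH.covDeriv_smul (hlift.smoothAlong ha hu) (hlift.smoothAlong ha hv) (fun _ => mem_univ _)
    hhd hev', hH.covDeriv_smul hu hv (fun _ => mem_univ _) hhd hev,
    hB.covDeriv_lift_of_ne_zero hΩ hΦ hc hlift hK hv (hσ0 _ hm) ha hν, hev.self_of_nhds]
  simp only [map_add, map_smul, smul_add, smul_smul]
  rw [add_assoc, mul_comm (h t)]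

end Lift

/-! ### The bundle `L ⊠ L_ℂ` -/

section Box

variable {V₀ : Type*} [NormedAddCommGroup V₀] [NormedSpace ℝ V₀]
  {H₀ : Type*} [TopologicalSpace H₀] {I₀ : ModelWithCorners ℝ V₀ H₀}
  {X₀ : Type*} [TopologicalSpace X₀] [ChartedSpace H₀ X₀]
  {V₁ : Type*} [NormedAddCommGroup V₁] [NormedSpace ℝ V₁]
  {H₁ : Type*} [TopologicalSpace H₁] {I₁ : ModelWithCorners ℝ V₁ H₁}
  {X₁ : Type*} [TopologicalSpace X₁] [ChartedSpace H₁ X₁]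
  {G : LieGroupoid I₀ X₀ I₁ X₁}
  {W : Type*} [NormedAddCommGroup W] [NormedSpace ℝ W]
  {K : Type*} [TopologicalSpace K] {J : ModelWithCorners ℝ W K}
  {M : Type*} [TopologicalSpace M] [ChartedSpace K M]
  {L : X₀ → Type*} [∀ x, AddCommGroup (L x)] [∀ x, Module ℂ (L x)]
  [TopologicalSpace (TotalSpace ℂ L)] [∀ x, TopologicalSpace (L x)] [FiberBundle ℂ L]

/-- The projection of the total space of `L ⊠ L_ℂ` to that of `L`. -/
def boxProj (u : TotalSpace ℂ (BoxFiber I₀ L)) : TotalSpace ℂ L := ⟨u.proj.1, u.2⟩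

/-- The trivializations of the pullback bundle are those of `L` at the first component. Smoothness
for `L ⊠ L_ℂ` therefore splits into smoothness for `L` and for the coordinate `z`. -/
theorem contMDiffWithinAt_box_iff {u : M → TotalSpace ℂ (BoxFiber I₀ L)} {s : Set M} {m : M} :
    ContMDiffWithinAt J ((I₀.prod 𝓘(ℝ, ℂ)).prod 𝓘(ℝ, ℂ)) ∞ u s m ↔
      ContMDiffWithinAt J (I₀.prod 𝓘(ℝ, ℂ)) ∞ (fun m => boxProj (u m)) s m ∧
        ContMDiffWithinAt J 𝓘(ℝ, ℂ) ∞ (fun m => (u m).proj.2) s m := by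
  rw [contMDiffWithinAt_totalSpace, contMDiffWithinAt_totalSpace, contMDiffWithinAt_prod_iff]
  constructor
  · rintro ⟨⟨h1, h2⟩, h3⟩
    exact ⟨⟨h1, h3⟩, h2⟩
  · rintro ⟨⟨h1, h3⟩, h2⟩
    exact ⟨⟨h1, h2⟩, h3⟩

theorem contMDiff_box_iff {u : M → TotalSpace ℂ (BoxFiber I₀ L)} :
    ContMDiff J ((I₀.prod 𝓘(ℝ, ℂ)).prod 𝓘(ℝ, ℂ)) ∞ u ↔
      ContMDiff J (I₀.prod 𝓘(ℝ, ℂ)) ∞ (fun m => boxProj (u m)) ∧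
        ContMDiff J 𝓘(ℝ, ℂ) ∞ (fun m => (u m).proj.2) := by
  simp only [← contMDiffOn_univ, ContMDiffOn, contMDiffWithinAt_box_iff, forall_and]

theorem contMDiff_boxProj : ContMDiff ((I₀.prod 𝓘(ℝ, ℂ)).prod 𝓘(ℝ, ℂ)) (I₀.prod 𝓘(ℝ, ℂ)) ∞
    (boxProj : TotalSpace ℂ (BoxFiber I₀ L) → TotalSpace ℂ L) :=
  (contMDiff_box_iff.1 contMDiff_id).1

theorem box_ext {u v : TotalSpace ℂ (BoxFiber I₀ L)} (h : boxProj u = boxProj v)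
    (h' : u.proj.2 = v.proj.2) : u = v := by
  obtain ⟨⟨x, z⟩, u⟩ := u
  obtain ⟨⟨y, w⟩, v⟩ := v
  obtain rfl : z = w := h'
  obtain ⟨rfl, h⟩ := TotalSpace.mk.inj h
  obtain rfl : u = v := eq_of_heq h
  rfl

theorem IsSmoothAlong.box_fst {γ : ℝ → X₀ × ℂ} {u : ∀ t, BoxFiber I₀ L (γ t)}
    (hu : IsSmoothAlong (I₀.prod 𝓘(ℝ, ℂ)) γ u) :
    IsSmoothAlong I₀ (fun t => (γ t).1) (fun t => (show L (γ t).1 from u t)) :=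
  (contMDiff_box_iff.1 hu).1

theorem IsSmoothAlong.box_snd {γ : ℝ → X₀ × ℂ} {u : ∀ t, BoxFiber I₀ L (γ t)}
    (hu : IsSmoothAlong (I₀.prod 𝓘(ℝ, ℂ)) γ u) : ContDiff ℝ ∞ (fun t => (γ t).2) :=
  (contMDiff_box_iff.1 hu).2.contDiff

theorem LineBundleData.boxC_moves_iff {B : LineBundleData G L} {k : X₁ × ℂ}
    {u v : TotalSpace ℂ (BoxFiber I₀ L)} :
    B.boxC.Moves k u v ↔
      B.Moves k.1 (boxProj u) (boxProj v) ∧ u.proj.2 = k.2 ∧ v.proj.2 = k.2 := by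
  constructor
  · rintro ⟨w, rfl, rfl⟩
    exact ⟨⟨w, rfl, rfl⟩, rfl, rfl⟩
  · rintro ⟨⟨w, h1, h2⟩, h3, h4⟩
    exact ⟨w, box_ext h1 h3, box_ext h2 h4⟩

end Box

/-! ### The connection form of the tensor product. -/

section BoxHermitian

variable {V₀ : Type*} [NormedAddCommGroup V₀] [NormedSpace ℝ V₀]
  {H₀ : Type*} [TopologicalSpace H₀] {I₀ : ModelWithCorners ℝ V₀ H₀}
  {X₀ : Type*} [TopologicalSpace X₀] [ChartedSpace H₀ X₀] [IsManifold I₀ ∞ X₀]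
  {V₁ : Type*} [NormedAddCommGroup V₁] [NormedSpace ℝ V₁]
  {H₁ : Type*} [TopologicalSpace H₁] {I₁ : ModelWithCorners ℝ V₁ H₁}
  {X₁ : Type*} [TopologicalSpace X₁] [ChartedSpace H₁ X₁]
  {G : LieGroupoid I₀ X₀ I₁ X₁}
  {L : X₀ → Type*} [∀ x, AddCommGroup (L x)] [∀ x, Module ℂ (L x)]
  [TopologicalSpace (TotalSpace ℂ L)] [∀ x, TopologicalSpace (L x)] [FiberBundle ℂ L]
  {B : LineBundleData G L}

/-- The connection form of `L ⊠ L_ℂ` in the frame given by a frame of `L`. -/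
def boxConnectionForm (A : ∀ x : X₀, TangentSpace I₀ x →L[ℝ] ℂ) (p : X₀ × ℂ) :
    TangentSpace (I₀.prod 𝓘(ℝ, ℂ)) p →L[ℝ] ℂ :=
  (A p.1).comp (mfderiv (I₀.prod 𝓘(ℝ, ℂ)) I₀ Prod.fst p)
    + (-Real.pi * p.2 : ℂ) • (Complex.conjCLE : ℂ →L[ℝ] ℂ).comp
      (mfderiv (I₀.prod 𝓘(ℝ, ℂ)) 𝓘(ℝ, ℂ) Prod.snd p)

theorem boxConnectionForm_apply (A : ∀ x : X₀, TangentSpace I₀ x →L[ℝ] ℂ) (p : X₀ × ℂ)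
    (v : TangentSpace (I₀.prod 𝓘(ℝ, ℂ)) p) :
    boxConnectionForm A p v = A p.1 (mfderiv (I₀.prod 𝓘(ℝ, ℂ)) I₀ Prod.fst p v)
      + -Real.pi * p.2 * starRingEnd ℂ (mfderiv (I₀.prod 𝓘(ℝ, ℂ)) 𝓘(ℝ, ℂ) Prod.snd p v) :=
  rfl

theorem contMDiff_conj : ContMDiff 𝓘(ℝ, ℂ) 𝓘(ℝ, ℂ) ∞ (fun z : ℂ => starRingEnd ℂ z) :=
  Complex.conjCLE.contDiff.contMDiff

theorem ContMDiffWithinAt.mul_complex {W : Type*} [NormedAddCommGroup W] [NormedSpace ℝ W]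
    {K : Type*} [TopologicalSpace K] {J : ModelWithCorners ℝ W K}
    {M : Type*} [TopologicalSpace M] [ChartedSpace K M] {f g : M → ℂ} {s : Set M} {m : M}
    (hf : ContMDiffWithinAt J 𝓘(ℝ, ℂ) ∞ f s m) (hg : ContMDiffWithinAt J 𝓘(ℝ, ℂ) ∞ g s m) :
    ContMDiffWithinAt J 𝓘(ℝ, ℂ) ∞ (fun m => f m * g m) s m :=
  (((ContinuousLinearMap.mul ℝ ℂ).contDiff.contMDiff).contMDiffAt.comp_contMDiffWithinAt
    m hf).clm_apply hg

/-- Connection forms add under tensor products. The frame is `σ ⊗ 1`, and `1` has connection form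
`-π z d\bar z` in `L_ℂ`. -/
theorem LineBundleData.IsConnectionForm.boxC {S U : Set X₀} {σ : ∀ x, L x}
    {A : ∀ x : X₀, TangentSpace I₀ x →L[ℝ] ℂ} (hA : B.IsConnectionForm S U σ A) :
    B.boxC.IsConnectionForm (Prod.fst ⁻¹' S) (Prod.fst ⁻¹' U) (fun p => σ p.1)
      (boxConnectionForm A) where
  isOpen := hA.isOpen.preimage continuous_fst
  smooth_frame p hp := contMDiffWithinAt_box_iff.2
    ⟨(hA.smooth_frame p.1 hp).comp p contMDiffWithinAt_fst (fun _ h => h), contMDiffWithinAt_snd⟩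
  frame_ne_zero p hp := hA.frame_ne_zero p.1 hp
  smooth_form := by
    have h1 : ContMDiff (I₀.prod 𝓘(ℝ, ℂ)).tangent I₀.tangent ∞
        (tangentMap (I₀.prod 𝓘(ℝ, ℂ)) I₀ (Prod.fst : X₀ × ℂ → X₀)) :=
      (contMDiff_fst (n := ∞)).contMDiff_tangentMap (by simp)
    have h2 : ContMDiff (I₀.prod 𝓘(ℝ, ℂ)).tangent 𝓘(ℝ, ℂ).tangent ∞
        (tangentMap (I₀.prod 𝓘(ℝ, ℂ)) 𝓘(ℝ, ℂ) (Prod.snd : X₀ × ℂ → ℂ)) :=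
      (contMDiff_snd (n := ∞)).contMDiff_tangentMap (by simp)
    have h3 : ContMDiff (I₀.prod 𝓘(ℝ, ℂ)).tangent 𝓘(ℝ, ℂ) ∞
        (fun v : TangentBundle (I₀.prod 𝓘(ℝ, ℂ)) (X₀ × ℂ) => v.proj.2) :=
      contMDiff_snd.comp (contMDiff_proj _)
    have h4 : ContMDiff (I₀.prod 𝓘(ℝ, ℂ)).tangent 𝓘(ℝ, ℂ) ∞
        (fun v : TangentBundle (I₀.prod 𝓘(ℝ, ℂ)) (X₀ × ℂ) => starRingEnd ℂ
          (tangentMap (I₀.prod 𝓘(ℝ, ℂ)) 𝓘(ℝ, ℂ) (Prod.snd : X₀ × ℂ → ℂ) v).2) :=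
      contMDiff_conj.comp ((contMDiff_snd_tangentBundle_modelSpace ℂ 𝓘(ℝ, ℂ)).comp h2)
    intro v hv
    have h5 := (hA.smooth_form.comp h1.contMDiffOn (fun v hv => hv)) v hv
    exact h5.add ((contMDiffWithinAt_const.mul_complex h3.contMDiffAt.contMDiffWithinAt).mul_complex
      h4.contMDiffAt.contMDiffWithinAt)
  covDeriv_eq γ u hu hγ t ht f hf := by
    have h1 := hA.covDeriv_eq _ _ hu.box_fst hγ t ht f hf
    have hγs : ContMDiff 𝓘(ℝ, ℝ) (I₀.prod 𝓘(ℝ, ℂ)) ∞ γ :=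
      (contMDiff_proj (BoxFiber I₀ L)).comp hu
    have hγd := (hγs.mdifferentiable (by simp) t).hasMFDerivAt
    have e1 : mfderiv (I₀.prod 𝓘(ℝ, ℂ)) I₀ Prod.fst (γ t)
        (mfderiv 𝓘(ℝ, ℝ) (I₀.prod 𝓘(ℝ, ℂ)) γ t (1 : ℝ))
        = mfderiv 𝓘(ℝ, ℝ) I₀ (fun t => (γ t).1) t (1 : ℝ) := by
      have h : HasMFDerivAt 𝓘(ℝ, ℝ) I₀ (fun t => (γ t).1) t _ :=
        ((contMDiff_fst (n := ∞)).mdifferentiable (by simp) (γ t)).hasMFDerivAt.comp t hγd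
      rw [h.mfderiv]
      rfl
    have e2 : mfderiv (I₀.prod 𝓘(ℝ, ℂ)) 𝓘(ℝ, ℂ) Prod.snd (γ t)
        (mfderiv 𝓘(ℝ, ℝ) (I₀.prod 𝓘(ℝ, ℂ)) γ t (1 : ℝ)) = deriv (fun t => (γ t).2) t := by
      have h : HasMFDerivAt 𝓘(ℝ, ℝ) 𝓘(ℝ, ℂ) (fun t => (γ t).2) t _ :=
        ((contMDiff_snd (n := ∞)).mdifferentiable (by simp) (γ t)).hasMFDerivAt.comp t hγd
      rw [← fderiv_apply_one_eq_deriv, ← mfderiv_eq_fderiv, h.mfderiv]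
      rfl
    change B.covDeriv (fun s => (γ s).1) u t
      + (-Real.pi * (γ t).2 * starRingEnd ℂ (deriv (fun s => (γ s).2) t)) •
        (show L (γ t).1 from u t) = (_ : ℂ) • σ (γ t).1
    have h2 : (show L (γ t).1 from u t) = f t • σ (γ t).1 := hf.self_of_nhds
    rw [boxConnectionForm_apply, e1, e2, h2]
    refine (congrArg (· + _) h1).trans ?_
    rw [smul_smul, ← add_smul]
    congr 1
    ring

end BoxHermitian

/-! ### The metric and the lifted action on the tensor product. -/

section BoxBundle

variable {V₀ : Type*} [NormedAddCommGroup V₀] [NormedSpace ℝ V₀]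
  {H₀ : Type*} [TopologicalSpace H₀] {I₀ : ModelWithCorners ℝ V₀ H₀}
  {X₀ : Type*} [TopologicalSpace X₀] [ChartedSpace H₀ X₀] [IsManifold I₀ ∞ X₀]
  {V₁ : Type*} [NormedAddCommGroup V₁] [NormedSpace ℝ V₁]
  {H₁ : Type*} [TopologicalSpace H₁] {I₁ : ModelWithCorners ℝ V₁ H₁}
  {X₁ : Type*} [TopologicalSpace X₁] [ChartedSpace H₁ X₁]
  {G : LieGroupoid I₀ X₀ I₁ X₁}
  {L : X₀ → Type*} [∀ x, AddCommGroup (L x)] [∀ x, Module ℂ (L x)]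
  [TopologicalSpace (TotalSpace ℂ L)] [∀ x, TopologicalSpace (L x)] [FiberBundle ℂ L]
  {B : LineBundleData G L}

theorem LineBundleData.IsHermitianLineBundle.herm_smul_left {S : Set X₀}
    (hB : B.IsHermitianLineBundle S) {x : X₀} (hx : x ∈ S) (a : ℂ) (u v : L x) :
    B.herm x (a • u) v = starRingEnd ℂ a * B.herm x u v := by
  rw [hB.herm_conj x hx, hB.herm_smul x hx, map_mul, ← hB.herm_conj x hx]

theorem LineBundleData.IsHermitianLineBundle.herm_add_left {S : Set X₀}
    (hB : B.IsHermitianLineBundle S) {x : X₀} (hx : x ∈ S) (u v w : L x) :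
    B.herm x (u + v) w = B.herm x u w + B.herm x v w := by
  rw [hB.herm_conj x hx, hB.herm_add x hx, map_add, ← hB.herm_conj x hx, ← hB.herm_conj x hx]

/-- This is the algebra behind metric compatibility in `L ⊠ L_ℂ`, with `r` the weight `e^{-π|z|²}`
and `w` the velocity of `z`. The weight has logarithmic derivative `-π (z d\bar z + \bar z dz)`. The
first summand is the connection term in the linear slot, and the second is its conjugate from the
conjugate-linear slot. -/
theorem LineBundleData.IsHermitianLineBundle.herm_add_smul_eq {S : Set X₀}
    (hB : B.IsHermitianLineBundle S) {x : X₀} (hx : x ∈ S) (u v u' v' : L x) (r : ℝ) (z w : ℂ) :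
    r * (-Real.pi * (z * starRingEnd ℂ w) + -Real.pi * (starRingEnd ℂ z * w)) * B.herm x u v
        + r * (B.herm x u' v + B.herm x u v')
      = r * B.herm x (u' + (-Real.pi * z * starRingEnd ℂ w) • u) v
        + r * B.herm x u (v' + (-Real.pi * z * starRingEnd ℂ w) • v) := by
  rw [hB.herm_add x hx, hB.herm_smul x hx, hB.herm_add_left hx, hB.herm_smul_left hx]
  simp only [map_mul, map_neg, Complex.conj_ofReal, Complex.conj_conj]
  ring

theorem hasDerivAt_exp_neg_pi_norm_sq {z : ℝ → ℂ} {z' : ℂ} {t : ℝ} (hz : HasDerivAt z z' t) :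
    HasDerivAt (fun s => (Real.exp (-Real.pi * ‖z s‖ ^ 2) : ℂ))
      (Real.exp (-Real.pi * ‖z t‖ ^ 2) *
        (-Real.pi * (z t * starRingEnd ℂ z') + -Real.pi * (starRingEnd ℂ (z t) * z'))) t := by
  have h1 : HasDerivAt (fun s => starRingEnd ℂ (z s)) (starRingEnd ℂ z') t :=
    (Complex.conjCLE : ℂ →L[ℝ] ℂ).hasFDerivAt.comp_hasDerivAt t hz
  have h2 := (((hz.mul h1).const_mul (-Real.pi : ℂ)).cexp)
  have h3 : ∀ w : ℂ, (Real.exp (-Real.pi * ‖w‖ ^ 2) : ℂ)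
      = Complex.exp (-Real.pi * (w * starRingEnd ℂ w)) := by
    intro w
    rw [Complex.mul_conj, Complex.normSq_eq_norm_sq]
    push_cast
    rfl
  simp only [h3]
  refine h2.congr_deriv ?_
  simp only [Pi.mul_apply]
  ring

variable [FiniteDimensional ℝ V₀] [T2Space X₀] [VectorBundle ℂ ℂ L] [VectorBundle ℝ ℂ L]
  [ContMDiffVectorBundle ∞ ℂ L I₀]

theorem LineBundleData.IsHermitianLineBundle.boxC (hB : B.IsHermitianLineBundle univ) :
    B.boxC.IsHermitianLineBundle univ where
  invariant _ := Iff.rfl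
  herm_conj p _ u v := by
    have h := hB.herm_conj p.1 (mem_univ _) u v
    refine (congrArg ((Real.exp (-Real.pi * ‖p.2‖ ^ 2) : ℂ) * ·) h).trans ?_
    refine (?_ : _ = starRingEnd ℂ (Real.exp (-Real.pi * ‖p.2‖ ^ 2) : ℂ) * _).trans
      (map_mul (starRingEnd ℂ) _ _).symm
    rw [Complex.conj_ofReal]
  herm_add p _ u v w := by
    have h := hB.herm_add p.1 (mem_univ _) u v w
    exact (congrArg ((Real.exp (-Real.pi * ‖p.2‖ ^ 2) : ℂ) * ·) h).trans (mul_add _ _ _)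
  herm_smul p _ a u v := by
    have h := hB.herm_smul p.1 (mem_univ _) a u v
    exact (congrArg ((Real.exp (-Real.pi * ‖p.2‖ ^ 2) : ℂ) * ·) h).trans (mul_left_comm _ _ _)
  herm_pos p _ u hu := by
    change 0 < ((Real.exp (-Real.pi * ‖p.2‖ ^ 2) : ℂ) * B.herm p.1 u u).re
    rw [Complex.re_ofReal_mul]
    exact mul_pos (Real.exp_pos _) (hB.herm_pos p.1 (mem_univ _) u hu)
  smooth_herm := by
    have h1 : ContMDiff (I₀.prod 𝓘(ℝ, ℂ)) 𝓘(ℝ, ℂ) ∞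
        (fun u : TotalSpace ℂ L => B.herm u.proj u.2 u.2) := by
      rw [← contMDiffOn_univ]
      exact hB.smooth_herm.mono fun _ _ => mem_univ _
    have h2 : ContDiff ℝ ∞ (fun z : ℂ => (Real.exp (-Real.pi * ‖z‖ ^ 2) : ℂ)) :=
      Complex.ofRealCLM.contDiff.comp (Real.contDiff_exp.comp
        (contDiff_const.mul (contDiff_norm_sq ℝ)))
    have h3 : ContMDiff ((I₀.prod 𝓘(ℝ, ℂ)).prod 𝓘(ℝ, ℂ)) 𝓘(ℝ, ℂ) ∞
        (fun u : TotalSpace ℂ (BoxFiber I₀ L) => u.proj.2) :=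
      contMDiff_snd.comp (contMDiff_proj (BoxFiber I₀ L))
    intro u _
    exact ((h2.contMDiff.comp h3).contMDiffAt.contMDiffWithinAt).mul_complex
      ((h1.comp contMDiff_boxProj).contMDiffAt.contMDiffWithinAt)
  move_one p _ u := B.boxC_moves_iff.2 ⟨hB.move_one p.1 (mem_univ _) u, rfl, rfl⟩
  move_mul g h u v w _ h1 h2 := by
    rw [LineBundleData.boxC_moves_iff] at h1 h2 ⊢
    exact ⟨hB.move_mul _ _ _ _ _ (mem_univ _) h1.1 h2.1, h1.2.1,
      h2.2.2.trans (h2.2.1.symm.trans h1.2.2)⟩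
  smooth_move σ hσ := by
    refine (contMDiff_box_iff.2 ⟨?_, contMDiff_snd⟩).contMDiffOn
    refine hB.contMDiff_move (k := fun k : X₁ × ℂ => k.1) contMDiff_fst
      (u := fun k => σ (G.src k.1, k.2)) ?_
    exact contMDiff_boxProj.comp (hσ.comp
      ((G.smooth_src.comp contMDiff_fst).prodMk contMDiff_snd))
  herm_move k _ u v := congrArg ((Real.exp (-Real.pi * ‖k.2‖ ^ 2) : ℂ) * ·)
    (hB.herm_move k.1 (mem_univ _) u v)
  exists_connectionForm p _ := by
    obtain ⟨U, σ, A, hx, hA⟩ := hB.exists_connectionForm p.1 (mem_univ _)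
    have h := hA.boxC
    exact ⟨_, _, _, hx, h.isOpen, h.smooth_frame, h.frame_ne_zero, h.smooth_form,
      fun γ u hu _ => h.covDeriv_eq γ u hu fun _ => mem_univ _⟩
  covDeriv_herm γ u v hu hv hγ t := by
    have h1 := hB.covDeriv_herm _ _ _ hu.box_fst hv.box_fst (fun _ => mem_univ _) t
    have hz : HasDerivAt (fun s => (γ s).2) (deriv (fun s => (γ s).2) t) t :=
      (hu.box_snd.differentiable (by simp) t).hasDerivAt
    refine ((hasDerivAt_exp_neg_pi_norm_sq hz).mul h1).congr_deriv ?_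
    set z' := deriv (fun s => (γ s).2) t
    exact hB.herm_add_smul_eq (mem_univ (γ t).1) _ _ _ _ _ _ _
  covDeriv_move k u hk hu hγ t := by
    have h1 := hB.covDeriv_move (fun t => (k t).1) u (contMDiff_fst.comp hk) hu.box_fst
      (fun _ => mem_univ _) t
    change B.covDeriv (fun s => G.tgt (k s).1) (fun s => B.move (k s).1 (u s)) t
        + (-Real.pi * (k t).2 * starRingEnd ℂ (deriv (fun s => (k s).2) t)) •
          B.move (k t).1 (u t)
      = B.move (k t).1 (B.covDeriv (fun s => G.src (k s).1) u t
        + (-Real.pi * (k t).2 * starRingEnd ℂ (deriv (fun s => (k s).2) t)) •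
          (show L (G.src (k t).1) from u t))
    rw [map_add, map_smul]
    exact congrArg (· + _) h1

theorem IsCircleLift.box {C : CircleAction G}
    {lift : ∀ (a : Circle) (x : X₀), L x →ₗ[ℂ] L (C.obj a x)} (hlift : IsCircleLift C B lift) :
    IsCircleLift C.prodC B.boxC (boxLift I₀ C lift) where
  lift_one p u := box_ext (hlift.lift_one p.1 u) (congrArg Prod.snd (C.prodC.obj_one p))
  lift_mul a b p u := box_ext (hlift.lift_mul a b p.1 u) (congrArg Prod.snd (C.prodC.obj_mul a b p))
  smooth := by
    refine contMDiff_box_iff.2 ⟨?_, ?_⟩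
    · exact hlift.smooth.comp (contMDiff_fst.prodMk (contMDiff_boxProj.comp contMDiff_snd))
    · exact contMDiff_snd.comp (C.prodC.smooth_obj.comp
        (contMDiff_fst.prodMk ((contMDiff_proj (BoxFiber I₀ L)).comp contMDiff_snd)))
  unitary a p u v := by
    have h : ‖((a⁻¹ : Circle) : ℂ) * p.2‖ = ‖p.2‖ := by
      rw [norm_mul, Circle.norm_coe, one_mul]
    exact congrArg₂ (fun (r : ℝ) (w : ℂ) => (Real.exp (-Real.pi * r ^ 2) : ℂ) * w) h
      (hlift.unitary a p.1 u v)
  commutes a k u v h := by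
    rw [LineBundleData.boxC_moves_iff] at h ⊢
    refine ⟨hlift.commutes a k.1 _ _ h.1, ?_, ?_⟩
    · exact congrArg (((a⁻¹ : Circle) : ℂ) * ·) h.2.1
    · exact congrArg (((a⁻¹ : Circle) : ℂ) * ·) h.2.2

end BoxBundle

/-! ### Descent of a Hermitian line bundle with connection to a circle quotient. -/

section Quotient

variable {V₀ : Type*} [NormedAddCommGroup V₀] [NormedSpace ℝ V₀]
  {H₀ : Type*} [TopologicalSpace H₀] {I₀ : ModelWithCorners ℝ V₀ H₀}
  {X₀ : Type*} [TopologicalSpace X₀] [ChartedSpace H₀ X₀] [IsManifold I₀ ∞ X₀]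
  {V₁ : Type*} [NormedAddCommGroup V₁] [NormedSpace ℝ V₁]
  {H₁ : Type*} [TopologicalSpace H₁] {I₁ : ModelWithCorners ℝ V₁ H₁}
  {X₁ : Type*} [TopologicalSpace X₁] [ChartedSpace H₁ X₁]
  {G : LieGroupoid I₀ X₀ I₁ X₁} {C : CircleAction G}
  {L : X₀ → Type*} [∀ x, AddCommMonoid (L x)] [∀ x, Module ℂ (L x)]
  {B : LineBundleData G L} {lift : ∀ (a : Circle) (x : X₀), L x →ₗ[ℂ] L (C.obj a x)}

theorem LineBundleData.quotient_moves_iff {k : X₁ × Circle} {u v : TotalSpace ℂ L} :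
    (B.quotient C lift).Moves k u v ↔
      ∃ w, B.Moves k.1 u w ∧ v = ⟨C.obj k.2 w.proj, lift k.2 w.proj w.2⟩ := by
  constructor
  · rintro ⟨w, rfl, rfl⟩
    exact ⟨⟨G.tgt k.1, B.move k.1 w⟩, ⟨w, rfl, rfl⟩, rfl⟩
  · rintro ⟨_, ⟨w, rfl, rfl⟩, rfl⟩
    exact ⟨w, rfl, rfl⟩

variable [TopologicalSpace (TotalSpace ℂ L)] [∀ x, TopologicalSpace (L x)] [FiberBundle ℂ L]

theorem IsCircleLift.total_lift_inv (hlift : IsCircleLift C B lift) (a : Circle) (x : X₀)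
    (u : L x) : (⟨C.obj a⁻¹ (C.obj a x), lift a⁻¹ (C.obj a x) (lift a x u)⟩ : TotalSpace ℂ L)
      = ⟨x, u⟩ := by
  rw [← hlift.lift_mul, inv_mul_cancel, hlift.lift_one]

/-- A Hermitian line bundle with connection descends to the quotient by a lifted circle action on
an invariant set along which the lifted action preserves the connection. -/
theorem LineBundleData.IsHermitianLineBundle.quotient (hB : B.IsHermitianLineBundle univ)
    (hlift : IsCircleLift C B lift) {S : Set X₀}
    (hS : ∀ k, C.quotient.src k ∈ S ↔ C.quotient.tgt k ∈ S)
    (hmove : ∀ (g : ℝ → X₁) (u : ∀ t, L (G.src (g t))), ContMDiff 𝓘(ℝ, ℝ) I₁ ∞ g →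
      IsSmoothAlong I₀ (fun t => G.src (g t)) u →
        IsSmoothAlong I₀ (fun t => G.tgt (g t)) (fun t => B.move (g t) (u t)))
    (hcov : ∀ (a : ℝ → Circle) (γ : ℝ → X₀) (u : ∀ t, L (γ t)), ContMDiff 𝓘(ℝ, ℝ) (𝓡 1) ∞ a →
      IsSmoothAlong I₀ γ u → (∀ t, γ t ∈ S) → ∀ t,
        B.covDeriv (fun s => C.obj (a s) (γ s)) (fun s => lift (a s) (γ s) (u s)) t
          = lift (a t) (γ t) (B.covDeriv γ u t)) :
    (B.quotient C lift).IsHermitianLineBundle S where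
  invariant := hS
  herm_conj x _ := hB.herm_conj x (mem_univ _)
  herm_add x _ := hB.herm_add x (mem_univ _)
  herm_smul x _ := hB.herm_smul x (mem_univ _)
  herm_pos x _ := hB.herm_pos x (mem_univ _)
  smooth_herm := hB.smooth_herm.mono fun _ _ => mem_univ _
  move_one x _ u := LineBundleData.quotient_moves_iff.2
    ⟨⟨x, u⟩, hB.move_one x (mem_univ _) u, (hlift.lift_one x u).symm⟩
  move_mul k l u v w _ h1 h2 := by
    rw [LineBundleData.quotient_moves_iff] at h1 h2 ⊢
    obtain ⟨u', hu', rfl⟩ := h1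
    obtain ⟨w', hw', rfl⟩ := h2
    -- In the semidirect product, `k * l` has arrow part `(l.2⁻¹ • k.1) * l.1`. The intermediate
    -- point `w'` is therefore rotated back by `l.2⁻¹`, and the circle part `k.2 * l.2` restores the
    -- final position.
    refine ⟨_, hB.move_mul (C.arr l.2⁻¹ k.1) l.1 u u'
      ⟨C.obj l.2⁻¹ w'.proj, lift l.2⁻¹ w'.proj w'.2⟩ (mem_univ _) hu' ?_, ?_⟩
    · have := hlift.commutes l.2⁻¹ k.1 _ _ hw'
      rwa [hlift.total_lift_inv] at this
    · change _ = (⟨C.obj (k.2 * l.2) (C.obj l.2⁻¹ w'.proj),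
        lift (k.2 * l.2) (C.obj l.2⁻¹ w'.proj) (lift l.2⁻¹ w'.proj w'.2)⟩ : TotalSpace ℂ L)
      rw [← hlift.lift_mul, mul_assoc, mul_inv_cancel, mul_one]
  smooth_move σ hσ := by
    have h1 : ContMDiff I₁ (I₀.prod 𝓘(ℝ, ℂ)) ∞
        (fun g => (⟨G.tgt g, B.move g (σ (G.src g))⟩ : TotalSpace ℂ L)) := by
      rw [← contMDiffOn_univ]
      exact (hB.smooth_move σ hσ).mono fun g _ => mem_univ _
    exact (hlift.smooth.comp (contMDiff_snd.prodMk (h1.comp contMDiff_fst))).contMDiffOn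
  herm_move k _ u v := (hlift.unitary _ _ _ _).trans (hB.herm_move k.1 (mem_univ _) u v)
  exists_connectionForm x _ := by
    obtain ⟨U, σ, A, hx, hA⟩ := hB.exists_connectionForm x (mem_univ _)
    exact ⟨U, σ, A, hx, hA.isOpen, hA.smooth_frame, hA.frame_ne_zero, hA.smooth_form,
      fun γ u hu _ => hA.covDeriv_eq γ u hu fun _ => mem_univ _⟩
  covDeriv_herm γ u v hu hv _ := hB.covDeriv_herm γ u v hu hv fun _ => mem_univ _
  covDeriv_move k u hk hu hγ t := by
    have hg : ContMDiff 𝓘(ℝ, ℝ) I₁ ∞ (fun t => (k t).1) := contMDiff_fst.comp hk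
    -- The arrows `(g, 1)` of the quotient show that `S` is invariant under `G` itself.
    have hinv : ∀ g, G.src g ∈ S ↔ G.tgt g ∈ S := fun g => by
      simpa [CircleAction.quotient, C.obj_one] using hS (g, 1)
    have h1 := hcov (fun t => (k t).2) (fun t => G.tgt (k t).1)
      (fun t => B.move (k t).1 (u t)) (contMDiff_snd.comp hk) (hmove _ u hg hu)
      (fun t => (hinv _).1 (hγ t)) t
    have h2 := hB.covDeriv_move (fun t => (k t).1) u hg hu (fun _ => mem_univ _) t
    exact h1.trans (congrArg (lift (k t).2 (G.tgt (k t).1)) h2)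

end Quotient

/-! ### The reduced bundle and the cut bundle -/

/-- Differentiating `a \bar a = 1` shows that `a' \bar a` is purely imaginary; its imaginary part is
the angular velocity. -/
theorem exists_hasDerivAt_circle {a : ℝ → Circle} (ha : ContMDiff 𝓘(ℝ, ℝ) (𝓡 1) ∞ a) (t : ℝ) :
    ∃ ν : ℝ, HasDerivAt (fun s => (a s : ℂ)) (Complex.I * ν * a t) t := by
  have h1 : ContDiff ℝ ∞ (fun s => (a s : ℂ)) := (contMDiff_circle_val.comp ha).contDiff
  have hd : HasDerivAt (fun s => (a s : ℂ)) (deriv (fun s => (a s : ℂ)) t) t :=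
    (h1.differentiable (by simp) t).hasDerivAt
  set a' := deriv (fun s => (a s : ℂ)) t
  have h2 : HasDerivAt (fun s => starRingEnd ℂ (a s : ℂ)) (starRingEnd ℂ a') t :=
    (Complex.conjCLE : ℂ →L[ℝ] ℂ).hasFDerivAt.comp_hasDerivAt t hd
  have hone : ∀ s, (a s : ℂ) * starRingEnd ℂ (a s : ℂ) = 1 := fun s => by
    rw [Complex.mul_conj, Circle.normSq_coe, Complex.ofReal_one]
  have h3 : a' * starRingEnd ℂ (a t : ℂ) + a t * starRingEnd ℂ a' = 0 := by
    have h4 := hd.mul h2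
    have h5 : ((fun s => (a s : ℂ)) * fun s => starRingEnd ℂ (a s : ℂ)) = fun _ => 1 :=
      funext hone
    rw [h5] at h4
    exact h4.unique (hasDerivAt_const t 1)
  have h6 : (a' * starRingEnd ℂ (a t : ℂ)).re = 0 := by
    have h7 := congrArg Complex.re h3
    simp only [Complex.add_re, Complex.mul_re, Complex.conj_re, Complex.conj_im,
      Complex.zero_re] at h7 ⊢
    linarith
  refine ⟨(a' * starRingEnd ℂ (a t : ℂ)).im, hd.congr_deriv ?_⟩
  have h8 : Complex.I * (a' * starRingEnd ℂ (a t : ℂ)).im = a' * starRingEnd ℂ (a t : ℂ) := by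
    apply Complex.ext <;> simp [h6]
  rw [h8, mul_assoc, mul_comm (starRingEnd ℂ _), hone, mul_one]

theorem norm_circle_inv_mul (a : Circle) (z : ℂ) : ‖((a⁻¹ : Circle) : ℂ) * z‖ = ‖z‖ := by
  rw [norm_mul, Circle.norm_coe, one_mul]

section Reduction

variable {V₀ : Type*} [NormedAddCommGroup V₀] [NormedSpace ℝ V₀] [FiniteDimensional ℝ V₀]
  {H₀ : Type*} [TopologicalSpace H₀] {I₀ : ModelWithCorners ℝ V₀ H₀} [I₀.Boundaryless]
  {X₀ : Type*} [TopologicalSpace X₀] [ChartedSpace H₀ X₀] [IsManifold I₀ ∞ X₀] [T2Space X₀]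
  {V₁ : Type*} [NormedAddCommGroup V₁] [NormedSpace ℝ V₁]
  {H₁ : Type*} [TopologicalSpace H₁] {I₁ : ModelWithCorners ℝ V₁ H₁}
  {X₁ : Type*} [TopologicalSpace X₁] [ChartedSpace H₁ X₁]
  {G : LieGroupoid I₀ X₀ I₁ X₁} {C : CircleAction G}
  {Ω : ∀ x : X₀, TangentSpace I₀ x →L[ℝ] TangentSpace I₀ x →L[ℝ] ℝ} {c : ℝ} {Φ : X₀ → ℝ}

theorem IsMomentMap.quotient_tgt (hΩ : IsSymplecticForm G Ω) (hΦ : IsMomentMap C Ω c Φ)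
    (k : X₁ × Circle) : Φ (C.quotient.tgt k) = Φ (C.quotient.src k) :=
  (hΦ.apply_obj hΩ _ _).trans (hΦ.invariant k.1).symm

theorem IsMomentMap.cutMoment_tgt (hΩ : IsSymplecticForm G Ω) (hΦ : IsMomentMap C Ω c Φ)
    (k : (X₁ × ℂ) × Circle) :
    cutMoment c Φ (C.prodC.quotient.tgt k) = cutMoment c Φ (C.prodC.quotient.src k) := by
  obtain ⟨⟨g, z⟩, a⟩ := k
  change Φ (C.obj a (G.tgt g)) - c / 2 * ‖((a⁻¹ : Circle) : ℂ) * z‖ ^ 2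
    = Φ (G.src g) - c / 2 * ‖z‖ ^ 2
  rw [hΦ.apply_obj hΩ, hΦ.invariant, norm_circle_inv_mul]

variable {L : X₀ → Type*} [∀ x, AddCommGroup (L x)] [∀ x, Module ℂ (L x)]
  [TopologicalSpace (TotalSpace ℂ L)] [∀ x, TopologicalSpace (L x)] [FiberBundle ℂ L]
  [VectorBundle ℂ ℂ L] [VectorBundle ℝ ℂ L] [ContMDiffVectorBundle ∞ ℂ L I₀]
  {B : LineBundleData G L} {lift : ∀ (a : Circle) (x : X₀), L x →ₗ[ℂ] L (C.obj a x)}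

/-- The reduced bundle is a Hermitian line bundle with connection. -/
theorem LineBundleData.IsPrequantum.red (hB : B.IsPrequantum Ω) (hΩ : IsSymplecticForm G Ω)
    (hΦ : IsMomentMap C Ω c Φ) (hc : c ≠ 0) (hlift : IsCircleLift C B lift)
    (hK : SatisfiesKostant C B lift c Φ) :
    (B.red C lift).IsHermitianLineBundle {x | Φ x = 0} := by
  have hH := hB.isHermitianLineBundle
  refine hH.quotient hlift (fun k => ?_) (fun g u hg hu => hH.contMDiff_move hg hu) ?_
  · rw [mem_ofPred_eq, mem_ofPred_eq, hΦ.quotient_tgt hΩ]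
  · intro a γ u ha hu hγ t
    -- The correction in `covDeriv_lift` is proportional to `Φ`, hence vanishes on the level set.
    obtain ⟨ν, hν⟩ := exists_hasDerivAt_circle ha t
    rw [hB.covDeriv_lift hΩ hΦ hc hlift hK hu ha hν, show Φ (γ t) = 0 from hγ t]
    simp

theorem deriv_circle_inv_mul {a : ℝ → Circle} {z : ℝ → ℂ} {ν : ℝ} {z' : ℂ} {t : ℝ}
    (ha : HasDerivAt (fun s => (a s : ℂ)) (Complex.I * ν * a t) t) (hz : HasDerivAt z z' t) :
    deriv (fun s => (((a s)⁻¹ : Circle) : ℂ) * z s) t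
      = (((a t)⁻¹ : Circle) : ℂ) * (z' - Complex.I * ν * z t) := by
  have h1 : HasDerivAt (fun s => (((a s)⁻¹ : Circle) : ℂ))
      (starRingEnd ℂ (Complex.I * ν * a t)) t := by
    simp only [Circle.coe_inv_eq_conj]
    exact (Complex.conjCLE : ℂ →L[ℝ] ℂ).hasFDerivAt.comp_hasDerivAt t ha
  have h2 := (h1.mul hz).deriv
  refine Eq.trans h2 ?_
  simp only [Circle.coe_inv_eq_conj, map_mul, Complex.conj_I, Complex.conj_ofReal]
  ring

/-- The cut bundle is a Hermitian line bundle with connection. -/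
theorem LineBundleData.IsPrequantum.cut (hB : B.IsPrequantum Ω) (hΩ : IsSymplecticForm G Ω)
    (hΦ : IsMomentMap C Ω c Φ) (hc : c ≠ 0) (hlift : IsCircleLift C B lift)
    (hK : SatisfiesKostant C B lift c Φ) :
    (B.cut C lift).IsHermitianLineBundle {p | cutMoment c Φ p = 0} := by
  have hH := hB.isHermitianLineBundle
  refine hH.boxC.quotient hlift.box (fun k => ?_) (fun k u hk hu => ?_) ?_
  · rw [mem_ofPred_eq, mem_ofPred_eq, hΦ.cutMoment_tgt hΩ]
  · exact contMDiff_box_iff.2 ⟨hH.contMDiff_move (contMDiff_fst.comp hk) hu.box_fst,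
      (contMDiff_snd.comp hk : ContMDiff 𝓘(ℝ, ℝ) 𝓘(ℝ, ℂ) ∞ fun t => (k t).2)⟩
  · intro a γ u ha hu hγ t
    obtain ⟨ν, hν⟩ := exists_hasDerivAt_circle ha t
    have h1 := hB.covDeriv_lift hΩ hΦ hc hlift hK hu.box_fst ha hν
    have hz : HasDerivAt (fun s => (γ s).2) (deriv (fun s => (γ s).2) t) t :=
      (hu.box_snd.differentiable (by simp) t).hasDerivAt
    have h2 := deriv_circle_inv_mul hν hz
    have h3 : ∀ {x y : X₀} (f : L x →ₗ[ℂ] L y) (D w : L x) {α β δ : ℂ}, α + β = δ →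
        f (D + α • w) + β • f w = f (D + δ • w) := by
      rintro x y f D w α β _ rfl
      rw [← map_smul, ← map_add, add_assoc, ← add_smul]
    refine (congrArg₂ (fun (D : L (C.obj (a t) (γ t).1)) (z' : ℂ) =>
      D + (-Real.pi * ((((a t)⁻¹ : Circle) : ℂ) * (γ t).2) * starRingEnd ℂ z') •
        lift (a t) (γ t).1 (u t)) h1 h2).trans ?_
    refine h3 (lift (a t) (γ t).1) _ _ ?_
    -- On `ψ⁻¹(0)` the correction for `L` is `2πi Φ ν / c = πiν|z|²`. Rotating `z` by `a⁻¹` adds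
    -- `-iνz` to its velocity, up to the rotation, and the term `-π z d\bar z` then yields exactly
    -- `-πiν|z|²`.
    have h4 : Φ (γ t).1 = c / 2 * ‖(γ t).2‖ ^ 2 := sub_eq_zero.1 (hγ t)
    have h5 : (Φ (γ t).1 : ℂ) = c / 2 * ((γ t).2 * starRingEnd ℂ (γ t).2) := by
      rw [h4, Complex.mul_conj, Complex.normSq_eq_norm_sq]
      push_cast
      ring
    have h6 : (((a t)⁻¹ : Circle) : ℂ) * starRingEnd ℂ (((a t)⁻¹ : Circle) : ℂ) = 1 := by
      rw [Complex.mul_conj, Circle.normSq_coe, Complex.ofReal_one]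
    have hc' : (c : ℂ) ≠ 0 := Complex.ofReal_ne_zero.2 hc
    set w := (((a t)⁻¹ : Circle) : ℂ)
    set z' := deriv (fun s => (γ s).2) t
    have h7 : -(Real.pi : ℂ) * (w * (γ t).2) * starRingEnd ℂ (w * (z' - Complex.I * ν * (γ t).2))
        = (w * starRingEnd ℂ w) * (-Real.pi * (γ t).2 *
          (starRingEnd ℂ z' + Complex.I * ν * starRingEnd ℂ (γ t).2)) := by
      simp only [map_mul, map_sub, Complex.conj_I, Complex.conj_ofReal]
      ring
    rw [h7, h6, h5]
    field_simp
    ring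

end Reduction

/-! ### The orbifolds `{Φ > 0}` and `M_red` inside the cut -/

/-- The direction `z / |z|` of a complex number `z ≠ 0`. -/
def direction (z : ℂ) : Circle := Circle.exp (Complex.arg z)

theorem norm_mul_direction (z : ℂ) : (‖z‖ : ℂ) * direction z = z := by
  rw [direction, Circle.coe_exp]
  exact Complex.norm_mul_exp_arg_mul_I z

theorem direction_unique {z : ℂ} {a : Circle} (hz : z ≠ 0) (h : (‖z‖ : ℂ) * a = z) :
    direction z = a :=
  Circle.ext (mul_left_cancel₀ (Complex.ofReal_ne_zero.2 (norm_ne_zero_iff.2 hz))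
    ((norm_mul_direction z).trans h.symm))

theorem direction_circle_mul (a : Circle) {z : ℂ} (hz : z ≠ 0) :
    direction (a * z) = a * direction z := by
  refine direction_unique (mul_ne_zero a.coe_ne_zero hz) ?_
  rw [norm_mul, Circle.norm_coe, one_mul, Circle.coe_mul, mul_left_comm, norm_mul_direction]

theorem direction_ofReal {r : ℝ} (hr : 0 ≤ r) : direction (r : ℂ) = 1 := by
  rw [direction, Complex.arg_ofReal_of_nonneg hr, Circle.exp_zero]

/-- The argument is smooth only off its branch cut. Since `direction w = direction z * direction (w
/ z)`, only its smoothness at `1` matters. -/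
theorem contMDiffAt_direction {z : ℂ} (hz : z ≠ 0) :
    ContMDiffAt 𝓘(ℝ, ℂ) (𝓡 1) ∞ direction z := by
  have h1 : ContDiffAt ℝ ∞ (fun w : ℂ => Complex.arg (w / z)) z := by
    have h2 : ContDiffAt ℝ ∞ (fun w : ℂ => (Complex.log (w / z)).im) z := by
      refine Complex.imCLM.contDiff.contDiffAt.comp z (ContDiffAt.comp z
        (g := Complex.log) (f := fun w => w / z) ?_ (contDiffAt_id.div_const z))
      have h3 : z / z ∈ Complex.slitPlane := by rw [div_self hz]; exact Complex.one_mem_slitPlane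
      exact (Complex.contDiffAt_log h3).restrict_scalars ℝ
    simpa only [Complex.log_im] using h2
  have h4 : ContMDiffAt 𝓘(ℝ, ℂ) (𝓡 1) ∞ (fun w => direction z * direction (w / z)) z :=
    contMDiffAt_const.mul (contMDiff_circleExp.contMDiffAt.comp z h1.contMDiffAt)
  refine h4.congr_of_eventuallyEq ?_
  filter_upwards [isOpen_ne.mem_nhds hz] with w hw
  refine direction_unique hw ?_
  have h5 := norm_mul_direction z
  have h6 := norm_mul_direction (w / z)
  rw [norm_div, Complex.ofReal_div] at h6
  have hz' : (‖z‖ : ℂ) ≠ 0 := Complex.ofReal_ne_zero.2 (norm_ne_zero_iff.2 hz)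
  rw [Circle.coe_mul]
  calc (‖w‖ : ℂ) * (direction z * direction (w / z))
      = (‖z‖ * direction z) * ((‖w‖ : ℂ) / ‖z‖ * direction (w / z)) := by field_simp
    _ = w := by rw [h5, h6, mul_div_cancel₀ _ hz]

section Embeddings

variable {V₀ : Type*} [NormedAddCommGroup V₀] [NormedSpace ℝ V₀] [FiniteDimensional ℝ V₀]
  {H₀ : Type*} [TopologicalSpace H₀] {I₀ : ModelWithCorners ℝ V₀ H₀} [I₀.Boundaryless]
  {X₀ : Type*} [TopologicalSpace X₀] [ChartedSpace H₀ X₀] [IsManifold I₀ ∞ X₀] [T2Space X₀]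
  {V₁ : Type*} [NormedAddCommGroup V₁] [NormedSpace ℝ V₁]
  {H₁ : Type*} [TopologicalSpace H₁] {I₁ : ModelWithCorners ℝ V₁ H₁}
  {X₁ : Type*} [TopologicalSpace X₁] [ChartedSpace H₁ X₁]
  {G : LieGroupoid I₀ X₀ I₁ X₁} {C : CircleAction G}
  {Ω : ∀ x : X₀, TangentSpace I₀ x →L[ℝ] TangentSpace I₀ x →L[ℝ] ℝ} {c : ℝ} {Φ : X₀ → ℝ}

theorem sqrt_of_cutMoment_eq_zero (hc : 0 < c) {p : X₀ × ℂ} (h : cutMoment c Φ p = 0) :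
    Real.sqrt (2 * Φ p.1 / c) = ‖p.2‖ := by
  have h1 : Φ p.1 = c / 2 * ‖p.2‖ ^ 2 := sub_eq_zero.1 h
  have h2 : 2 * Φ p.1 / c = ‖p.2‖ ^ 2 := by
    rw [h1]
    field_simp
  rw [h2, Real.sqrt_sq (norm_nonneg _)]

theorem snd_ne_zero_of_cutMoment {p : X₀ × ℂ} (h : cutMoment c Φ p = 0) (hp : 0 < Φ p.1) :
    p.2 ≠ 0 := by
  intro h0
  rw [cutMoment, h0, norm_zero] at h
  linarith

theorem cutMoment_cutEmb (hc : 0 < c) {x : X₀} (hx : 0 < Φ x) :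
    cutMoment c Φ (cutEmb c Φ x) = 0 := by
  change Φ x - c / 2 * ‖(Real.sqrt (2 * Φ x / c) : ℂ)‖ ^ 2 = 0
  rw [Complex.norm_real, Real.norm_eq_abs, sq_abs, Real.sq_sqrt (by positivity)]
  field_simp
  ring

theorem contMDiffAt_sqrt_moment (hc : 0 < c) (hΦ : ContMDiff I₀ 𝓘(ℝ, ℝ) ∞ Φ) {x : X₀}
    (hx : 0 < Φ x) :
    ContMDiffAt I₀ 𝓘(ℝ, ℝ) ∞ (fun x => Real.sqrt (2 * Φ x / c)) x := by
  have h1 : ContDiffAt ℝ ∞ (fun r : ℝ => Real.sqrt (2 * r / c)) (Φ x) :=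
    ContDiffAt.sqrt (by fun_prop) (by positivity)
  exact h1.contMDiffAt.comp x hΦ.contMDiffAt

theorem contMDiffAt_ofReal_sqrt_moment (hc : 0 < c) (hΦ : ContMDiff I₀ 𝓘(ℝ, ℝ) ∞ Φ) {x : X₀}
    (hx : 0 < Φ x) :
    ContMDiffAt I₀ 𝓘(ℝ, ℂ) ∞ (fun x => (Real.sqrt (2 * Φ x / c) : ℂ)) x :=
  Complex.ofRealCLM.contDiff.contMDiff.contMDiffAt.comp x (contMDiffAt_sqrt_moment hc hΦ hx)

theorem isSmoothFunctor_cutEmb (hc : 0 < c) (hΦ : IsMomentMap C Ω c Φ) :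
    IsSmoothFunctor G {x | 0 < Φ x} C.prodC.quotient {p | cutMoment c Φ p = 0 ∧ 0 < Φ p.1}
      (cutEmb c Φ) (cutEmbArr G c Φ) where
  mapsTo x hx := ⟨cutMoment_cutEmb hc hx, hx⟩
  smooth_obj x hx := (contMDiffAt_id.prodMk
    (contMDiffAt_ofReal_sqrt_moment hc hΦ.smooth hx)).contMDiffWithinAt
  smooth_arr g hg := ((contMDiffAt_id.prodMk
    ((contMDiffAt_ofReal_sqrt_moment hc hΦ.smooth hg.1).comp g
      G.smooth_src.contMDiffAt)).prodMk contMDiffAt_const).contMDiffWithinAt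
  map_src _ _ _ := rfl
  map_tgt g _ _ := by
    refine Prod.ext (C.obj_one _) ?_
    change (((1 : Circle)⁻¹ : Circle) : ℂ) * (Real.sqrt (2 * Φ (G.src g) / c) : ℂ)
      = (Real.sqrt (2 * Φ (G.tgt g) / c) : ℂ)
    rw [hΦ.invariant g, inv_one, Circle.coe_one, one_mul]
  map_mul g h _ _ _ hgh := by
    refine Prod.ext (Prod.ext ?_ ?_) (mul_one _).symm
    · change G.mul g h = G.mul (C.arr 1⁻¹ g) h
      rw [inv_one, C.arr_one]
    · change (Real.sqrt (2 * Φ (G.src (G.mul g h)) / c) : ℂ) = Real.sqrt (2 * Φ (G.src h) / c)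
      rw [G.src_mul _ _ hgh]

theorem contMDiffAt_rotate {W : Type*} [NormedAddCommGroup W] [NormedSpace ℝ W]
    {K : Type*} [TopologicalSpace K] {J : ModelWithCorners ℝ W K}
    {M : Type*} [TopologicalSpace M] [ChartedSpace K M] {a : Circle → M → M}
    (ha : ContMDiff ((𝓡 1).prod J) J ∞ (fun p : Circle × M => a p.1 p.2)) {m : M} {z : ℂ}
    (hz : z ≠ 0) :
    ContMDiffAt (J.prod 𝓘(ℝ, ℂ)) J ∞ (fun p : M × ℂ => a (direction p.2) p.1) (m, z) :=
  ha.contMDiffAt.comp (m, z) (ContMDiffAt.prodMk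
    (ContMDiffAt.comp (g := direction) (m, z) (contMDiffAt_direction hz) contMDiffAt_snd)
    contMDiffAt_fst)

/-- This functor will invert the embedding of `{Φ > 0}`. Acting by `direction z` carries `(x, z)` to
a point whose second component is `|z|`, and the second component is then forgotten. The circle part
`b` of an arrow disappears because `direction (b⁻¹ z) * b = direction z`. -/
theorem isSmoothFunctor_rotate (hΩ : IsSymplecticForm G Ω) (hΦ : IsMomentMap C Ω c Φ) :
    IsSmoothFunctor C.prodC.quotient {p | cutMoment c Φ p = 0 ∧ 0 < Φ p.1} G {x | 0 < Φ x}
      (fun p => C.obj (direction p.2) p.1) (fun k => C.arr (direction k.1.2) k.1.1) where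
  mapsTo p hp := by
    change 0 < Φ (C.obj _ _)
    rw [hΦ.apply_obj hΩ]
    exact hp.2
  smooth_obj p hp := (contMDiffAt_rotate C.smooth_obj
    (snd_ne_zero_of_cutMoment hp.1 hp.2)).contMDiffWithinAt
  smooth_arr k hk := ((contMDiffAt_rotate C.smooth_arr
    (snd_ne_zero_of_cutMoment hk.1.1 hk.1.2)).comp k contMDiffAt_fst).contMDiffWithinAt
  map_src _ _ _ := C.src_arr _ _
  map_tgt k hk _ := by
    obtain ⟨⟨g, z⟩, b⟩ := k
    have hz : z ≠ 0 := snd_ne_zero_of_cutMoment hk.1 hk.2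
    change G.tgt (C.arr (direction z) g)
      = C.obj (direction (((b⁻¹ : Circle) : ℂ) * z)) (C.obj b (G.tgt g))
    rw [C.tgt_arr, direction_circle_mul _ hz, ← C.obj_mul, mul_right_comm, inv_mul_cancel, one_mul]
  map_mul k l hl _ _ hkl := by
    obtain ⟨⟨g, z⟩, a⟩ := k
    obtain ⟨⟨h, w⟩, b⟩ := l
    have hw : w ≠ 0 := snd_ne_zero_of_cutMoment hl.1 hl.2
    obtain rfl : z = ((b⁻¹ : Circle) : ℂ) * w := congrArg Prod.snd hkl
    have hgh : G.src g = C.obj b (G.tgt h) := congrArg Prod.fst hkl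
    change C.arr (direction w) (G.mul (C.arr b⁻¹ g) h)
      = G.mul (C.arr (direction (((b⁻¹ : Circle) : ℂ) * w)) g) (C.arr (direction w) h)
    rw [C.mul_arr _ _ _ (by rw [C.src_arr, hgh, C.obj_inv_obj]), direction_circle_mul _ hw,
      ← C.arr_mul, mul_comm b⁻¹]

/-- Embedding and then rotating is the identity, since a nonnegative real number has direction `1`;
units of `G` give the first transformation. Rotating and then embedding moves `(x, z)` along its
circle orbit to the slice, and the arrow with circle part `(direction z)⁻¹` leads back. -/
theorem isSmoothEquivalence_cutEmb (hc : 0 < c) (hΩ : IsSymplecticForm G Ω)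
    (hΦ : IsMomentMap C Ω c Φ) :
    IsSmoothEquivalence G {x | 0 < Φ x} C.prodC.quotient
      {p | cutMoment c Φ p = 0 ∧ 0 < Φ p.1} (cutEmb c Φ) (cutEmbArr G c Φ) := by
  refine ⟨isSmoothFunctor_cutEmb hc hΦ, _, _, G.one, fun p =>
    ((G.one (C.obj (direction p.2) p.1), (Real.sqrt (2 * Φ p.1 / c) : ℂ)), (direction p.2)⁻¹),
    isSmoothFunctor_rotate hΩ hΦ, ?_, ?_⟩
  · have h1 : ∀ x, direction (cutEmb c Φ x).2 = 1 := fun x => direction_ofReal (Real.sqrt_nonneg _)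
    have h2 : ∀ g, direction (cutEmbArr G c Φ g).1.2 = 1 :=
      fun g => direction_ofReal (Real.sqrt_nonneg _)
    refine ⟨G.smooth_one.contMDiffOn, fun x _ => ?_, fun x _ => G.tgt_one x, fun g _ _ => ?_⟩
    · simp only [Function.comp_apply, h1]
      exact (G.src_one x).trans (C.obj_one x).symm
    · simp only [Function.comp_apply, h2]
      change G.mul (G.one (G.tgt g)) (C.arr 1 g) = G.mul g (G.one (G.src g))
      rw [C.arr_one, G.one_mul, G.mul_one]
  · refine ⟨fun p hp => ?_, fun p hp => ?_, fun p hp => ?_, fun k hk _ => ?_⟩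
    · have hz := snd_ne_zero_of_cutMoment hp.1 hp.2
      exact (((G.smooth_one.contMDiffAt.comp p (contMDiffAt_rotate C.smooth_obj hz)).prodMk
        (ContMDiffAt.comp (g := fun x => (Real.sqrt (2 * Φ x / c) : ℂ)) p
          (contMDiffAt_ofReal_sqrt_moment hc hΦ.smooth hp.2) contMDiffAt_fst)).prodMk
        ((contMDiff_inv (𝓡 1) ∞).contMDiffAt.comp p (ContMDiffAt.comp (g := direction) p
          (contMDiffAt_direction hz) contMDiffAt_snd))).contMDiffWithinAt
    · refine Prod.ext (G.src_one _) ?_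
      change (Real.sqrt (2 * Φ p.1 / c) : ℂ)
        = Real.sqrt (2 * Φ (C.obj (direction p.2) p.1) / c)
      rw [hΦ.apply_obj hΩ]
    · refine Prod.ext ?_ ?_
      · change C.obj (direction p.2)⁻¹ (G.tgt (G.one _)) = p.1
        rw [G.tgt_one, C.obj_inv_obj]
      · change ((((direction p.2)⁻¹)⁻¹ : Circle) : ℂ) * (Real.sqrt (2 * Φ p.1 / c) : ℂ) = p.2
        rw [inv_inv, sqrt_of_cutMoment_eq_zero hc hp.1, mul_comm, norm_mul_direction]
    · obtain ⟨⟨g, z⟩, b⟩ := k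
      have hz : z ≠ 0 := snd_ne_zero_of_cutMoment hk.1 hk.2
      have h1 : direction (((b⁻¹ : Circle) : ℂ) * z) = b⁻¹ * direction z :=
        direction_circle_mul _ hz
      refine Prod.ext (Prod.ext ?_ ?_) ?_
      · change G.mul (C.arr 1⁻¹ (G.one (C.obj (direction (((b⁻¹ : Circle) : ℂ) * z))
            (C.obj b (G.tgt g))))) (C.arr (direction z) g)
          = G.mul (C.arr ((direction z)⁻¹)⁻¹ g) (G.one (C.obj (direction z) (G.src g)))
        rw [h1, ← C.obj_mul, mul_right_comm, inv_mul_cancel, one_mul, inv_one, C.arr_one, inv_inv,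
          ← C.tgt_arr, G.one_mul, ← C.src_arr, G.mul_one]
      · change (Real.sqrt (2 * Φ (G.src (C.arr (direction z) g)) / c) : ℂ)
          = Real.sqrt (2 * Φ (G.src g) / c)
        rw [C.src_arr, hΦ.apply_obj hΩ]
      · change (direction (((b⁻¹ : Circle) : ℂ) * z))⁻¹ * 1 = b * (direction z)⁻¹
        rw [h1, mul_inv, inv_inv, mul_one]

/-- On `z = 0` the equation `ψ = 0` is `Φ = 0`, and rotation fixes `z`. The two restricted groupoids
are thus identified by mutually inverse functors, and units serve as both natural transformations.
-/
theorem isSmoothEquivalence_redEmb (C : CircleAction G) (c : ℝ) (Φ : X₀ → ℝ) :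
    IsSmoothEquivalence C.quotient {x | Φ x = 0} C.prodC.quotient
      {p | cutMoment c Φ p = 0 ∧ p.2 = 0} redEmb redEmbArr := by
  have h0 : ∀ p : X₀ × ℂ, p.2 = 0 → redEmb p.1 = p := fun p hp => Prod.ext rfl hp.symm
  have h1 : ∀ k : (X₁ × ℂ) × Circle, k.1.2 = 0 → redEmbArr (k.1.1, k.2) = k :=
    fun k hk => Prod.ext (Prod.ext rfl hk.symm) rfl
  refine ⟨⟨fun x hx => ⟨?_, rfl⟩, ?_, ?_, fun _ _ _ => rfl, fun k _ _ => ?_, fun _ _ _ _ _ _ => ?_⟩,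
    Prod.fst, fun k => (k.1.1, k.2), C.quotient.one, C.prodC.quotient.one,
    ⟨fun p hp => ?_, contMDiff_fst.contMDiffOn, ?_, fun _ _ _ => rfl, fun _ _ _ => rfl,
      fun _ _ _ _ _ _ => rfl⟩,
    ⟨C.quotient.smooth_one.contMDiffOn, fun x _ => C.quotient.src_one x,
      fun x _ => C.quotient.tgt_one x, fun k _ _ => ?_⟩,
    ⟨C.prodC.quotient.smooth_one.contMDiffOn, fun p hp => ?_,
      fun p _ => C.prodC.quotient.tgt_one p, fun k hk _ => ?_⟩⟩
  · change Φ x - c / 2 * ‖(0 : ℂ)‖ ^ 2 = 0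
    rw [norm_zero, show Φ x = 0 from hx]
    ring
  · exact (contMDiff_id.prodMk contMDiff_const).contMDiffOn
  · exact ((contMDiff_fst.prodMk contMDiff_const).prodMk contMDiff_snd).contMDiffOn
  · exact Prod.ext rfl (mul_zero _)
  · exact Prod.ext (Prod.ext rfl rfl) rfl
  · have h : Φ p.1 - c / 2 * ‖p.2‖ ^ 2 = 0 := hp.1
    rw [hp.2, norm_zero] at h
    change Φ p.1 = 0
    linarith
  · exact ((contMDiff_fst.comp contMDiff_fst).prodMk contMDiff_snd).contMDiffOn
  · exact (C.quotient.one_mul k).trans (C.quotient.mul_one k).symm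
  · exact (C.prodC.quotient.src_one p).trans (h0 p hp.2).symm
  · change C.prodC.quotient.mul (C.prodC.quotient.one (C.prodC.quotient.tgt k))
      (redEmbArr (k.1.1, k.2)) = C.prodC.quotient.mul k
        (C.prodC.quotient.one (C.prodC.quotient.src k))
    rw [h1 k hk.2, C.prodC.quotient.one_mul, C.prodC.quotient.mul_one]

end Embeddings

/-! ### The embeddings preserve the symplectic forms and the line bundles -/

section Isomorphisms

variable {V₀ : Type*} [NormedAddCommGroup V₀] [NormedSpace ℝ V₀] [FiniteDimensional ℝ V₀]
  {H₀ : Type*} [TopologicalSpace H₀] {I₀ : ModelWithCorners ℝ V₀ H₀} [I₀.Boundaryless]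
  {X₀ : Type*} [TopologicalSpace X₀] [ChartedSpace H₀ X₀] [IsManifold I₀ ∞ X₀] [T2Space X₀]
  {V₁ : Type*} [NormedAddCommGroup V₁] [NormedSpace ℝ V₁]
  {H₁ : Type*} [TopologicalSpace H₁] {I₁ : ModelWithCorners ℝ V₁ H₁}
  {X₁ : Type*} [TopologicalSpace X₁] [ChartedSpace H₁ X₁]
  {G : LieGroupoid I₀ X₀ I₁ X₁} {C : CircleAction G}
  {Ω : ∀ x : X₀, TangentSpace I₀ x →L[ℝ] TangentSpace I₀ x →L[ℝ] ℝ} {c : ℝ} {Φ : X₀ → ℝ}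

/-- A map `x ↦ (x, r x)` to `M × ℂ` with real second component pulls back the product form to the
form on `M`. -/
theorem boxForm_mfderiv_graph (Ω : ∀ x : X₀, TangentSpace I₀ x →L[ℝ] TangentSpace I₀ x →L[ℝ] ℝ)
    {r : X₀ → ℝ} {x : X₀} (hr : MDifferentiableAt I₀ 𝓘(ℝ, ℝ) r x) (v w : TangentSpace I₀ x) :
    boxForm Ω (x, (r x : ℂ))
        (mfderiv I₀ (I₀.prod 𝓘(ℝ, ℂ)) (fun x => (x, (r x : ℂ))) x v)
        (mfderiv I₀ (I₀.prod 𝓘(ℝ, ℂ)) (fun x => (x, (r x : ℂ))) x w) = Ω x v w := by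
  have h1 : HasMFDerivAt I₀ 𝓘(ℝ, ℂ) (fun x => (r x : ℂ)) x
      (Complex.ofRealCLM.comp (mfderiv I₀ 𝓘(ℝ, ℝ) r x)) :=
    Complex.ofRealCLM.hasMFDerivAt.comp x hr.hasMFDerivAt
  have h2 : mfderiv I₀ (I₀.prod 𝓘(ℝ, ℂ)) (fun x => (x, (r x : ℂ))) x = _ :=
    ((hasMFDerivAt_id (I := I₀) x).prodMk h1).mfderiv
  have h3 : ∀ v, mfderiv (I₀.prod 𝓘(ℝ, ℂ)) I₀ Prod.fst (x, (r x : ℂ))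
      (mfderiv I₀ (I₀.prod 𝓘(ℝ, ℂ)) (fun x => (x, (r x : ℂ))) x v) = v := fun v =>
    (DFunLike.congr_fun mfderiv_fst _).trans (congrArg Prod.fst (DFunLike.congr_fun h2 v))
  -- The second component of the graph is real, so the second components of the two tangent vectors
  -- are real and the area form of the plane vanishes on them.
  have h4 : ∀ v, Complex.im (mfderiv (I₀.prod 𝓘(ℝ, ℂ)) 𝓘(ℝ, ℂ) Prod.snd (x, (r x : ℂ))
      (mfderiv I₀ (I₀.prod 𝓘(ℝ, ℂ)) (fun x => (x, (r x : ℂ))) x v)) = 0 := fun v =>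
    congrArg Complex.im ((DFunLike.congr_fun mfderiv_snd _).trans
      (congrArg Prod.snd (DFunLike.congr_fun h2 v)))
  simp only [boxForm, h4, mul_zero, zero_mul, sub_zero]
  exact congrArg₂ (fun v w : TangentSpace I₀ x => Ω x v w) (h3 v) (h3 w)

variable {L : X₀ → Type*} [∀ x, AddCommGroup (L x)] [∀ x, Module ℂ (L x)]
  [TopologicalSpace (TotalSpace ℂ L)] [∀ x, TopologicalSpace (L x)] [FiberBundle ℂ L]
  [VectorBundle ℂ ℂ L] [VectorBundle ℝ ℂ L] [ContMDiffVectorBundle ∞ ℂ L I₀]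
  {B : LineBundleData G L} {lift : ∀ (a : Circle) (x : X₀), L x →ₗ[ℂ] L (C.obj a x)}

theorem LineBundleData.Moves.smul {k : X₁} {u v : TotalSpace ℂ L} (h : B.Moves k u v) (a : ℂ) :
    B.Moves k ⟨u.proj, a • u.2⟩ ⟨v.proj, a • v.2⟩ := by
  obtain ⟨w, rfl, rfl⟩ := h
  exact ⟨a • w, rfl, by rw [map_smul]⟩

theorem LineBundleData.IsHermitianLineBundle.herm_real_smul {S : Set X₀}
    (hB : B.IsHermitianLineBundle S) {x : X₀} (hx : x ∈ S) (r : ℝ) (u v : L x) :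
    B.herm x ((r : ℂ) • u) ((r : ℂ) • v) = r ^ 2 * B.herm x u v := by
  rw [hB.herm_smul x hx, hB.herm_smul_left hx, Complex.conj_ofReal]
  ring

/-- On the slice `z` is real and `z² = 2Φ/c`. The square of `e^{πΦ/c}` cancels the weight
`e^{-πz²}`, and its logarithmic derivative `π dΦ/c` cancels `-π z dz = -π dΦ/c`. The embedded arrows
have circle part `1`, so only `lift_one` is needed for equivariance. -/
theorem isLineBundleIso_cutIso (hB : B.IsPrequantum Ω) (hΩ : IsSymplecticForm G Ω)
    (hΦ : IsMomentMap C Ω c Φ) (hc : 0 < c) (hlift : IsCircleLift C B lift) :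
    IsLineBundleIso B {x | 0 < Φ x} (B.cut C lift) {p | cutMoment c Φ p = 0 ∧ 0 < Φ p.1}
      (cutEmb c Φ) (cutEmbArr G c Φ) (cutIso I₀ L c Φ) where
  base := isSmoothEquivalence_cutEmb hc hΩ hΦ
  bijective x _ := by
    have h : (Real.exp (Real.pi * Φ x / c) : ℂ) ≠ 0 :=
      Complex.ofReal_ne_zero.2 (Real.exp_pos _).ne'
    exact (LinearEquiv.smulOfNeZero ℂ (L x) _ h).bijective
  smooth := by
    intro u hu
    refine contMDiffWithinAt_box_iff.2 ⟨?_, ?_⟩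
    · have h1 : ContMDiff I₀ 𝓘(ℝ, ℂ) ∞ (fun x => (Real.exp (Real.pi * Φ x / c) : ℂ)) := by
        have h2 : ContDiff ℝ ∞ (fun r : ℝ => (Real.exp (Real.pi * r / c) : ℂ)) :=
          Complex.ofRealCLM.contDiff.comp (Real.contDiff_exp.comp (by fun_prop))
        exact h2.contMDiff.comp hΦ.smooth
      exact ContMDiffWithinAt.totalSpace_smul
        ((h1.comp (contMDiff_proj L)).contMDiffAt.contMDiffWithinAt) contMDiffWithinAt_id
    · exact ((contMDiffAt_ofReal_sqrt_moment hc hΦ.smooth hu).comp u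
        (contMDiff_proj L).contMDiffAt).contMDiffWithinAt
  equivariant g u v _ h := by
    refine LineBundleData.quotient_moves_iff.2
      ⟨⟨cutEmb c Φ v.proj, cutIso I₀ L c Φ v.proj v.2⟩, ?_, ?_⟩
    · obtain ⟨w, rfl, rfl⟩ := h
      refine LineBundleData.boxC_moves_iff.2 ⟨?_, rfl, ?_⟩
      · have h := LineBundleData.Moves.smul (B := B) ⟨w, rfl, rfl⟩
          (Real.exp (Real.pi * Φ (G.src g) / c) : ℂ)
        have e : boxProj (⟨cutEmb c Φ (G.tgt g), cutIso I₀ L c Φ (G.tgt g) (B.move g w)⟩ :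
            TotalSpace ℂ (BoxFiber I₀ L))
            = ⟨G.tgt g, (Real.exp (Real.pi * Φ (G.src g) / c) : ℂ) • B.move g w⟩ := by
          rw [hΦ.invariant g]
          rfl
        rw [e]
        exact h
      · change (Real.sqrt (2 * Φ (G.tgt g) / c) : ℂ) = Real.sqrt (2 * Φ (G.src g) / c)
        rw [hΦ.invariant g]
    · exact (hlift.box.lift_one _ _).symm
  herm_eq x hx u v := by
    have h1 := hB.isHermitianLineBundle.herm_real_smul (mem_univ x)
      (Real.exp (Real.pi * Φ x / c)) u v
    refine (congrArg ((Real.exp (-Real.pi * ‖(Real.sqrt (2 * Φ x / c) : ℂ)‖ ^ 2) : ℂ) * ·)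
      h1).trans ?_
    have hx' : 0 < Φ x := hx
    rw [← mul_assoc, Complex.norm_real, Real.norm_eq_abs, sq_abs,
      Real.sq_sqrt (by positivity), ← Complex.ofReal_pow, ← Complex.ofReal_mul, ← Real.exp_nat_mul,
      ← Real.exp_add]
    have h2 : -Real.pi * (2 * Φ x / c) + ((2 : ℕ) : ℝ) * (Real.pi * Φ x / c) = 0 := by
      push_cast
      ring
    rw [h2, Real.exp_zero, Complex.ofReal_one, one_mul]
  covDeriv_eq γ u hu hγ t := by
    have hγs : ContMDiff 𝓘(ℝ, ℝ) I₀ ∞ γ := (contMDiff_proj L).comp hu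
    have hf : ContDiff ℝ ∞ (fun s => Φ (γ s)) := (hΦ.smooth.comp hγs).contDiff
    have hfd : HasDerivAt (fun s => Φ (γ s)) (deriv (fun s => Φ (γ s)) t) t :=
      (hf.differentiable (by simp) t).hasDerivAt
    set f' := deriv (fun s => Φ (γ s)) t
    have hpos : 0 < Φ (γ t) := hγ t
    have he : HasDerivAt (fun s => (Real.exp (Real.pi * Φ (γ s) / c) : ℂ))
        ((Real.exp (Real.pi * Φ (γ t) / c) * (Real.pi * f' / c) : ℝ) : ℂ) t :=
      (((hfd.const_mul Real.pi).div_const c).exp).ofReal_comp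
    have hr : HasDerivAt (fun s => (Real.sqrt (2 * Φ (γ s) / c) : ℂ))
        ((2 * f' / c / (2 * Real.sqrt (2 * Φ (γ t) / c)) : ℝ) : ℂ) t :=
      (((hfd.const_mul 2).div_const c).sqrt (by positivity)).ofReal_comp
    have hes : IsSmoothAlong I₀ γ (fun s => (Real.exp (Real.pi * Φ (γ s) / c) : ℂ) • u s) := by
      have h2 : ContDiff ℝ ∞ (fun s => (Real.exp (Real.pi * Φ (γ s) / c) : ℂ)) :=
        Complex.ofRealCLM.contDiff.comp (Real.contDiff_exp.comp
          ((contDiff_const.mul hf).div_const c))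
      intro s
      exact ContMDiffWithinAt.totalSpace_smul
        (h2.contMDiff.contMDiffAt.contMDiffWithinAt) (hu s).contMDiffWithinAt
    have h1 := hB.isHermitianLineBundle.covDeriv_smul hes hu (fun _ => mem_univ _)
      he.differentiableAt (Eventually.of_forall fun _ => rfl)
    rw [he.deriv] at h1
    refine (congrArg₂ (fun (D : L (γ t)) (z' : ℂ) =>
      D + (-Real.pi * (Real.sqrt (2 * Φ (γ t) / c) : ℂ) * starRingEnd ℂ z') •
        ((Real.exp (Real.pi * Φ (γ t) / c) : ℂ) • u t)) h1 hr.deriv).trans ?_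
    -- Positivity of `Φ` keeps the square root nonzero, so that it cancels against the denominator
    -- of its own derivative.
    have hs : Real.sqrt (2 * Φ (γ t) / c) ≠ 0 := (Real.sqrt_pos.2 (by positivity)).ne'
    have h3 : Real.exp (Real.pi * Φ (γ t) / c) * (Real.pi * f' / c)
        + -Real.pi * Real.sqrt (2 * Φ (γ t) / c) * (2 * f' / c / (2 * Real.sqrt (2 * Φ (γ t) / c)))
          * Real.exp (Real.pi * Φ (γ t) / c) = 0 := by
      field_simp
      ring
    have h4 : ∀ (α β : ℂ) (w D : L (γ t)), α + β = 0 → α • w + D + β • w = D := by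
      intro α β w D h
      rw [add_right_comm, ← add_smul, h, zero_smul, zero_add]
    rw [smul_smul, Complex.conj_ofReal]
    refine h4 _ _ _ _ ?_
    exact_mod_cast congrArg (fun r : ℝ => (r : ℂ)) h3

/-- At `z = 0` the weight is `1` and the form `-π z d\bar z` vanishes; the lift to `L_ℂ` is trivial,
so the identity of `L` respects all structures. -/
theorem isLineBundleIso_redIso (B : LineBundleData G L)
    (lift : ∀ (a : Circle) (x : X₀), L x →ₗ[ℂ] L (C.obj a x)) (c : ℝ) (Φ : X₀ → ℝ) :
    IsLineBundleIso (B.red C lift) {x | Φ x = 0} (B.cut C lift)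
      {p | cutMoment c Φ p = 0 ∧ p.2 = 0} redEmb redEmbArr (redIso I₀ L) where
  base := isSmoothEquivalence_redEmb C c Φ
  bijective _ _ := Function.bijective_id
  smooth u _ := contMDiffWithinAt_box_iff.2 ⟨contMDiffWithinAt_id, contMDiffWithinAt_const⟩
  equivariant k u v _ h := by
    obtain ⟨w, hw, rfl⟩ := LineBundleData.quotient_moves_iff.1 h
    refine LineBundleData.quotient_moves_iff.2 ⟨⟨redEmb w.proj, w.2⟩,
      LineBundleData.boxC_moves_iff.2 ⟨hw, rfl, rfl⟩, box_ext rfl ?_⟩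
    exact (mul_zero _).symm
  herm_eq x _ u v := by
    have h : (Real.exp (-Real.pi * ‖(0 : ℂ)‖ ^ 2) : ℂ) = 1 := by simp
    exact (congrArg (· * B.herm x u v) h).trans (one_mul _)
  covDeriv_eq γ u _ _ t := by
    have h : ∀ (D w : L (γ t)) (z : ℂ), D + (-Real.pi * 0 * starRingEnd ℂ z) • w = D := by
      intro D w z
      rw [mul_zero, zero_mul, zero_smul, add_zero]
    exact h _ _ _

end Isomorphisms

end


theorem mainTheorem10
    {V₀ : Type*} [NormedAddCommGroup V₀] [NormedSpace ℝ V₀] [FiniteDimensional ℝ V₀]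
    {H₀ : Type*} [TopologicalSpace H₀] {I₀ : ModelWithCorners ℝ V₀ H₀} [I₀.Boundaryless]
    {X₀ : Type*} [TopologicalSpace X₀] [ChartedSpace H₀ X₀] [IsManifold I₀ ∞ X₀] [T2Space X₀]
    {V₁ : Type*} [NormedAddCommGroup V₁] [NormedSpace ℝ V₁] [FiniteDimensional ℝ V₁]
    {H₁ : Type*} [TopologicalSpace H₁] {I₁ : ModelWithCorners ℝ V₁ H₁} [I₁.Boundaryless]
    {X₁ : Type*} [TopologicalSpace X₁] [ChartedSpace H₁ X₁] [IsManifold I₁ ∞ X₁] [T2Space X₁]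
    (G : LieGroupoid I₀ X₀ I₁ X₁) (hG : G.IsOrbifold)
    (Ω : ∀ x : X₀, TangentSpace I₀ x →L[ℝ] TangentSpace I₀ x →L[ℝ] ℝ)
    (hΩ : IsSymplecticForm G Ω)
    (C : CircleAction G) (c : ℝ) (hc : 0 < c) (Φ : X₀ → ℝ) (hΦ : IsMomentMap C Ω c Φ)
    (hreg : ∀ x, Φ x = 0 → mfderiv I₀ 𝓘(ℝ, ℝ) Φ x ≠ 0)
    {L : X₀ → Type*} [∀ x, AddCommGroup (L x)] [∀ x, Module ℂ (L x)]
    [TopologicalSpace (TotalSpace ℂ L)] [∀ x, TopologicalSpace (L x)] [FiberBundle ℂ L]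
    [VectorBundle ℂ ℂ L] [VectorBundle ℝ ℂ L] [ContMDiffVectorBundle ∞ ℂ L I₀]
    (B : LineBundleData G L) (hB : B.IsPrequantum Ω)
    (lift : ∀ (a : Circle) (x : X₀), L x →ₗ[ℂ] L (C.obj a x)) (hlift : IsCircleLift C B lift)
    (hK : SatisfiesKostant C B lift c Φ) :
    (∀ x, 0 < Φ x → ∀ v w : TangentSpace I₀ x,
      boxForm Ω (cutEmb c Φ x) (mfderiv I₀ (I₀.prod 𝓘(ℝ, ℂ)) (cutEmb c Φ) x v)
        (mfderiv I₀ (I₀.prod 𝓘(ℝ, ℂ)) (cutEmb c Φ) x w) = Ω x v w) ∧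
    (∀ x, Φ x = 0 → ∀ v w : TangentSpace I₀ x,
      boxForm Ω (redEmb x) (mfderiv I₀ (I₀.prod 𝓘(ℝ, ℂ)) redEmb x v)
        (mfderiv I₀ (I₀.prod 𝓘(ℝ, ℂ)) redEmb x w) = Ω x v w) ∧
    (B.red C lift).IsHermitianLineBundle {x | Φ x = 0} ∧
    (B.cut C lift).IsHermitianLineBundle {p | cutMoment c Φ p = 0} ∧
    IsLineBundleIso B {x | 0 < Φ x}
      (B.cut C lift) {p | cutMoment c Φ p = 0 ∧ 0 < Φ p.1}
      (cutEmb c Φ) (cutEmbArr G c Φ) (cutIso I₀ L c Φ) ∧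
    IsLineBundleIso (B.red C lift) {x | Φ x = 0}
      (B.cut C lift) {p | cutMoment c Φ p = 0 ∧ p.2 = 0}
      redEmb redEmbArr (redIso I₀ L) := by
  have hc0 : c ≠ 0 := hc.ne'
  refine ⟨fun x hx v w => ?_, fun x _ v w => ?_, hB.red hΩ hΦ hc0 hlift hK,
    hB.cut hΩ hΦ hc0 hlift hK, isLineBundleIso_cutIso hB hΩ hΦ hc hlift,
    isLineBundleIso_redIso B lift c Φ⟩
  · exact boxForm_mfderiv_graph Ω
      ((contMDiffAt_sqrt_moment hc hΦ.smooth hx).mdifferentiableAt (by simp)) v w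
  -- The embedding at `z = 0` is the graph of the real function `0`, so the same pullback
  -- computation applies.
  · have h0 : (redEmb : X₀ → X₀ × ℂ) = fun x => (x, ((0 : ℝ) : ℂ)) :=
      funext fun x => Prod.ext rfl Complex.ofReal_zero.symm
    rw [h0]
    exact boxForm_mfderiv_graph Ω (r := fun _ => 0) mdifferentiableAt_const v w
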